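/- Let $G$ be a connected reductive linear algebraic group over $\mathbb{C}$ with Lie algebra $\mathfrak{g}$ and centre $\mathfrak{z}(\mathfrak{g})$. Let $X$ be a finite-dimensional, Hausdorff, $\sigma$-compact complex manifold (for example a compact connected Kähler manifold), and let $\pi : E_G \to X$ be a holomorphic principal $G$-bundle (right action). Let $\mathfrak{E} := E_G \times_G \mathfrak{g}$ be the adjoint bundle, with the Lie bracket on its fibres, and $\mathfrak{Z} := E_G \times_G \mathfrak{z}(\mathfrak{g}) \subset \mathfrak{E}$, which is canonically the trivial bundle $X \times \mathfrak{z}(\mathfrak{g})$. A smooth section $s$ of $\mathfrak{E}$ corresponds to the smooth function $f_s : E_G \to \mathfrak{g}$ with $s(\pi(p)) = [p, f_s(p)]$, which satisfies $f_s(p \cdot g) = \mathrm{Ad}(g^{-1}) f_s(p)$. Let $D$ be a smooth connection on the complex vector bundle $\mathfrak{E}$ such that 1. $D[s,t] = [Ds, t] + [s, Dt]$ for all smooth sections $s, t$ of $\mathfrak{E}$, and 2. $D|_{\mathfrak{Z}} = d$, that is, $D$ sends the section of $\mathfrak{Z}$ given by a smooth function $h : X \to \mathfrak{z}(\mathfrak{g})$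 to the $\mathfrak{z}(\mathfrak{g})$-valued form $dh$. Then $D$ is induced from a smooth connection on $E_G$: there is a connection form $\omega \in \Omega^1(E_G, \mathfrak{g})$ such that $f_{Ds} = d f_s + [\omega, f_s]$ for every smooth section $s$ of $\mathfrak{E}$, where $f_{Ds}$ denotes the $\mathfrak{g}$-valued one-form on $E_G$ corresponding to $Ds$. Moreover, if $D$ is compatible with the holomorphic structure of $\mathfrak{E}$ (that is, $D^{0,1} = \overline{\partial}_{\mathfrak{E}}$), then the connection can be chosen compatible with the holomorphic structure of $E_G$ (that is, $\omega$ is of type $(1,0)$). -/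

import Mathlib

open scoped Manifold ContDiff
open VectorField

noncomputable section

/-! ### Complex manifolds as smooth real manifolds -/

section RealStructure

variable {E : Type*} [NormedAddCommGroup E] [NormedSpace ℂ E]

/-- A complex manifold is, with the same charts, a real manifold. -/
instance isManifold_real_of_complex {n : ℕ∞ω} {M : Type*} [TopologicalSpace M]
    [ChartedSpace E M] [IsManifold 𝓘(ℂ, E) n M] : IsManifold 𝓘(ℝ, E) n M := by
  refine isManifold_of_contDiffOn _ _ _ fun e e' he he' => ?_
  have h := (contDiffGroupoid n 𝓘(ℂ, E)).compatible he he'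
  rw [contDiffGroupoid, mem_groupoid_of_pregroupoid] at h
  exact ContDiffOn.restrict_scalars ℝ h.1

/-- The complex structure (multiplication by `i`) on the real tangent spaces of a complex
manifold. -/
def tangentJ {M : Type*} [TopologicalSpace M] [ChartedSpace E M] (p : M) :
    TangentSpace 𝓘(ℝ, E) p →ₗ[ℝ] TangentSpace 𝓘(ℝ, E) p :=
  ((LinearMap.lsmul ℂ E Complex.I).restrictScalars ℝ : E →ₗ[ℝ] E)

end RealStructure

/-! ### The adjoint action of a complex Lie group on its Lie algebra -/

section AdjointAction

variable {EG : Type*} [NormedAddCommGroup EG] [NormedSpace ℂ EG]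
  {G : Type*} [TopologicalSpace G] [ChartedSpace EG G] [Group G]

/-- `Ad g`, the derivative at the identity of the conjugation `h ↦ g * h * g⁻¹`. -/
def Ad (g : G) : GroupLieAlgebra 𝓘(ℂ, EG) G →ₗ[ℂ] GroupLieAlgebra 𝓘(ℂ, EG) G :=
  (mfderiv 𝓘(ℂ, EG) 𝓘(ℂ, EG) (fun h : G => g * h * g⁻¹) 1 : EG →L[ℂ] EG).toLinearMap

theorem Ad_apply (g : G) (v : GroupLieAlgebra 𝓘(ℂ, EG) G) :
    Ad g v = mfderiv 𝓘(ℂ, EG) 𝓘(ℂ, EG) (fun h : G => g * h * g⁻¹) 1 v := rfl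

theorem Ad_one : Ad (EG := EG) (1 : G) = LinearMap.id := by
  ext v
  rw [Ad_apply]
  have : (fun h : G => 1 * h * 1⁻¹) = id := by ext; simp
  rw [this, mfderiv_id]
  rfl

variable [LieGroup 𝓘(ℂ, EG) ω G]

theorem mdifferentiable_conj (g : G) :
    MDifferentiable 𝓘(ℂ, EG) 𝓘(ℂ, EG) (fun h : G => g * h * g⁻¹) :=
  ((contMDiff_mul_right (I := 𝓘(ℂ, EG)) (n := ω) (a := g⁻¹)).comp
    (contMDiff_mul_left (I := 𝓘(ℂ, EG)) (n := ω) (a := g))).mdifferentiable (by simp)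

theorem Ad_mul (g h : G) : Ad (EG := EG) (g * h) = Ad g ∘ₗ Ad h := by
  ext v
  have e : (fun x : G => g * h * x * (g * h)⁻¹) =
      (fun x => g * x * g⁻¹) ∘ (fun x => h * x * h⁻¹) := by
    ext x; simp [mul_assoc]
  have key := mfderiv_comp_apply (I' := 𝓘(ℂ, EG)) (1 : G) (mdifferentiable_conj g _)
    (mdifferentiable_conj (EG := EG) h _) v
  have aux : ∀ (x : G) (_ : x = 1) (u : EG),
      (mfderiv 𝓘(ℂ, EG) 𝓘(ℂ, EG) (fun h : G => g * h * g⁻¹) x : EG →L[ℂ] EG) u =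
        (mfderiv 𝓘(ℂ, EG) 𝓘(ℂ, EG) (fun h : G => g * h * g⁻¹) 1 : EG →L[ℂ] EG) u := by
    rintro _ rfl u; rfl
  have e' : (mfderiv 𝓘(ℂ, EG) 𝓘(ℂ, EG) (fun x : G => g * h * x * (g * h)⁻¹) 1 : EG →L[ℂ] EG) =
      (mfderiv 𝓘(ℂ, EG) 𝓘(ℂ, EG)
        ((fun x : G => g * x * g⁻¹) ∘ (fun x => h * x * h⁻¹)) 1 : EG →L[ℂ] EG) := by
    rw [e]
  exact (congrArg (fun L : EG →L[ℂ] EG => L v) e').trans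
    (key.trans (aux (h * 1 * h⁻¹) (by simp) _))

theorem Ad_lie [FiniteDimensional ℂ EG] (g : G) (v w : GroupLieAlgebra 𝓘(ℂ, EG) G) :
    Ad g ⁅v, w⁆ = ⁅Ad g v, Ad g w⁆ := by
  have : CompleteSpace EG := FiniteDimensional.complete ℂ EG
  set φ : G → G := fun h => g * h * g⁻¹ with hφ
  set ψ : G → G := fun h => g⁻¹ * h * g with hψ
  have dφ : MDifferentiable 𝓘(ℂ, EG) 𝓘(ℂ, EG) φ := mdifferentiable_conj g
  have dψ : MDifferentiable 𝓘(ℂ, EG) 𝓘(ℂ, EG) ψ := by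
    simpa [hψ] using mdifferentiable_conj (EG := EG) g⁻¹
  have dL : ∀ a : G, MDifferentiable 𝓘(ℂ, EG) 𝓘(ℂ, EG) (fun h : G => a * h) := fun a =>
    (contMDiff_mul_left (I := 𝓘(ℂ, EG)) (n := ω) (a := a)).mdifferentiable (by simp)
  have hφψ : φ ∘ ψ = id := by ext x; simp [hφ, hψ, mul_assoc]
  have hψφ : ψ ∘ φ = id := by ext x; simp [hφ, hψ, mul_assoc]
  have hφ1 : φ 1 = 1 := by simp [hφ]
  -- left-invariant fields are related by conjugation
  have rel : ∀ (u : GroupLieAlgebra 𝓘(ℂ, EG) G) (h : G),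
      (mfderiv 𝓘(ℂ, EG) 𝓘(ℂ, EG) φ h : EG →L[ℂ] EG) (mulInvariantVectorField u h) =
        (mulInvariantVectorField (Ad g u) (φ h) : EG) := by
    intro u h
    have k1 := mfderiv_comp_apply (I' := 𝓘(ℂ, EG)) (1 : G) (dφ (h * 1)) (dL h 1) u
    have k2 := mfderiv_comp_apply (I' := 𝓘(ℂ, EG)) (1 : G) (dL (φ h) (φ 1)) (dφ 1) u
    have e : φ ∘ (fun x => h * x) = (fun x => φ h * x) ∘ φ := by
      ext x; simp [hφ, mul_assoc]
    have e' : (mfderiv 𝓘(ℂ, EG) 𝓘(ℂ, EG) (φ ∘ (fun x => h * x)) 1 : EG →L[ℂ] EG) =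
        (mfderiv 𝓘(ℂ, EG) 𝓘(ℂ, EG) ((fun x => φ h * x) ∘ φ) 1 : EG →L[ℂ] EG) := by rw [e]
    have a1 : ∀ (x : G) (_ : x = h) (z : EG),
        (mfderiv 𝓘(ℂ, EG) 𝓘(ℂ, EG) φ x : EG →L[ℂ] EG) z =
          (mfderiv 𝓘(ℂ, EG) 𝓘(ℂ, EG) φ h : EG →L[ℂ] EG) z := by
      rintro _ rfl z; rfl
    have a2 : ∀ (x : G) (_ : x = 1) (z : EG),
        (mfderiv 𝓘(ℂ, EG) 𝓘(ℂ, EG) (fun y => φ h * y) x : EG →L[ℂ] EG) z =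
          (mfderiv 𝓘(ℂ, EG) 𝓘(ℂ, EG) (fun y => φ h * y) 1 : EG →L[ℂ] EG) z := by
      rintro _ rfl z; rfl
    exact (a1 (h * 1) (mul_one h) _).symm.trans (k1.symm.trans
      ((congrArg (fun L : EG →L[ℂ] EG => L u) e').trans (k2.trans (a2 (φ 1) hφ1 _))))
  -- the differential of conjugation is invertible
  have inv : ∀ h : G, ∃ e : TangentSpace 𝓘(ℂ, EG) h ≃L[ℂ] TangentSpace 𝓘(ℂ, EG) (φ h),
      (e : TangentSpace 𝓘(ℂ, EG) h →L[ℂ] TangentSpace 𝓘(ℂ, EG) (φ h)) =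
        mfderiv 𝓘(ℂ, EG) 𝓘(ℂ, EG) φ h := by
    intro h
    let a : EG →L[ℂ] EG := mfderiv 𝓘(ℂ, EG) 𝓘(ℂ, EG) φ h
    let b : EG →L[ℂ] EG := mfderiv 𝓘(ℂ, EG) 𝓘(ℂ, EG) ψ (φ h)
    have hba : ∀ z : EG, b (a z) = z := by
      intro z
      have k := mfderiv_comp_apply (I' := 𝓘(ℂ, EG)) h (dψ (φ h)) (dφ h) z
      have e' : (mfderiv 𝓘(ℂ, EG) 𝓘(ℂ, EG) (ψ ∘ φ) h : EG →L[ℂ] EG) =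
          (mfderiv 𝓘(ℂ, EG) 𝓘(ℂ, EG) id h : EG →L[ℂ] EG) := by rw [hψφ]
      have e'' : (mfderiv 𝓘(ℂ, EG) 𝓘(ℂ, EG) id h : EG →L[ℂ] EG) = ContinuousLinearMap.id ℂ EG :=
        mfderiv_id
      exact k.symm.trans (congrArg (fun L : EG →L[ℂ] EG => L z) (e'.trans e''))
    have hab : Function.Surjective a :=
      LinearMap.surjective_of_injective (f := a.toLinearMap)
        (Function.LeftInverse.injective (g := b) hba)
    have hab' : ∀ z : EG, a (b z) = z := by
      intro z
      obtain ⟨y, rfl⟩ := hab z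
      rw [hba]
    let e : EG ≃L[ℂ] EG := ContinuousLinearEquiv.equivOfInverse a b hba hab'
    exact ⟨e, rfl⟩
  have pull : ∀ u : GroupLieAlgebra 𝓘(ℂ, EG) G,
      mpullback 𝓘(ℂ, EG) 𝓘(ℂ, EG) φ (mulInvariantVectorField (Ad g u)) =
        mulInvariantVectorField u := by
    intro u
    ext h
    obtain ⟨e, he⟩ := inv h
    have r : e (mulInvariantVectorField u h) = mulInvariantVectorField (Ad g u) (φ h) := by
      refine Eq.trans ?_ (rel u h)
      exact congrArg (fun L : EG →L[ℂ] EG => L (mulInvariantVectorField u h)) he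
    rw [mpullback_apply, ← he, ContinuousLinearMap.inverse_equiv, ← r]
    exact e.symm_apply_apply _
  have hb := mpullback_mlieBracket (I := 𝓘(ℂ, EG)) (I' := 𝓘(ℂ, EG)) (n := ω) (f := φ) (x₀ := 1)
    (V := mulInvariantVectorField (Ad g v)) (W := mulInvariantVectorField (Ad g w))
    (mdifferentiableAt_mulInvariantVectorField _) (mdifferentiableAt_mulInvariantVectorField _)
    (((contMDiff_mul_right (I := 𝓘(ℂ, EG)) (n := ω) (a := g⁻¹)).comp
      (contMDiff_mul_left (I := 𝓘(ℂ, EG)) (n := ω) (a := g))) 1) le_top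
  rw [pull, pull, mpullback_apply] at hb
  obtain ⟨e, he⟩ := inv 1
  rw [← he, ContinuousLinearMap.inverse_equiv] at hb
  have hb' := congrArg e hb
  have hb'' : mlieBracket 𝓘(ℂ, EG) (mulInvariantVectorField (Ad g v))
      (mulInvariantVectorField (Ad g w)) (φ 1) = e ⁅v, w⁆ :=
    (e.apply_symm_apply _).symm.trans hb'
  have fin1 : (e ⁅v, w⁆ : EG) = Ad g ⁅v, w⁆ :=
    congrArg (fun L : EG →L[ℂ] EG => L (⁅v, w⁆ : GroupLieAlgebra 𝓘(ℂ, EG) G)) he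
  have a3 : ∀ (x : G) (_ : x = 1),
      (mlieBracket 𝓘(ℂ, EG) (mulInvariantVectorField (Ad g v))
        (mulInvariantVectorField (Ad g w)) x : EG) =
      (mlieBracket 𝓘(ℂ, EG) (mulInvariantVectorField (Ad g v))
        (mulInvariantVectorField (Ad g w)) 1 : EG) := by
    rintro _ rfl; rfl
  exact fin1.symm.trans (Eq.trans hb''.symm (a3 (φ 1) hφ1))

end AdjointAction

/-! ### Connected reductive linear algebraic groups over `ℂ` -/

section LinearAlgebraicGroup

/-- Zariski closed subsets of `GL n ℂ`: common zero loci of polynomials in the matrix entries. -/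
def IsZariskiClosed {n : ℕ} (S : Set (GL (Fin n) ℂ)) : Prop :=
  ∃ I : Set (MvPolynomial (Fin n × Fin n) ℂ), ∀ g : GL (Fin n) ℂ,
    g ∈ S ↔ ∀ F ∈ I, MvPolynomial.eval (fun ij => (g : Matrix (Fin n) (Fin n) ℂ) ij.1 ij.2) F = 0

/-- A linear algebraic structure on a complex Lie group `G`: a holomorphic embedding of `G` as a
Zariski closed subgroup of some `GL n ℂ`. -/
structure LinearAlgebraicStructure (EG : Type*) [NormedAddCommGroup EG] [NormedSpace ℂ EG]
    (G : Type*) [TopologicalSpace G] [ChartedSpace EG G] [Group G] where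
  n : ℕ
  ρ : G →* GL (Fin n) ℂ
  isEmbedding : Topology.IsEmbedding ρ
  holomorphic : ∀ i j, ContMDiff 𝓘(ℂ, EG) 𝓘(ℂ, ℂ) ω
    (fun g => (ρ g : Matrix (Fin n) (Fin n) ℂ) i j)
  immersion : ∀ v : GroupLieAlgebra 𝓘(ℂ, EG) G,
    (∀ i j, mvfderiv 𝓘(ℂ, EG) (fun g : G => (ρ g : Matrix (Fin n) (Fin n) ℂ) i j) 1 v = 0) → v = 0
  isZariskiClosed : IsZariskiClosed (ρ.range : Set (GL (Fin n) ℂ))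

/-- A linear algebraic group is reductive if its unipotent radical is trivial, i.e. if it has no
nontrivial connected normal unipotent algebraic subgroup. -/
def LinearAlgebraicStructure.IsReductive {EG : Type*} [NormedAddCommGroup EG] [NormedSpace ℂ EG]
    {G : Type*} [TopologicalSpace G] [ChartedSpace EG G] [Group G]
    (A : LinearAlgebraicStructure EG G) : Prop :=
  ∀ U : Subgroup G, U.Normal → IsConnected (U : Set G) →
    IsZariskiClosed (A.ρ '' (U : Set G)) →
    (∀ u ∈ U, IsNilpotent ((A.ρ u : Matrix (Fin A.n) (Fin A.n) ℂ) - 1)) → U = ⊥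

end LinearAlgebraicGroup

/-! ### Holomorphic principal bundles and the adjoint bundle -/

/-- A holomorphic principal `G`-bundle `E_G = P → X`, with `G` acting on the right. -/
structure HolomorphicPrincipalBundle
    (EX : Type*) [NormedAddCommGroup EX] [NormedSpace ℂ EX]
    (X : Type*) [TopologicalSpace X] [ChartedSpace EX X]
    (EG : Type*) [NormedAddCommGroup EG] [NormedSpace ℂ EG]
    (G : Type*) [TopologicalSpace G] [ChartedSpace EG G] [Group G]
    (EP : Type*) [NormedAddCommGroup EP] [NormedSpace ℂ EP]
    (P : Type*) [TopologicalSpace P] [ChartedSpace EP P] where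
  proj : P → X
  act : P → G → P
  act_one : ∀ p, act p 1 = p
  act_mul : ∀ p g h, act p (g * h) = act (act p g) h
  proj_act : ∀ p g, proj (act p g) = proj p
  holomorphic_proj : ContMDiff 𝓘(ℂ, EP) 𝓘(ℂ, EX) ω proj
  holomorphic_act : ContMDiff (𝓘(ℂ, EP).prod 𝓘(ℂ, EG)) 𝓘(ℂ, EP) ω
    (fun q : P × G => act q.1 q.2)
  /-- Local triviality: over a neighbourhood `U` of any point there is a `G`-equivariant
  biholomorphism `U × G ≃ proj ⁻¹' U` over `U`. -/
  locally_trivial : ∀ x : X, ∃ Φ : OpenPartialHomeomorph (X × G) P, ∃ U : Set X, x ∈ U ∧ IsOpen U ∧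
    Φ.source = U ×ˢ Set.univ ∧ Φ.target = proj ⁻¹' U ∧
    ContMDiffOn (𝓘(ℂ, EX).prod 𝓘(ℂ, EG)) 𝓘(ℂ, EP) ω Φ Φ.source ∧
    ContMDiffOn 𝓘(ℂ, EP) (𝓘(ℂ, EX).prod 𝓘(ℂ, EG)) ω Φ.symm Φ.target ∧
    (∀ y ∈ U, ∀ g, proj (Φ (y, g)) = y) ∧
    ∀ y ∈ U, ∀ g h, Φ (y, g * h) = act (Φ (y, g)) h

namespace HolomorphicPrincipalBundle

section AdjointBundle

variable {EX : Type*} [NormedAddCommGroup EX] [NormedSpace ℂ EX]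
  {X : Type*} [TopologicalSpace X] [ChartedSpace EX X]
  {EG : Type*} [NormedAddCommGroup EG] [NormedSpace ℂ EG]
  {G : Type*} [TopologicalSpace G] [ChartedSpace EG G] [Group G]
  {EP : Type*} [NormedAddCommGroup EP] [NormedSpace ℂ EP]
  {P : Type*} [TopologicalSpace P] [ChartedSpace EP P]
  (B : HolomorphicPrincipalBundle EX X EG G EP P)

/-- The fibre of `E_G` over `x`. -/
abbrev Fiber (x : X) : Type _ := {p : P // B.proj p = x}

theorem fiber_nonempty (x : X) : Nonempty (B.Fiber x) := by
  obtain ⟨Φ, U, hx, -, -, -, -, -, hp, -⟩ := B.locally_trivial x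
  exact ⟨⟨Φ (x, 1), hp x hx 1⟩⟩

theorem exists_eq_act {p q : P} (h : B.proj p = B.proj q) : ∃ g, q = B.act p g := by
  obtain ⟨Φ, U, hx, -, hs, ht, -, -, hp, he⟩ := B.locally_trivial (B.proj q)
  have key : ∀ r : P, B.proj r = B.proj q → ∃ g, r = Φ (B.proj q, g) := by
    intro r hr
    have hrt : r ∈ Φ.target := by rw [ht]; simpa [hr] using hx
    have h1 := Φ.map_target hrt
    rw [hs] at h1
    refine ⟨(Φ.symm r).2, ?_⟩
    have h2 := hp _ h1.1 (Φ.symm r).2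
    rw [Prod.mk.eta, Φ.right_inv hrt, hr] at h2
    rw [h2, Prod.mk.eta, Φ.right_inv hrt]
  obtain ⟨a, rfl⟩ := key p h
  obtain ⟨b, hb⟩ := key q rfl
  exact ⟨a⁻¹ * b, by rw [← he _ hx, mul_inv_cancel_left, ← hb]⟩

theorem act_injective (p : P) : Function.Injective (B.act p) := by
  obtain ⟨Φ, U, hx, -, hs, ht, -, -, hp, he⟩ := B.locally_trivial (B.proj p)
  have hpt : p ∈ Φ.target := by rw [ht]; exact hx
  have h1 := Φ.map_target hpt
  rw [hs] at h1
  intro g h hgh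
  have key : ∀ k, B.act p k = Φ ((Φ.symm p).1, (Φ.symm p).2 * k) := by
    intro k
    rw [he _ h1.1, Prod.mk.eta, Φ.right_inv hpt]
  simp only [key] at hgh
  have := Φ.injOn (by rw [hs]; exact ⟨h1.1, Set.mem_univ _⟩)
    (by rw [hs]; exact ⟨h1.1, Set.mem_univ _⟩) hgh
  simpa using this

variable [LieGroup 𝓘(ℂ, EG) ω G]

/-- The relation `(p, ξ) ∼ (p · g, Ad g⁻¹ ξ)` on `(E_G)_x × 𝔤`. -/
def adSetoid (x : X) : Setoid (B.Fiber x × GroupLieAlgebra 𝓘(ℂ, EG) G) where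
  r a b := ∃ g : G, b.1.1 = B.act a.1.1 g ∧ b.2 = Ad g⁻¹ a.2
  iseqv :=
    { refl := fun a => ⟨1, (B.act_one _).symm, by simp [Ad_one]⟩
      symm := by
        rintro a b ⟨g, h1, h2⟩
        refine ⟨g⁻¹, ?_, ?_⟩
        · rw [h1, ← B.act_mul, mul_inv_cancel, B.act_one]
        · rw [h2, ← LinearMap.comp_apply, ← Ad_mul]
          simp [Ad_one]
      trans := by
        rintro a b c ⟨g, h1, h2⟩ ⟨h, h3, h4⟩
        refine ⟨g * h, ?_, ?_⟩
        · rw [h3, h1, B.act_mul]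
        · rw [h4, h2, mul_inv_rev, Ad_mul, LinearMap.comp_apply] }

/-- The fibre over `x` of the adjoint bundle `𝔈 = E_G ×_G 𝔤`. -/
def AdFiber (x : X) : Type _ := Quotient (B.adSetoid x)

/-- The class `[p, ξ]` in the adjoint bundle. -/
def adMk {x : X} (p : B.Fiber x) (ξ : GroupLieAlgebra 𝓘(ℂ, EG) G) : B.AdFiber x :=
  Quotient.mk (B.adSetoid x) (p, ξ)

theorem adMk_bijective {x : X} (p : B.Fiber x) : Function.Bijective (B.adMk p) := by
  constructor
  · intro ξ η h
    obtain ⟨g, h1, h2⟩ := Quotient.exact h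
    have : g = 1 := B.act_injective p.1 (by rw [B.act_one]; exact h1.symm)
    subst this
    simpa [Ad_one] using h2.symm
  · intro e
    induction e using Quotient.inductionOn with
    | _ a =>
      obtain ⟨q, ξ⟩ := a
      obtain ⟨g, hg⟩ := B.exists_eq_act (q.2.trans p.2.symm)
      exact ⟨Ad g⁻¹ ξ, (Quotient.sound (s := B.adSetoid x) ⟨g, hg, rfl⟩).symm⟩

theorem adMk_eq {x : X} (p q : B.Fiber x) (g : G) (h : q.1 = B.act p.1 g)
    (ξ : GroupLieAlgebra 𝓘(ℂ, EG) G) : B.adMk p ξ = B.adMk q (Ad g⁻¹ ξ) :=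
  Quotient.sound (s := B.adSetoid x) ⟨g, h, rfl⟩

/-- A reference identification `𝔈_x ≃ 𝔤`, used to define the algebraic structure of the fibre. -/
def adChart (x : X) : B.AdFiber x ≃ GroupLieAlgebra 𝓘(ℂ, EG) G :=
  (Equiv.ofBijective _ (B.adMk_bijective (Classical.choice (B.fiber_nonempty x)))).symm

variable [FiniteDimensional ℂ EG]

instance (x : X) : LieRing (B.AdFiber x) :=
  (B.adChart x).lieRing

instance (x : X) : LieAlgebra ℂ (B.AdFiber x) :=
  (B.adChart x).lieAlgebra ℂ

/-- Every point `p` of `E_G` over `x` gives an isomorphism of Lie algebras `𝔤 ≃ 𝔈_x`,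
`ξ ↦ [p, ξ]`; this characterizes the Lie algebra structure of `𝔈_x`. -/
def frame {x : X} (p : B.Fiber x) : GroupLieAlgebra 𝓘(ℂ, EG) G ≃ₗ⁅ℂ⁆ B.AdFiber x :=
  have key : ∀ ξ, B.adMk p ξ = (B.adChart x).symm
      (Ad (B.exists_eq_act (p.2.trans (Classical.choice (B.fiber_nonempty x)).2.symm)).choose⁻¹ ξ) :=
    fun ξ => B.adMk_eq p _ _
      (B.exists_eq_act (p.2.trans (Classical.choice (B.fiber_nonempty x)).2.symm)).choose_spec ξ
  LieEquiv.ofBijective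
    { toFun := B.adMk p
      map_add' := fun ξ η => by
        simp only [key, map_add]
        exact map_add ((B.adChart x).lieEquiv ℂ).symm _ _
      map_smul' := fun c ξ => by
        simp only [key, map_smul]
        exact map_smul ((B.adChart x).lieEquiv ℂ).symm _ _
      map_lie' := fun {ξ η} => by
        simp only [key, Ad_lie]
        exact LieEquiv.map_lie ((B.adChart x).lieEquiv ℂ).symm _ _ }
    (B.adMk_bijective p)

@[simp]
theorem frame_apply {x : X} (p : B.Fiber x) (ξ : GroupLieAlgebra 𝓘(ℂ, EG) G) :
    B.frame p ξ = B.adMk p ξ := rfl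

/-- The function `f_s : E_G → 𝔤` of a section `s` of `𝔈`, characterized by
`s (π p) = [p, f_s p]`; it satisfies `f_s (p · g) = Ad g⁻¹ (f_s p)`. -/
def sectionFun (s : ∀ x, B.AdFiber x) (p : P) : GroupLieAlgebra 𝓘(ℂ, EG) G :=
  (B.frame ⟨p, rfl⟩).symm (s (B.proj p))

/-- A section `s` of `𝔈` is smooth if `f_s` is a smooth function on `E_G`. -/
def IsSmoothSection (s : ∀ x, B.AdFiber x) : Prop :=
  ContMDiff (M' := EG) 𝓘(ℝ, EP) 𝓘(ℝ, EG) ∞ (fun p => (B.sectionFun s p : EG))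

/-- The differential `d f_s` of the function of a section, as a `𝔤`-valued form on `E_G`. -/
def dSectionFun (s : ∀ x, B.AdFiber x) (p : P) :
    TangentSpace 𝓘(ℝ, EP) p →ₗ[ℝ] GroupLieAlgebra 𝓘(ℂ, EG) G :=
  (mvfderiv (F := EG) 𝓘(ℝ, EP) (fun q => (B.sectionFun s q : EG)) p : EP →L[ℝ] EG).toLinearMap

/-- The differential of the projection `E_G → X`. -/
def dproj (p : P) : TangentSpace 𝓘(ℝ, EP) p →ₗ[ℝ] TangentSpace 𝓘(ℝ, EX) (B.proj p) :=
  (mfderiv 𝓘(ℝ, EP) 𝓘(ℝ, EX) B.proj p).toLinearMap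

/-- The pullback to `E_G` of an `𝔈`-valued one-form `η` on `X`, as a `𝔤`-valued one-form. -/
def pullbackForm (η : ∀ x, TangentSpace 𝓘(ℝ, EX) x →ₗ[ℝ] B.AdFiber x) (p : P)
    (w : TangentSpace 𝓘(ℝ, EP) p) : GroupLieAlgebra 𝓘(ℂ, EG) G :=
  (B.frame ⟨p, rfl⟩).symm (η (B.proj p) (B.dproj p w))

end AdjointBundle

/-! ### Connections on the adjoint bundle and on the principal bundle -/

section Connections

variable {EX : Type*} [NormedAddCommGroup EX] [NormedSpace ℂ EX]
  {X : Type*} [TopologicalSpace X] [ChartedSpace EX X]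
  {EG : Type*} [NormedAddCommGroup EG] [NormedSpace ℂ EG] [FiniteDimensional ℂ EG]
  {G : Type*} [TopologicalSpace G] [ChartedSpace EG G] [Group G] [LieGroup 𝓘(ℂ, EG) ω G]
  {EP : Type*} [NormedAddCommGroup EP] [NormedSpace ℂ EP]
  {P : Type*} [TopologicalSpace P] [ChartedSpace EP P] [IsManifold 𝓘(ℂ, EP) ω P]

/-- A `𝔤`-valued real one-form on `E_G` is smooth if it is smooth as a function on the tangent
bundle. -/
def IsSmoothForm (θ : ∀ p : P, TangentSpace 𝓘(ℝ, EP) p → GroupLieAlgebra 𝓘(ℂ, EG) G) : Prop :=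
  ContMDiff (M' := EG) (𝓘(ℝ, EP).tangent) 𝓘(ℝ, EG) ∞
    (fun w : TangentBundle 𝓘(ℝ, EP) P => (θ w.proj w.snd : EG))

/-- A smooth connection `D` on the complex vector bundle `𝔈`: it sends a smooth section to a smooth
`𝔈`-valued one-form, is additive, and satisfies the Leibniz rule for multiplication with smooth
complex-valued functions. As for covariant derivatives in Mathlib, the value on a
section that is not smooth is irrelevant. -/
structure AdConnection (B : HolomorphicPrincipalBundle EX X EG G EP P) where
  toFun : (∀ x, B.AdFiber x) → ∀ x, TangentSpace 𝓘(ℝ, EX) x →ₗ[ℝ] B.AdFiber x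
  smooth : ∀ s, B.IsSmoothSection s → IsSmoothForm (B.pullbackForm (toFun s))
  add : ∀ s t, B.IsSmoothSection s → B.IsSmoothSection t →
    ∀ x v, toFun (fun y => s y + t y) x v = toFun s x v + toFun t x v
  leibniz : ∀ (f : X → ℂ) (s), ContMDiff 𝓘(ℝ, EX) 𝓘(ℝ, ℂ) ∞ f → B.IsSmoothSection s →
    ∀ x v, toFun (fun y => f y • s y) x v = mvfderiv 𝓘(ℝ, EX) f x v • s x + f x • toFun s x v

namespace AdConnection

variable {B : HolomorphicPrincipalBundle EX X EG G EP P} (D : B.AdConnection)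

/-- `D[s, t] = [D s, t] + [s, D t]` for all smooth sections `s`, `t`. -/
def SatisfiesLieLeibniz : Prop :=
  ∀ s t, B.IsSmoothSection s → B.IsSmoothSection t →
    ∀ x v, D.toFun (fun y => ⁅s y, t y⁆) x v = ⁅D.toFun s x v, t x⁆ + ⁅s x, D.toFun t x v⁆

/-- `D` restricts to `d` on `ℨ = E_G ×_G 𝔷(𝔤)`: under `ℨ ≃ X × 𝔷(𝔤)`, `[p, ζ] ↦ (π p, ζ)`, a smooth
section of `ℨ` is a smooth function `h : X → 𝔷(𝔤)`, and `D` sends it to `d h`. -/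
def RestrictsToDOnCenter : Prop :=
  ∀ (s : ∀ x, B.AdFiber x) (h : X → GroupLieAlgebra 𝓘(ℂ, EG) G),
    ContMDiff (M' := EG) 𝓘(ℝ, EX) 𝓘(ℝ, EG) ∞ (fun x => (h x : EG)) →
    (∀ x, h x ∈ LieAlgebra.center ℂ (GroupLieAlgebra 𝓘(ℂ, EG) G)) →
    (∀ x (p : B.Fiber x), s x = B.adMk p (h x)) →
    ∀ x v (p : B.Fiber x),
      D.toFun s x v = B.adMk p (mvfderiv (F := EG) 𝓘(ℝ, EX) (fun y => (h y : EG)) x v : EG)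

/-- `D` is compatible with the holomorphic structure: `D^{0,1} = ∂̄`. Here
`D^{0,1} s (v) = (D s (v) + i D s (i v)) / 2`, and `∂̄ s` is the `𝔈`-valued form whose pullback to
`E_G` is the `(0,1)`-part of `d f_s`. -/
def IsCompatible : Prop :=
  ∀ s, B.IsSmoothSection s → ∀ (p : P) (w : TangentSpace 𝓘(ℝ, EP) p),
    (2⁻¹ : ℂ) • (D.toFun s (B.proj p) (B.dproj p w) +
        Complex.I • D.toFun s (B.proj p) (tangentJ (B.proj p) (B.dproj p w))) =
      B.adMk ⟨p, rfl⟩ ((2⁻¹ : ℂ) • (B.dSectionFun s p w +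
        Complex.I • B.dSectionFun s p (tangentJ p w)))

end AdConnection

/-- A smooth connection on the principal bundle `E_G`, given by its `𝔤`-valued connection form. -/
structure PrincipalConnection (B : HolomorphicPrincipalBundle EX X EG G EP P) where
  form : ∀ p : P, TangentSpace 𝓘(ℝ, EP) p →ₗ[ℝ] GroupLieAlgebra 𝓘(ℂ, EG) G
  smooth : IsSmoothForm (fun p => form p)
  /-- The form reproduces the generators of the fundamental vector fields. -/
  fundamental : ∀ (p : P) (ξ : GroupLieAlgebra 𝓘(ℂ, EG) G),
    form p (mfderiv 𝓘(ℝ, EG) 𝓘(ℝ, EP) (fun g : G => B.act p g) 1 ξ : EP) = ξ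
  /-- `R_g^* ω = Ad g⁻¹ ω`. -/
  equivariant : ∀ (p : P) (g : G) (w : TangentSpace 𝓘(ℝ, EP) p),
    form (B.act p g) (mfderiv 𝓘(ℝ, EP) 𝓘(ℝ, EP) (fun q => B.act q g) p w) = Ad g⁻¹ (form p w)

namespace PrincipalConnection

variable {B : HolomorphicPrincipalBundle EX X EG G EP P} (A : B.PrincipalConnection)

/-- The connection is compatible with the holomorphic structure of `E_G`: its form has type
`(1,0)`, equivalently its horizontal subspaces are complex subspaces. -/
def IsCompatible : Prop :=
  ∀ (p : P) (w : TangentSpace 𝓘(ℝ, EP) p), A.form p (tangentJ p w) = Complex.I • A.form p w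

/-- `D` is induced by the connection `A` on `E_G`: `f_{D s} = d f_s + [ω, f_s]`. -/
def Induces (D : B.AdConnection) : Prop :=
  ∀ s, B.IsSmoothSection s → ∀ (p : P) (w : TangentSpace 𝓘(ℝ, EP) p),
    B.pullbackForm (D.toFun s) p w = B.dSectionFun s p w + ⁅A.form p w, B.sectionFun s p⁆

end PrincipalConnection

end Connections

end HolomorphicPrincipalBundle

end

/-! Over a trivialization of `E_G`, conditions 1 and 2 say that `D` differs from the flat connection
`d` by a one-form with values in the derivations of `𝔤` that kill `𝔷(𝔤)`. For reductive `𝔤` such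
derivations are inner, so the difference is `ad` of a `𝔤`-valued form; adding that form to the flat
connection form gives a connection on `E_G` over the open set that induces `D`. The form is
determined only modulo the centre. Choosing it through one fixed complex linear map `κ` from
endomorphisms to `𝔤` keeps it smooth, and of type (1,0) when `D` is compatible. Reproducing
generators, equivariance, inducing `D` and having type (1,0) all survive convex combinations whose
weights are functions on `X`, so a partition of unity glues the local forms.

Derivations (`LieAlgebra.exists_eq_lie_of_derivation`): a derivation killing the centre descends to
the semisimple quotient `𝔤/𝔷`, where it is inner. After subtracting `ad a`, what remains has central
values, kills brackets and kills the centre, so it factors through the perfect algebra `𝔤/𝔷` and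
vanishes.

Reductivity of `𝔤` (`LinearAlgebraicStructure.hasCentralRadical`) has to be extracted from the
absence of unipotent normal subgroups. Let `A` be the associative matrix algebra generated by `𝔤`
and `J` the radical of its trace form. Elements of `J` are nilpotent, so the `g` in `G` with `g - 1`
in `J` form a normal, Zariski closed, unipotent subgroup; it is connected because with `u` it
contains all complex powers of `u`. Hence it is trivial, and exponentiating gives `𝔤 ∩ J = 0`. By
Lie's theorem `[𝔤, rad 𝔤]` lies in `J`, so it vanishes and the radical is central.

Connectedness of `G` makes `Ad` trivial on `𝔷(𝔤)`, so that a cut-off central element is a section of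
`ℨ` to which condition 2 applies (`CutTriv.connEnd_center`). -/

set_option linter.unusedSectionVars false

noncomputable section

/-! ### Reductive Lie algebras: a trace criterion, and derivations that kill the centre -/

section LieAlgebraPart

open LieModule LieAlgebra

/-- An endomorphism of a finite-dimensional space in characteristic zero all of whose powers have
trace zero is nilpotent. -/
theorem Module.End.isNilpotent_of_trace_pow_eq_zero {K V : Type*} [Field K] [CharZero K]
    [AddCommGroup V] [Module K V] [FiniteDimensional K V] (f : Module.End K V)
    (h : ∀ k : ℕ, LinearMap.trace K V (f ^ (k + 1)) = 0) : IsNilpotent f := by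
  have hp : minpoly K f ≠ 0 := minpoly.ne_zero (Algebra.IsIntegral.isIntegral f)
  obtain ⟨q, hq, hndvd⟩ := Polynomial.exists_eq_pow_rootMultiplicity_mul_and_not_dvd _ hp 0
  set m := (minpoly K f).rootMultiplicity 0
  rw [map_zero, sub_zero] at hq hndvd
  -- The exponent is `m + 1` rather than `m` so that `u * X ^ (m + 1)` has no constant term even
  -- when `m = 0`.
  have hcop : IsCoprime ((Polynomial.X : Polynomial K) ^ (m + 1)) q :=
    ((Polynomial.irreducible_X.coprime_iff_not_dvd).2 hndvd).pow_left
  obtain ⟨u, v, huv⟩ := hcop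
  have haev : f ^ m * Polynomial.aeval f q = 0 := by
    have := minpoly.aeval K f
    rw [hq] at this
    simpa using this
  -- `e` is the Fitting projection onto the part where `f` is invertible. It is a polynomial in `f`
  -- without constant term, so its trace vanishes; as the trace of a projection is its rank, `e = 0`
  -- in characteristic zero.
  set e := Polynomial.aeval f (u * Polynomial.X ^ (m + 1)) with he
  have h1 : e + Polynomial.aeval f (v * q) = 1 := by
    rw [he, ← map_add, huv, map_one]
  have hez : e * Polynomial.aeval f (v * q) = 0 := by
    rw [he, ← map_mul, show u * Polynomial.X ^ (m + 1) * (v * q) =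
      u * v * Polynomial.X * (Polynomial.X ^ m * q) by ring, map_mul, map_mul _ (_ ^ m)]
    simp [haev]
  have hidem : e * e = e := by
    have := congrArg (e * ·) h1
    simpa only [mul_add, hez, add_zero, mul_one] using this
  have htr : LinearMap.trace K V e = 0 := by
    have : u * Polynomial.X ^ (m + 1) = u * Polynomial.X ^ m * Polynomial.X := by ring
    rw [he, this, Polynomial.aeval_eq_sum_range]
    rw [map_sum]
    refine Finset.sum_eq_zero fun i _ => ?_
    rcases i with _ | i
    · simp
    · simp [h]
  have he0 : e = 0 := by
    have hproj : LinearMap.IsProj (LinearMap.range e) e :=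
      ⟨fun x => ⟨x, rfl⟩, by rintro _ ⟨x, rfl⟩; exact LinearMap.congr_fun hidem x⟩
    have := hproj.trace
    rw [htr] at this
    have h0 : Module.finrank K (LinearMap.range e) = 0 := by exact_mod_cast this.symm
    rwa [Submodule.finrank_eq_zero, LinearMap.range_eq_bot] at h0
  refine ⟨m, ?_⟩
  rw [he0, zero_add] at h1
  calc f ^ m = f ^ m * Polynomial.aeval f (v * q) := by rw [h1, mul_one]
    _ = Polynomial.aeval f v * (f ^ m * Polynomial.aeval f q) := by
      rw [map_mul, ← mul_assoc, ← mul_assoc]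
      congr 1
      have := congrArg (Polynomial.aeval f) (mul_comm (Polynomial.X ^ m) v)
      simpa using this
    _ = 0 := by rw [haev, mul_zero]

variable {k L : Type*} [Field k] [CharZero k] [IsAlgClosed k] [LieRing L] [LieAlgebra k L]
  [FiniteDimensional k L]

/-- An element of `[L, rad L]` times any endomorphism preserving all submodules is nilpotent. -/
theorem LieModule.isNilpotent_toEnd_lie_radical_mul (y : L) {r : L} (hr : r ∈ radical k L)
    {V : Type*} [AddCommGroup V] [Module k V] [LieRingModule L V] [LieModule k L V]
    [FiniteDimensional k V] (b : Module.End k V)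
    (hb : ∀ (N : LieSubmodule k L V), ∀ v ∈ N, b v ∈ N) :
    _root_.IsNilpotent (toEnd k L V ⁅y, r⁆ * b) := by
  induction hn : Module.finrank k V using Nat.strong_induction_on generalizing V with
  | _ n ih =>
  rcases subsingleton_or_nontrivial V with hV | hV
  · exact ⟨0, Subsingleton.elim _ _⟩
  -- Lie's theorem: the solvable radical has a common eigenvector. Its whole weight space `W` is
  -- stable under `L`, by the invariance lemma for ideals.
  obtain ⟨χ, hχ⟩ : ∃ χ : Module.Dual k (radical k L), Nontrivial (weightSpace V χ) :=
    exists_nontrivial_weightSpace_of_isSolvable k (radical k L) V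
  let W : LieSubmodule k L V := weightSpaceOfIsLieTower k V χ
  have hW : ∀ w ∈ W, ∀ s (hs : s ∈ radical k L), ⁅s, w⁆ = χ ⟨s, hs⟩ • w := by
    intro w hw s hs
    exact (mem_weightSpace (χ : radical k L → k) w).1 hw ⟨s, hs⟩
  -- On `W` the element `r` acts by a scalar, which commutes with the action of `y`. So the operator
  -- is zero on `W` and nilpotent on `V ⧸ W` by induction.
  have hWz : ∀ w ∈ W, ⁅⁅y, r⁆, w⁆ = 0 := by
    intro w hw
    rw [lie_lie, hW w hw r hr, hW _ (W.lie_mem hw) r hr, lie_smul, sub_self]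
  have hlt : Module.finrank k (V ⧸ W) < n := by
    have h1 := Submodule.finrank_quotient_add_finrank W.toSubmodule
    have h2 : 0 < Module.finrank k W.toSubmodule := by
      have : Nontrivial W.toSubmodule := hχ
      exact Module.finrank_pos
    have h3 : Module.finrank k (V ⧸ W) = Module.finrank k (V ⧸ W.toSubmodule) := rfl
    omega
  let b' : Module.End k (V ⧸ W) := W.toSubmodule.mapQ W.toSubmodule b (fun v hv => hb W v hv)
  have hb'mk : ∀ v, b' (LieSubmodule.Quotient.mk v) = LieSubmodule.Quotient.mk (b v) := fun v => rfl
  obtain ⟨m, hm⟩ := ih _ hlt b' (fun N v hv => by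
    obtain ⟨v, rfl⟩ := LieSubmodule.Quotient.surjective_mk' W v
    exact hb (N.comap (LieSubmodule.Quotient.mk' W)) v hv) rfl
  have hpow : ∀ j v, ((toEnd k L (V ⧸ W) ⁅y, r⁆ * b') ^ j) (LieSubmodule.Quotient.mk v) =
      LieSubmodule.Quotient.mk (((toEnd k L V ⁅y, r⁆ * b) ^ j) v) := by
    intro j
    induction j with
    | zero => intro v; rfl
    | succ j ihj =>
      intro v
      rw [pow_succ', Module.End.mul_apply, ihj, pow_succ', Module.End.mul_apply]
      rfl
  refine ⟨m + 1, LinearMap.ext fun v => ?_⟩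
  have hmem : ((toEnd k L V ⁅y, r⁆ * b) ^ m) v ∈ W := by
    rw [← LieSubmodule.Quotient.mk_eq_zero', ← hpow, hm]
    rfl
  rw [pow_succ', Module.End.mul_apply]
  exact hWz _ (hb W _ hmem)

/-- A Lie algebra is reductive if it has a representation such that no nonzero element lies in the
radical of the trace form of the associative algebra generated by the representation. -/
theorem LieAlgebra.hasCentralRadical_of_trace {V : Type*} [AddCommGroup V] [Module k V]
    [LieRingModule L V] [LieModule k L V] [FiniteDimensional k V]
    (h : ∀ x : L, (∀ b ∈ Algebra.adjoin k (Set.range (toEnd k L V)),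
      LinearMap.trace k V (toEnd k L V x * b) = 0) → x = 0) : HasCentralRadical k L := by
  -- To see that `r` is central, apply `h` to `⁅y, r⁆`. Elements of the generated associative
  -- algebra preserve every submodule, so all the products in question are nilpotent and have trace
  -- zero.
  refine hasCentralRadical_of_radical_le k L fun r hr => ?_
  refine (mem_maxTrivSubmodule k L L r).mpr fun y => h _ fun b hb => ?_
  refine (LinearMap.isNilpotent_trace_of_isNilpotent
    (LieModule.isNilpotent_toEnd_lie_radical_mul y hr b fun N => ?_)).eq_zero
  induction hb using Algebra.adjoin_induction with
  | mem x hx => obtain ⟨z, rfl⟩ := hx; exact fun v hv => N.lie_mem hv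
  | algebraMap c => exact fun v hv => N.smul_mem c hv
  | add a b _ _ ha hb => exact fun v hv => N.add_mem (ha v hv) (hb v hv)
  | mul a b _ _ ha hb => exact fun v hv => ha _ (hb v hv)

/-- The quotient map of a Lie algebra by an ideal, as a morphism of Lie algebras. -/
def LieIdeal.quotientHom {k L : Type*} [CommRing k] [LieRing L] [LieAlgebra k L]
    (I : LieIdeal k L) : L →ₗ⁅k⁆ L ⧸ I where
  toLinearMap := (LieSubmodule.Quotient.mk' I : L →ₗ[k] L ⧸ I)
  map_lie' := fun {x y} => LieSubmodule.Quotient.mk_bracket I x y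

theorem LieIdeal.quotientHom_surjective {k L : Type*} [CommRing k] [LieRing L] [LieAlgebra k L]
    (I : LieIdeal k L) : Function.Surjective I.quotientHom := fun q => by
  obtain ⟨x, rfl⟩ := LieSubmodule.Quotient.surjective_mk' I q
  exact ⟨x, rfl⟩

theorem LieIdeal.quotientHom_eq_zero {k L : Type*} [CommRing k] [LieRing L] [LieAlgebra k L]
    (I : LieIdeal k L) {x : L} : I.quotientHom x = 0 ↔ x ∈ I :=
  LieSubmodule.Quotient.mk_eq_zero I

/-- A Lie algebra with nondegenerate Killing form is perfect: a linear form vanishing on all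
brackets is zero. -/
theorem LieAlgebra.IsKilling.dual_eq_zero {k L : Type*} [Field k] [LieRing L] [LieAlgebra k L]
    [FiniteDimensional k L] [IsKilling k L] (f : Module.Dual k L)
    (hf : ∀ x y : L, f ⁅x, y⁆ = 0) : f = 0 := by
  have hnd := LieAlgebra.IsKilling.killingForm_nondegenerate k L
  -- The form is `killingForm a`. By invariance, vanishing on brackets makes every `⁅a, y⁆`
  -- orthogonal to everything, so `a` is central, hence zero.
  obtain ⟨a, rfl⟩ := (LinearMap.BilinForm.toDual (killingForm k L) hnd).surjective f
  have hker : ∀ b : L, (∀ z, killingForm k L b z = 0) → b = 0 := fun b hb => hnd.1 b hb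
  have ha : a ∈ center k L := by
    refine (mem_maxTrivSubmodule k L L a).2 fun y => ?_
    rw [← lie_skew, neg_eq_zero]
    refine hker _ fun z => ?_
    rw [traceForm_apply_lie_apply]
    exact hf y z
  have ha0 : a = 0 := by
    have := center_eq_bot k L
    rw [this] at ha
    exact (LieSubmodule.mem_bot a).1 ha
  rw [ha0, map_zero]

/-- An abelian ideal of the quotient pulls back to an ideal whose derived ideal is central. That
preimage is solvable, so it lies in the radical, which is the centre, and the abelian ideal is zero.
-/
theorem LieAlgebra.hasTrivialRadical_quotient_center {k L : Type*} [Field k] [LieRing L]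
    [LieAlgebra k L] [FiniteDimensional k L] [HasCentralRadical k L] :
    HasTrivialRadical k (L ⧸ center k L) := by
  rw [hasTrivialRadical_iff_no_abelian_ideals]
  intro I hI
  let π := (center k L).quotientHom
  let K : LieIdeal k L := I.comap π
  have h1 : derivedSeriesOfIdeal k L 1 K ≤ center k L := by
    rw [derivedSeriesOfIdeal_succ, derivedSeriesOfIdeal_zero, LieSubmodule.lieIdeal_oper_eq_span,
      LieSubmodule.lieSpan_le]
    rintro _ ⟨⟨x, hx⟩, ⟨y, hy⟩, rfl⟩
    change ⁅x, y⁆ ∈ center k L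
    rw [← (center k L).quotientHom_eq_zero, LieHom.map_lie]
    have hx' : π x ∈ I := hx
    have hy' : π y ∈ I := hy
    exact congrArg Subtype.val (hI.trivial ⟨π x, hx'⟩ ⟨π y, hy'⟩)
  have h2 : derivedSeriesOfIdeal k L 2 K = ⊥ := by
    rw [derivedSeriesOfIdeal_succ, LieSubmodule.lie_eq_bot_iff]
    intro x hx y hy
    exact (mem_maxTrivSubmodule k L L y).1 (h1 hy) x
  have hK : IsSolvable K := IsSolvable.mk (R := k) (k := 2) ((LieIdeal.derivedSeries_eq_bot_iff K 2).2 h2)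
  rw [LieIdeal.solvable_iff_le_radical, HasCentralRadical.radical_eq_center] at hK
  rw [LieSubmodule.eq_bot_iff]
  intro q hq
  obtain ⟨x, rfl⟩ := (center k L).quotientHom_surjective q
  exact (center k L).quotientHom_eq_zero.2 (hK hq)

/-- In a reductive Lie algebra over a field of characteristic zero, a derivation that vanishes on
the centre is inner. -/
theorem LieAlgebra.exists_eq_lie_of_derivation {k L : Type*} [Field k] [CharZero k] [LieRing L]
    [LieAlgebra k L] [FiniteDimensional k L] [HasCentralRadical k L] (δ : L →ₗ[k] L)
    (hδ : ∀ x y : L, δ ⁅x, y⁆ = ⁅δ x, y⁆ + ⁅x, δ y⁆) (hz : ∀ z ∈ center k L, δ z = 0) :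
    ∃ a : L, ∀ x, δ x = ⁅a, x⁆ := by
  have : HasTrivialRadical k (L ⧸ center k L) := hasTrivialRadical_quotient_center
  let π := (center k L).quotientHom
  have hπs : Function.Surjective π := (center k L).quotientHom_surjective
  have hπ0 : ∀ x, π x = 0 ↔ x ∈ center k L := fun x => (center k L).quotientHom_eq_zero
  let δ' : (L ⧸ center k L) →ₗ[k] L ⧸ center k L :=
    (center k L).toSubmodule.mapQ (center k L).toSubmodule δ
      (fun z hzc => by rw [Submodule.mem_comap, hz z hzc]; exact Submodule.zero_mem _)
  have hδ' : ∀ x, δ' (π x) = π (δ x) := fun x => rfl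
  let Δ : LieDerivation k (L ⧸ center k L) (L ⧸ center k L) :=
    { toLinearMap := δ'
      leibniz' := by
        intro a b
        obtain ⟨x, rfl⟩ := hπs a
        obtain ⟨y, rfl⟩ := hπs b
        change δ' ⁅π x, π y⁆ = ⁅π x, δ' (π y)⁆ - ⁅π y, δ' (π x)⁆
        rw [← LieHom.map_lie, hδ', hδ, map_add, LieHom.map_lie, LieHom.map_lie, hδ', hδ',
          ← lie_skew (π y), sub_neg_eq_add, add_comm] }
  obtain ⟨q, hq⟩ := LieDerivation.IsKilling.exists_eq_ad Δ
  obtain ⟨a, rfl⟩ := hπs q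
  refine ⟨a, fun x => ?_⟩
  -- `ε` is a derivation with central values, so it kills all brackets; it also kills the centre. It
  -- therefore factors through the quotient, where linear forms vanishing on brackets are zero.
  let ε : L →ₗ[k] L := δ - ad k L a
  have hε : ∀ x, ε x = δ x - ⁅a, x⁆ := fun x => rfl
  have hεc : ∀ x, ε x ∈ center k L := by
    intro x
    rw [← hπ0, hε, map_sub, LieHom.map_lie, ← hδ']
    have := congrArg (fun D : LieDerivation k (L ⧸ center k L) (L ⧸ center k L) => D (π x)) hq
    rw [LieDerivation.ad_apply_apply] at this
    exact sub_eq_zero.2 this.symm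
  have hcl : ∀ z ∈ center k L, ∀ y : L, ⁅y, z⁆ = 0 := fun z hz y => (mem_maxTrivSubmodule k L L z).1 hz y
  have hcl' : ∀ z ∈ center k L, ∀ y : L, ⁅z, y⁆ = 0 := fun z hz y => by
    rw [← lie_skew, hcl z hz, neg_zero]
  have hεlie : ∀ x y : L, ε ⁅x, y⁆ = 0 := by
    intro x y
    have : ε ⁅x, y⁆ = ⁅ε x, y⁆ + ⁅x, ε y⁆ := by
      simp only [hε, hδ, sub_lie, lie_sub, leibniz_lie a x y]
      abel
    rw [this, hcl _ (hεc y), hcl' _ (hεc x), add_zero]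
  have hεz : ∀ z ∈ center k L, ε z = 0 := by
    intro z hzc
    rw [hε, hz z hzc, hcl z hzc, sub_zero]
  let ε' : (L ⧸ center k L) →ₗ[k] L := (center k L).toSubmodule.liftQ ε hεz
  have hε' : ∀ x, ε' (π x) = ε x := fun x => rfl
  have h0 : ε x = 0 := by
    refine (Module.forall_dual_apply_eq_zero_iff k (ε x)).1 fun f => ?_
    have := LieAlgebra.IsKilling.dual_eq_zero (f ∘ₗ ε') fun p q => by
      obtain ⟨u, rfl⟩ := hπs p
      obtain ⟨v, rfl⟩ := hπs q
      rw [← LieHom.map_lie, LinearMap.comp_apply, hε', hεlie, map_zero]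
    exact LinearMap.congr_fun this (π x)
  rwa [hε, sub_eq_zero] at h0

end LieAlgebraPart

/-! ### From complex to real differentiability -/

section RestrictScalars

variable {E E' : Type*} [NormedAddCommGroup E] [NormedSpace ℂ E]
  [NormedAddCommGroup E'] [NormedSpace ℂ E']
  {H : Type*} [TopologicalSpace H] {H' : Type*} [TopologicalSpace H']
  {I : ModelWithCorners ℂ E H} {J : ModelWithCorners ℝ E H}
  {I' : ModelWithCorners ℂ E' H'} {J' : ModelWithCorners ℝ E' H'}
  {M : Type*} [TopologicalSpace M] [ChartedSpace H M]
  {M' : Type*} [TopologicalSpace M'] [ChartedSpace H' M']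
  {n : ℕ∞ω} {f : M → M'} {x : M}

theorem extChartAt_eq_of_toPartialEquiv_eq (h : I.toPartialEquiv = J.toPartialEquiv) (x : M) :
    extChartAt I x = extChartAt J x := by
  simp only [extChartAt, OpenPartialHomeomorph.extend, h]

/-- Models over `ℂ` and over `ℝ` are compared only through their underlying partial equivalences.
This generality covers products of models, as needed for the multiplication of `G`. -/
theorem ContMDiffWithinAt.restrictScalars_of_eq (h : I.toPartialEquiv = J.toPartialEquiv)
    (h' : I'.toPartialEquiv = J'.toPartialEquiv) (hf : ContMDiffWithinAt I I' n f s x) :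
    ContMDiffWithinAt J J' n f s x := by
  rw [contMDiffWithinAt_iff] at hf ⊢
  have hr : Set.range I = Set.range J := congrArg (fun e : PartialEquiv H E => Set.range e) h
  rw [← extChartAt_eq_of_toPartialEquiv_eq h, ← extChartAt_eq_of_toPartialEquiv_eq h', ← hr]
  exact ⟨hf.1, hf.2.restrict_scalars ℝ⟩

theorem HasMFDerivAt.restrictScalars_of_eq (h : I.toPartialEquiv = J.toPartialEquiv)
    (h' : I'.toPartialEquiv = J'.toPartialEquiv)
    {f' : TangentSpace I x →L[ℂ] TangentSpace I' (f x)} (hf : HasMFDerivAt I I' f x f') :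
    HasMFDerivAt J J' f x ((show E →L[ℂ] E' from f').restrictScalars ℝ : E →L[ℝ] E') := by
  have hr : Set.range I = Set.range J := congrArg (fun e : PartialEquiv H E => Set.range e) h
  refine ⟨hf.1, ?_⟩
  have := HasFDerivWithinAt.restrictScalars ℝ hf.2
  unfold writtenInExtChartAt at this ⊢
  rw [← extChartAt_eq_of_toPartialEquiv_eq h, ← extChartAt_eq_of_toPartialEquiv_eq h', ← hr]
  exact this

end RestrictScalars

section SelfModel

variable {E E' : Type*} [NormedAddCommGroup E] [NormedSpace ℂ E]
  [NormedAddCommGroup E'] [NormedSpace ℂ E']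
  {M : Type*} [TopologicalSpace M] [ChartedSpace E M]
  {M' : Type*} [TopologicalSpace M'] [ChartedSpace E' M']
  {n : ℕ∞ω} {f : M → M'} {x : M}

theorem ContMDiffAt.restrictScalars (hf : ContMDiffAt 𝓘(ℂ, E) 𝓘(ℂ, E') n f x) :
    ContMDiffAt 𝓘(ℝ, E) 𝓘(ℝ, E') n f x :=
  ContMDiffWithinAt.restrictScalars_of_eq rfl rfl hf

theorem ContMDiff.restrictScalars (hf : ContMDiff 𝓘(ℂ, E) 𝓘(ℂ, E') n f) :
    ContMDiff 𝓘(ℝ, E) 𝓘(ℝ, E') n f :=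
  fun x => (hf x).restrictScalars

theorem MDifferentiableAt.mfderiv_real (hf : MDifferentiableAt 𝓘(ℂ, E) 𝓘(ℂ, E') f x) :
    (mfderiv 𝓘(ℝ, E) 𝓘(ℝ, E') f x : E →L[ℝ] E') =
      (mfderiv 𝓘(ℂ, E) 𝓘(ℂ, E') f x : E →L[ℂ] E').restrictScalars ℝ :=
  (hf.hasMFDerivAt.restrictScalars_of_eq (J := 𝓘(ℝ, E)) (J' := 𝓘(ℝ, E')) rfl rfl).mfderiv

theorem MDifferentiableAt.restrictScalars (hf : MDifferentiableAt 𝓘(ℂ, E) 𝓘(ℂ, E') f x) :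
    MDifferentiableAt 𝓘(ℝ, E) 𝓘(ℝ, E') f x :=
  (hf.hasMFDerivAt.restrictScalars_of_eq (J := 𝓘(ℝ, E)) (J' := 𝓘(ℝ, E')) rfl rfl).mdifferentiableAt

theorem MDifferentiableAt.mfderiv_tangentJ (hf : MDifferentiableAt 𝓘(ℂ, E) 𝓘(ℂ, E') f x)
    (w : TangentSpace 𝓘(ℝ, E) x) :
    mfderiv 𝓘(ℝ, E) 𝓘(ℝ, E') f x (tangentJ x w) =
      tangentJ (f x) (mfderiv 𝓘(ℝ, E) 𝓘(ℝ, E') f x w) := by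
  have key : ∀ u : E, (mfderiv 𝓘(ℝ, E) 𝓘(ℝ, E') f x : E →L[ℝ] E') u =
      (mfderiv 𝓘(ℂ, E) 𝓘(ℂ, E') f x : E →L[ℂ] E') u := fun u => by
    rw [hf.mfderiv_real]; rfl
  refine (key _).trans (((mfderiv 𝓘(ℂ, E) 𝓘(ℂ, E') f x : E →L[ℂ] E').map_smul Complex.I w).trans ?_)
  exact congrArg (Complex.I • ·) (key w).symm

end SelfModel

/-! ### Brackets of related vector fields, and calculus in normed algebras -/

section RelatedFields

variable {E E' : Type*} [NormedAddCommGroup E] [NormedSpace ℂ E]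
  [NormedAddCommGroup E'] [NormedSpace ℂ E']

/-- Differentiating `DF(V) = V' ∘ F` along `W`, and symmetrically, produces second derivatives of
`F` that cancel by symmetry. `F` need not be a local diffeomorphism: it will be a representation `G
→ 𝒜`. -/
theorem fderiv_lieBracket_of_related {F : E → E'} {V W : E → E} {V' W' : E' → E'} {z : E}
    (hF : ContDiffAt ℂ ω F z) (hV : DifferentiableAt ℂ V z) (hW : DifferentiableAt ℂ W z)
    (hV' : DifferentiableAt ℂ V' (F z)) (hW' : DifferentiableAt ℂ W' (F z))
    (rV : ∀ᶠ y in nhds z, fderiv ℂ F y (V y) = V' (F y))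
    (rW : ∀ᶠ y in nhds z, fderiv ℂ F y (W y) = W' (F y)) :
    fderiv ℂ F z (lieBracket ℂ V W z) = lieBracket ℂ V' W' (F z) := by
  have hF1 : DifferentiableAt ℂ F z := hF.differentiableAt (by simp)
  have hF2 : DifferentiableAt ℂ (fderiv ℂ F) z :=
    (hF.fderiv_right (m := 1) (by simp)).differentiableAt (by simp)
  have hsymm : IsSymmSndFDerivAt ℂ F z := hF.isSymmSndFDerivAt (by simp)
  have key : ∀ {V : E → E} {V' : E' → E'}, DifferentiableAt ℂ V z → DifferentiableAt ℂ V' (F z) →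
      (∀ᶠ y in nhds z, fderiv ℂ F y (V y) = V' (F y)) → ∀ u,
      fderiv ℂ V' (F z) (fderiv ℂ F z u) =
        fderiv ℂ F z (fderiv ℂ V z u) + fderiv ℂ (fderiv ℂ F) z u (V z) := by
    intro V V' hV hV' r u
    have h1 := Filter.EventuallyEq.fderiv_eq (𝕜 := ℂ) r
    have h2 : fderiv ℂ (fun y => V' (F y)) z = (fderiv ℂ V' (F z)).comp (fderiv ℂ F z) :=
      fderiv_comp z hV' hF1
    rw [h2, fderiv_clm_apply hF2 hV] at h1
    have := congrArg (fun A : E →L[ℂ] E' => A u) h1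
    simpa using this.symm
  simp only [lieBracket, map_sub]
  rw [← rV.self_of_nhds, ← rW.self_of_nhds, key hV hV' rV, key hW hW' rW, hsymm.eq]
  abel

variable [CompleteSpace E] {M : Type*} [TopologicalSpace M] [ChartedSpace E M]
  [IsManifold 𝓘(ℂ, E) ω M]

/-- The bracket of two vector fields related by `F` to vector fields on a vector space is related
to the bracket of the latter. -/
theorem mvfderiv_mlieBracket_of_related {F : M → E'} {V W : ∀ x : M, TangentSpace 𝓘(ℂ, E) x}
    {V' W' : E' → E'} {x : M} (hF : ContMDiff 𝓘(ℂ, E) 𝓘(ℂ, E') ω F)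
    (hV : MDifferentiableAt 𝓘(ℂ, E) 𝓘(ℂ, E).tangent (fun y => (⟨y, V y⟩ : TangentBundle 𝓘(ℂ, E) M)) x)
    (hW : MDifferentiableAt 𝓘(ℂ, E) 𝓘(ℂ, E).tangent (fun y => (⟨y, W y⟩ : TangentBundle 𝓘(ℂ, E) M)) x)
    (hV' : DifferentiableAt ℂ V' (F x)) (hW' : DifferentiableAt ℂ W' (F x))
    (rV : ∀ y, mvfderiv 𝓘(ℂ, E) F y (V y) = V' (F y))
    (rW : ∀ y, mvfderiv 𝓘(ℂ, E) F y (W y) = W' (F y)) :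
    mvfderiv 𝓘(ℂ, E) F x (mlieBracket 𝓘(ℂ, E) V W x) = lieBracket ℂ V' W' (F x) := by
  have : IsManifold 𝓘(ℂ, E) 2 M := IsManifold.of_le (n := ω) (by simp)
  have : IsManifold 𝓘(ℂ, E) 1 M := IsManifold.of_le (n := ω) (by simp)
  set φ := extChartAt 𝓘(ℂ, E) x with hφ
  have hrange : Set.range (𝓘(ℂ, E) : ModelWithCorners ℂ E E) = Set.univ := by simp
  have hinv : ∀ z ∈ φ.target,
      (mfderivWithin 𝓘(ℂ, E) 𝓘(ℂ, E) φ.symm (Set.range 𝓘(ℂ, E)) z).IsInvertible :=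
    fun z hz => isInvertible_mfderivWithin_extChartAt_symm hz
  have hopen : IsOpen φ.target := isOpen_extChartAt_target x
  have hx : φ x ∈ φ.target := mem_extChartAt_target x
  have hsymm : ContMDiffOn 𝓘(ℂ, E) 𝓘(ℂ, E) ω φ.symm φ.target := contMDiffOn_extChartAt_symm x
  have hFs : ContDiffOn ℂ ω (F ∘ φ.symm) φ.target :=
    (hF.comp_contMDiffOn hsymm).contDiffOn
  have hD : ∀ z ∈ φ.target, ∀ u : E, fderiv ℂ (F ∘ φ.symm) z u =
      mvfderiv 𝓘(ℂ, E) F (φ.symm z)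
        (mfderivWithin 𝓘(ℂ, E) 𝓘(ℂ, E) φ.symm (Set.range 𝓘(ℂ, E)) z u) := by
    intro z hz u
    have h1 : MDifferentiableAt 𝓘(ℂ, E) 𝓘(ℂ, E) φ.symm z :=
      (hsymm.contMDiffAt (hopen.mem_nhds hz)).mdifferentiableAt (by simp)
    have h2 := mfderiv_comp_apply (I' := 𝓘(ℂ, E)) z (hF.mdifferentiable (by simp) (φ.symm z)) h1 u
    rw [hrange, mfderivWithin_univ]
    rw [← mfderiv_eq_fderiv]
    exact h2
  -- At the centre of its own chart, the differential of the inverse chart is the identity of the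
  -- model space.
  have hself : ∀ u : E, mvfderiv 𝓘(ℂ, E) F x u = fderiv ℂ (F ∘ φ.symm) (φ x) u := by
    intro u
    have aux : ∀ (y : M) (_ : y = x) (A : E →L[ℂ] E) (_ : A = ContinuousLinearMap.id ℂ E),
        mvfderiv 𝓘(ℂ, E) F x u = mvfderiv 𝓘(ℂ, E) F y (A u) := by
      rintro _ rfl _ rfl; rfl
    exact (aux _ (extChartAt_to_inv x) _ mfderivWithin_range_extChartAt_symm).trans (hD _ hx u).symm
  have local_field : ∀ (V : ∀ x : M, TangentSpace 𝓘(ℂ, E) x) (V' : E' → E'),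
      MDifferentiableAt 𝓘(ℂ, E) 𝓘(ℂ, E).tangent (fun y => (⟨y, V y⟩ : TangentBundle 𝓘(ℂ, E) M)) x →
      (∀ y, mvfderiv 𝓘(ℂ, E) F y (V y) = V' (F y)) →
      ∃ V₁ : E → E, V₁ = mpullbackWithin 𝓘(ℂ, E) 𝓘(ℂ, E) φ.symm V (Set.range 𝓘(ℂ, E)) ∧
        DifferentiableAt ℂ V₁ (φ x) ∧
        ∀ᶠ z in nhds (φ x), fderiv ℂ (F ∘ φ.symm) z (V₁ z) = V' ((F ∘ φ.symm) z) := by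
    intro V V' hV r
    refine ⟨_, rfl, ?_, ?_⟩
    · have h1 := MDifferentiableWithinAt.differentiableWithinAt_mpullbackWithin_vectorField
        (s := Set.univ) hV.mdifferentiableWithinAt
      exact h1.differentiableAt (by simp)
    · filter_upwards [hopen.mem_nhds hx] with z hz
      refine (hD z hz _).trans (Eq.trans ?_ (r _))
      exact congrArg (mvfderiv 𝓘(ℂ, E) F (φ.symm z)) ((hinv z hz).self_apply_inverse _)
  obtain ⟨V₁, hV₁, dV, rV₁⟩ := local_field V V' hV rV
  obtain ⟨W₁, hW₁, dW, rW₁⟩ := local_field W W' hW rW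
  have hbr : (mlieBracket 𝓘(ℂ, E) V W x : E) = lieBracket ℂ V₁ W₁ (φ x) := by
    have aux : ∀ (A : E →L[ℂ] E) (_ : A = ContinuousLinearMap.id ℂ E) (S : Set E)
        (_ : S = Set.univ), A.inverse (lieBracketWithin ℂ V₁ W₁ S (φ x)) =
          lieBracket ℂ V₁ W₁ (φ x) := by
      rintro _ rfl _ rfl
      rw [lieBracketWithin_univ, ContinuousLinearMap.inverse_id]
      rfl
    subst hV₁ hW₁
    exact aux _ mfderiv_extChartAt_self _ (by simp)
  have hxx : φ.symm (φ x) = x := extChartAt_to_inv x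
  have hval : (F ∘ φ.symm) (φ x) = F x := congrArg F hxx
  have main := fderiv_lieBracket_of_related (hFs.contDiffAt (hopen.mem_nhds hx)) dV dW
    (by rwa [hval]) (by rwa [hval]) rV₁ rW₁
  rw [hval] at main
  refine (hself _).trans (Eq.trans ?_ main)
  exact congrArg (fderiv ℂ (F ∘ φ.symm) (φ x)) hbr

end RelatedFields

section ProductRule

variable {𝕜 : Type*} [NontriviallyNormedField 𝕜] {E : Type*} [NormedAddCommGroup E]
  [NormedSpace 𝕜 E] {H : Type*} [TopologicalSpace H] {I : ModelWithCorners 𝕜 E H}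
  {M : Type*} [TopologicalSpace M] [ChartedSpace H M]
  {𝒜 : Type*} [NormedRing 𝒜] [NormedAlgebra 𝕜 𝒜]

theorem mvfderiv_mul_algebra {f g : M → 𝒜} {x : M} (hf : MDifferentiableAt I 𝓘(𝕜, 𝒜) f x)
    (hg : MDifferentiableAt I 𝓘(𝕜, 𝒜) g x) (w : TangentSpace I x) :
    mvfderiv I (fun y => f y * g y) x w = f x * mvfderiv I g x w + mvfderiv I f x w * g x := by
  have h := (HasMFDerivAt.mul' hf.hasMFDerivAt hg.hasMFDerivAt).mfderiv
  have h' := congrArg (fun A : E →L[𝕜] 𝒜 => A w) h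
  exact h'

/-- The base point `y` is separate from `f x` for use at points that agree only propositionally,
such as `act p 1` and `p`. -/
theorem mvfderiv_comp_mfderiv {E₂ : Type*} [NormedAddCommGroup E₂] [NormedSpace 𝕜 E₂]
    {H₂ : Type*} [TopologicalSpace H₂] {I₂ : ModelWithCorners 𝕜 E₂ H₂} {N : Type*}
    [TopologicalSpace N] [ChartedSpace H₂ N] {F : Type*} [NormedAddCommGroup F] [NormedSpace 𝕜 F]
    {g : N → F} {f : M → N} {x : M} {y : N} (hg : MDifferentiableAt I₂ 𝓘(𝕜, F) g y)
    (hf : MDifferentiableAt I I₂ f x) (hy : f x = y) (w : TangentSpace I x) :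
    mvfderiv I (fun z => g (f z)) x w = mvfderiv I₂ g y (mfderiv I I₂ f x w : E₂) := by
  subst hy
  exact mfderiv_comp_apply x hg hf w

theorem mvfderiv_clm_comp {F F' : Type*} [NormedAddCommGroup F] [NormedSpace 𝕜 F]
    [NormedAddCommGroup F'] [NormedSpace 𝕜 F'] (T : F →L[𝕜] F') {f : M → F} {x : M}
    (hf : MDifferentiableAt I 𝓘(𝕜, F) f x) (w : TangentSpace I x) :
    mvfderiv I (fun y => T (f y)) x w = T (mvfderiv I f x w) := by
  have hT : mfderiv 𝓘(𝕜, F) 𝓘(𝕜, F') T (f x) = (T : F →L[𝕜] F') := by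
    rw [mfderiv_eq_fderiv, T.fderiv]
  have h := mvfderiv_comp_mfderiv (g := T) T.differentiableAt.mdifferentiableAt hf rfl w
  refine h.trans ?_
  exact congrArg (fun A : F →L[𝕜] F' => A (mvfderiv I f x w)) hT

theorem Filter.EventuallyEq.mvfderiv_eq {F : Type*} [NormedAddCommGroup F] [NormedSpace 𝕜 F]
    {f g : M → F} {x : M} (h : f =ᶠ[nhds x] g) (w : TangentSpace I x) :
    mvfderiv I f x w = mvfderiv I g x w := by
  have := h.mfderiv_eq (I := I) (I' := 𝓘(𝕜, F))
  exact congrArg (fun A : E →L[𝕜] F => A w) this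

/-- In a chart the function has zero derivative on a ball, hence is constant there; a locally
constant function on a preconnected space is constant. -/
theorem apply_eq_of_mvfderiv_eq_zero {E : Type*} [NormedAddCommGroup E] [NormedSpace ℂ E]
    {M : Type*} [TopologicalSpace M] [ChartedSpace E M] [IsManifold 𝓘(ℂ, E) 1 M]
    [PreconnectedSpace M] {F : Type*} [NormedAddCommGroup F] [NormedSpace ℂ F] {f : M → F}
    (hf : MDifferentiable 𝓘(ℂ, E) 𝓘(ℂ, F) f)
    (h : ∀ x (w : TangentSpace 𝓘(ℂ, E) x), mvfderiv 𝓘(ℂ, E) f x w = 0) (x y : M) : f x = f y := by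
  have hloc : IsLocallyConstant f := by
    rw [IsLocallyConstant.iff_eventually_eq]
    intro x
    set φ := extChartAt 𝓘(ℂ, E) x
    have hopen : IsOpen φ.target := isOpen_extChartAt_target x
    have hx : φ x ∈ φ.target := mem_extChartAt_target x
    obtain ⟨r, hr, hball⟩ := Metric.isOpen_iff.1 hopen _ hx
    have hd : ∀ z ∈ φ.target, HasFDerivAt (f ∘ φ.symm) (0 : E →L[ℂ] F) z := by
      intro z hz
      have h1 : MDifferentiableAt 𝓘(ℂ, E) 𝓘(ℂ, E) φ.symm z :=
        ((contMDiffOn_extChartAt_symm (n := 1) x).contMDiffAt (hopen.mem_nhds hz)).mdifferentiableAt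
          (by simp)
      have h2 : DifferentiableAt ℂ (f ∘ φ.symm) z :=
        ((hf (φ.symm z)).comp z h1).differentiableAt
      have h3 : fderiv ℂ (f ∘ φ.symm) z = 0 := by
        ext u
        have := mvfderiv_comp_mfderiv (hf (φ.symm z)) h1 rfl u
        rw [h] at this
        refine Eq.trans ?_ this
        rw [← mfderiv_eq_fderiv]
        rfl
      exact h3 ▸ h2.hasFDerivAt
    have hconst : ∀ z ∈ Metric.ball (φ x) r, f (φ.symm z) = f (φ.symm (φ x)) := by
      intro z hz
      refine (convex_ball (φ x) r).is_const_of_fderivWithin_eq_zero (𝕜 := ℂ) (f := f ∘ φ.symm)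
        (fun u hu => (hd u (hball hu)).differentiableAt.differentiableWithinAt) (fun u hu => ?_)
        hz (Metric.mem_ball_self hr)
      rw [fderivWithin_of_isOpen Metric.isOpen_ball hu]
      exact (hd u (hball hu)).fderiv
    filter_upwards [extChartAt_source_mem_nhds (I := 𝓘(ℂ, E)) x,
      (continuousAt_extChartAt (I := 𝓘(ℂ, E)) x).preimage_mem_nhds (Metric.ball_mem_nhds _ hr)]
      with y hy hy'
    have := hconst _ hy'
    rwa [φ.left_inv hy, extChartAt_to_inv] at this
  exact hloc.apply_eq_of_preconnectedSpace x y

end ProductRule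

/-! ### Differentials of representations in a normed algebra -/

section AlgebraRepresentation

variable {EG : Type*} [NormedAddCommGroup EG] [NormedSpace ℂ EG] [FiniteDimensional ℂ EG]
  {G : Type*} [TopologicalSpace G] [ChartedSpace EG G] [Group G] [LieGroup 𝓘(ℂ, EG) ω G]
  {𝒜 : Type*} [NormedRing 𝒜] [NormedAlgebra ℂ 𝒜]

/-- The differential at the identity of a homomorphism into a normed algebra. -/
def repDeriv (R : G →* 𝒜) : GroupLieAlgebra 𝓘(ℂ, EG) G →ₗ[ℂ] 𝒜 :=
  (mvfderiv 𝓘(ℂ, EG) (fun g => R g) 1 : EG →L[ℂ] 𝒜).toLinearMap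

variable {R : G →* 𝒜}

theorem mdifferentiable_rep (hR : ContMDiff 𝓘(ℂ, EG) 𝓘(ℂ, 𝒜) ω (fun g => R g)) :
    MDifferentiable 𝓘(ℂ, EG) 𝓘(ℂ, 𝒜) (fun g => R g) := hR.mdifferentiable (by simp)

theorem mdifferentiable_lie_mul_left (a : G) : MDifferentiable 𝓘(ℂ, EG) 𝓘(ℂ, EG) (fun h : G => a * h) :=
  (contMDiff_mul_left (I := 𝓘(ℂ, EG)) (n := ω) (a := a)).mdifferentiable (by simp)

theorem mvfderiv_rep_mul_left (hR : ContMDiff 𝓘(ℂ, EG) 𝓘(ℂ, 𝒜) ω (fun g => R g)) (g h : G)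
    (v : EG) :
    mvfderiv 𝓘(ℂ, EG) (fun g => R g) (g * h)
        (mfderiv 𝓘(ℂ, EG) 𝓘(ℂ, EG) (fun x => g * x) h v) =
      R g * mvfderiv 𝓘(ℂ, EG) (fun g => R g) h v := by
  have h1 := mvfderiv_comp_mfderiv (mdifferentiable_rep hR (g * h))
    (mdifferentiable_lie_mul_left g h) rfl v
  have h2 : mvfderiv 𝓘(ℂ, EG) (fun x => (ContinuousLinearMap.mul ℂ 𝒜 (R g)) (R x)) h v = _ :=
    mvfderiv_clm_comp _ (mdifferentiable_rep hR h) v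
  have e : (fun x => R (g * x)) = fun x => (ContinuousLinearMap.mul ℂ 𝒜 (R g)) (R x) := by
    ext x; simp
  rw [e] at h1
  exact h1.symm.trans h2

/-- `R` relates the left-invariant field of `v` to the linear field `Y ↦ Y * repDeriv R v` on `𝒜`.
-/
theorem mvfderiv_rep_mulInvariantVectorField
    (hR : ContMDiff 𝓘(ℂ, EG) 𝓘(ℂ, 𝒜) ω (fun g => R g)) (v : GroupLieAlgebra 𝓘(ℂ, EG) G) (g : G) :
    mvfderiv 𝓘(ℂ, EG) (fun g => R g) g (mulInvariantVectorField v g) = R g * repDeriv R v := by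
  have aux : ∀ (x : G) (_ : x = g) (u : EG), mvfderiv 𝓘(ℂ, EG) (fun g => R g) g u =
      mvfderiv 𝓘(ℂ, EG) (fun g => R g) x u := by
    rintro _ rfl u; rfl
  exact (aux (g * 1) (mul_one g) _).trans (mvfderiv_rep_mul_left hR g 1 v)

/-- The differential of a representation takes values in translates of the image of the Lie
algebra. -/
theorem mvfderiv_rep_eq (hR : ContMDiff 𝓘(ℂ, EG) 𝓘(ℂ, 𝒜) ω (fun g => R g)) (g : G)
    (u : TangentSpace 𝓘(ℂ, EG) g) :
    ∃ m : GroupLieAlgebra 𝓘(ℂ, EG) G,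
      mvfderiv 𝓘(ℂ, EG) (fun g => R g) g u = R g * repDeriv R m := by
  have aux : ∀ (x : G) (_ : x = 1) (u : EG), mvfderiv 𝓘(ℂ, EG) (fun g => R g) 1 u =
      mvfderiv 𝓘(ℂ, EG) (fun g => R g) x u := by
    rintro _ rfl u; rfl
  refine ⟨(mfderiv 𝓘(ℂ, EG) 𝓘(ℂ, EG) (fun x => g⁻¹ * x) g u : EG), ?_⟩
  have h1 := mvfderiv_rep_mul_left hR g⁻¹ g u
  refine Eq.trans ?_ (congrArg (R g * ·) (h1.symm.trans (aux _ (inv_mul_cancel g) _).symm))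
  rw [← mul_assoc, ← map_mul, mul_inv_cancel, map_one, one_mul]

/-- Left-invariant fields are related by `R` to right multiplications, and the bracket of two right
multiplications is right multiplication by the commutator; evaluate at `R 1 = 1`. -/
theorem repDeriv_lie (hR : ContMDiff 𝓘(ℂ, EG) 𝓘(ℂ, 𝒜) ω (fun g => R g))
    (v w : GroupLieAlgebra 𝓘(ℂ, EG) G) :
    repDeriv R ⁅v, w⁆ = repDeriv R v * repDeriv R w - repDeriv R w * repDeriv R v := by
  have : CompleteSpace EG := FiniteDimensional.complete ℂ EG
  have hd : ∀ a : 𝒜, HasFDerivAt (fun Y : 𝒜 => Y * a) ((ContinuousLinearMap.mul ℂ 𝒜).flip a) (R 1) :=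
    fun a => ((ContinuousLinearMap.mul ℂ 𝒜).flip a).hasFDerivAt
  have key := mvfderiv_mlieBracket_of_related (V := mulInvariantVectorField v)
    (W := mulInvariantVectorField w) (V' := fun Y => Y * repDeriv R v)
    (W' := fun Y => Y * repDeriv R w) (x := 1) hR
    (mdifferentiableAt_mulInvariantVectorField _) (mdifferentiableAt_mulInvariantVectorField _)
    (hd _).differentiableAt (hd _).differentiableAt
    (fun y => mvfderiv_rep_mulInvariantVectorField hR v y)
    (fun y => mvfderiv_rep_mulInvariantVectorField hR w y)
  refine key.trans ?_
  rw [lieBracket, (hd _).fderiv, (hd _).fderiv]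
  simp

theorem repDeriv_Ad (hR : ContMDiff 𝓘(ℂ, EG) 𝓘(ℂ, 𝒜) ω (fun g => R g)) (g : G)
    (v : GroupLieAlgebra 𝓘(ℂ, EG) G) : repDeriv R (Ad g v) = R g * repDeriv R v * R g⁻¹ := by
  have h1 := mvfderiv_comp_mfderiv (mdifferentiable_rep hR (1 : G))
    (mdifferentiable_conj (EG := EG) g (1 : G)) (by simp) v
  let T : 𝒜 →L[ℂ] 𝒜 :=
    (ContinuousLinearMap.mul ℂ 𝒜).flip (R g⁻¹) ∘L ContinuousLinearMap.mul ℂ 𝒜 (R g)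
  have h2 := mvfderiv_clm_comp T (mdifferentiable_rep hR (1 : G)) v
  have e : (fun h : G => R (g * h * g⁻¹)) = fun x => T (R x) := by
    ext x; simp [T]
  rw [e] at h1
  exact h1.symm.trans h2

/-- The adjoint action of a connected group fixes the centre of the Lie algebra. -/
theorem Ad_eq_of_mem_center [ConnectedSpace G]
    (hR : ContMDiff 𝓘(ℂ, EG) 𝓘(ℂ, 𝒜) ω (fun g => R g)) (hinj : Function.Injective (repDeriv (EG := EG) R))
    {z : GroupLieAlgebra 𝓘(ℂ, EG) G}
    (hz : z ∈ LieAlgebra.center ℂ (GroupLieAlgebra 𝓘(ℂ, EG) G)) (g : G) : Ad g z = z := by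
  have : IsManifold 𝓘(ℂ, EG) 1 G := IsManifold.of_le (n := ω) (by simp)
  apply hinj
  set a := repDeriv R z
  have hinv : ContMDiff 𝓘(ℂ, EG) 𝓘(ℂ, EG) ω (fun g : G => g⁻¹) := contMDiff_inv 𝓘(ℂ, EG) ω
  have hS : MDifferentiable 𝓘(ℂ, EG) 𝓘(ℂ, 𝒜) (fun g => R g⁻¹) :=
    (hR.comp hinv).mdifferentiable (by simp)
  have hRd := mdifferentiable_rep hR
  have hcomm : ∀ m : GroupLieAlgebra 𝓘(ℂ, EG) G, repDeriv R m * a = a * repDeriv R m := by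
    intro m
    have h0 : ⁅m, z⁆ = 0 := (LieModule.mem_maxTrivSubmodule ℂ _ _ z).1 hz m
    have := repDeriv_lie hR m z
    rw [h0, map_zero] at this
    exact (sub_eq_zero.1 this.symm)
  have hRa : MDifferentiable 𝓘(ℂ, EG) 𝓘(ℂ, 𝒜) (fun g => R g * a) := fun x =>
    ((ContinuousLinearMap.mul ℂ 𝒜).flip a).differentiableAt.comp_mdifferentiableAt (hRd x)
  -- If `dR = R m` in some direction, then `d(R⁻¹) = -m R⁻¹`, so the derivative of `R a R⁻¹` is `R
  -- (m a - a m) R⁻¹`. It vanishes because `z` is central, so the function equals its value `a` at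
  -- `1`.
  have h0 := apply_eq_of_mvfderiv_eq_zero (f := fun g => R g * a * R g⁻¹)
    (fun x => (hRa x).mul (hS x)) (fun x w => ?_) g 1
  · rw [repDeriv_Ad hR]
    simpa using h0
  obtain ⟨m, hm⟩ := mvfderiv_rep_eq hR x w
  have h1 := mvfderiv_mul_algebra (hRd x) (hS x) w
  have e : (fun y => R y * R y⁻¹) = fun _ => (1 : 𝒜) := by
    ext y; rw [← map_mul, mul_inv_cancel, map_one]
  rw [e, mvfderiv_const] at h1
  have h2 : mvfderiv 𝓘(ℂ, EG) (fun y => R y⁻¹) x w = - (repDeriv R m * R x⁻¹) := by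
    have := congrArg (R x⁻¹ * ·) h1
    simp only [zero_apply, mul_zero, mul_add, ← mul_assoc, ← map_mul,
      inv_mul_cancel, map_one, one_mul, hm] at this
    exact eq_neg_of_add_eq_zero_left this.symm
  have h3 : mvfderiv 𝓘(ℂ, EG) (fun y => R y * a) x w = R x * repDeriv R m * a := by
    rw [← hm]
    exact mvfderiv_clm_comp ((ContinuousLinearMap.mul ℂ 𝒜).flip a) (hRd x) w
  rw [mvfderiv_mul_algebra (hRa x) (hS x), h2, h3, mul_assoc (R x) _ a, hcomm]
  noncomm_ring

end AlgebraRepresentation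

/-! ### The radical of a trace form and complex powers of unipotent matrices -/

section TraceRadical

variable {n : ℕ}

/-- The radical of the trace form of an algebra of matrices. -/
def traceRadical (A : Subalgebra ℂ (Matrix (Fin n) (Fin n) ℂ)) :
    Submodule ℂ (Matrix (Fin n) (Fin n) ℂ) where
  carrier := {a | a ∈ A ∧ ∀ b ∈ A, (a * b).trace = 0}
  add_mem' := fun ha hb => ⟨A.add_mem ha.1 hb.1, fun c hc => by
    rw [add_mul, Matrix.trace_add, ha.2 c hc, hb.2 c hc, add_zero]⟩
  zero_mem' := ⟨A.zero_mem, fun b _ => by simp⟩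
  smul_mem' := fun c a ha => ⟨A.smul_mem ha.1 c, fun b hb => by
    rw [smul_mul_assoc, Matrix.trace_smul, ha.2 b hb, smul_zero]⟩

variable {A : Subalgebra ℂ (Matrix (Fin n) (Fin n) ℂ)} {a b : Matrix (Fin n) (Fin n) ℂ}

theorem mul_mem_traceRadical (ha : a ∈ traceRadical A) (hb : b ∈ A) : a * b ∈ traceRadical A :=
  ⟨A.mul_mem ha.1 hb, fun c hc => by rw [mul_assoc]; exact ha.2 _ (A.mul_mem hb hc)⟩

theorem pow_succ_mem_traceRadical (ha : a ∈ traceRadical A) (k : ℕ) :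
    a ^ (k + 1) ∈ traceRadical A := by
  rw [pow_succ']
  exact mul_mem_traceRadical ha (A.pow_mem ha.1 k)

/-- The trace of `a ^ (k + 1) = a * a ^ k` vanishes for every `k`, since `a ^ k` lies in `A`. -/
theorem isNilpotent_of_mem_traceRadical (ha : a ∈ traceRadical A) : IsNilpotent a := by
  have h : IsNilpotent (Matrix.toLinAlgEquiv' a) := by
    refine Module.End.isNilpotent_of_trace_pow_eq_zero _ fun k => ?_
    rw [← map_pow, pow_succ']
    have := ha.2 _ (A.pow_mem ha.1 k)
    rw [← Matrix.trace_toLin'_eq] at this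
    exact this
  exact (IsNilpotent.map_iff Matrix.toLinAlgEquiv'.injective).1 h

/-- The characteristic polynomial is `X ^ n`. An exponent independent of `a` keeps the inverse
series of `oneAddUnit` a fixed finite sum as `a` varies. -/
theorem pow_eq_zero_of_mem_traceRadical (ha : a ∈ traceRadical A) : a ^ n = 0 := by
  have h : IsNilpotent (Matrix.toLinAlgEquiv' a) :=
    (isNilpotent_of_mem_traceRadical ha).map Matrix.toLinAlgEquiv'
  have h1 := LinearMap.aeval_self_charpoly (Matrix.toLinAlgEquiv' a)
  rw [h.charpoly_eq_X_pow_finrank, map_pow, Polynomial.aeval_X,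
    Module.finrank_fin_fun, ← map_pow] at h1
  exact Matrix.toLinAlgEquiv'.injective (h1.trans (map_zero _).symm)

/-- The unit `1 + a` for `a ^ m = 0`. -/
def oneAddUnit {𝒜 : Type*} [Ring 𝒜] (a : 𝒜) (m : ℕ) (h : a ^ m = 0) : 𝒜ˣ where
  val := 1 + a
  inv := ∑ i ∈ Finset.range m, (-a) ^ i
  val_inv := by
    have := mul_neg_geom_sum (-a) m
    rwa [sub_neg_eq_add, neg_pow, h, mul_zero, sub_zero] at this
  inv_val := by
    have := geom_sum_mul_neg (-a) m
    rwa [sub_neg_eq_add, neg_pow, h, mul_zero, sub_zero] at this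

/-- With `a = g - 1`, the inverse is a polynomial in `a`, so it lies in `A`, and `g⁻¹ - 1 = -a *
g⁻¹`. -/
theorem inv_sub_one_mem_traceRadical {g : (Matrix (Fin n) (Fin n) ℂ)ˣ}
    (hg : (g : Matrix (Fin n) (Fin n) ℂ) - 1 ∈ traceRadical A) :
    ((g⁻¹ : (Matrix (Fin n) (Fin n) ℂ)ˣ) : Matrix (Fin n) (Fin n) ℂ) - 1 ∈ traceRadical A := by
  set a : Matrix (Fin n) (Fin n) ℂ := g - 1 with ha
  have h0 := pow_eq_zero_of_mem_traceRadical hg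
  have hgu : g = oneAddUnit a n h0 := Units.ext (by simp [oneAddUnit, ha])
  have hinv : ((g⁻¹ : (Matrix (Fin n) (Fin n) ℂ)ˣ) : Matrix (Fin n) (Fin n) ℂ) ∈ A := by
    rw [hgu]
    change (∑ i ∈ Finset.range n, (-a) ^ i) ∈ A
    exact A.sum_mem fun i _ => A.pow_mem (A.neg_mem hg.1) i
  have : ((g⁻¹ : (Matrix (Fin n) (Fin n) ℂ)ˣ) : Matrix (Fin n) (Fin n) ℂ) - 1 =
      (-a) * ((g⁻¹ : (Matrix (Fin n) (Fin n) ℂ)ˣ) : Matrix (Fin n) (Fin n) ℂ) := by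
    rw [ha, neg_sub, sub_mul, one_mul, Units.mul_inv]
  rw [this]
  exact mul_mem_traceRadical ((traceRadical A).neg_mem hg) hinv

/-- The polynomial in `t` whose values at natural numbers are the binomial coefficients. -/
def binomialPoly (k : ℕ) : Polynomial ℂ :=
  Polynomial.C ((k.factorial : ℂ)⁻¹) * descPochhammer ℂ k

theorem binomialPoly_eval_nat (k j : ℕ) : (binomialPoly k).eval (j : ℂ) = j.choose k := by
  rw [binomialPoly, Polynomial.eval_mul, Polynomial.eval_C, descPochhammer_eval_eq_descFactorial,
    Nat.descFactorial_eq_factorial_mul_choose, Nat.cast_mul, ← mul_assoc, inv_mul_cancel₀, one_mul]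
  exact_mod_cast k.factorial_ne_zero

/-- `(1 + a) ^ t - 1` for complex `t` and nilpotent `a`. -/
def unipotentPow (a : Matrix (Fin n) (Fin n) ℂ) (t : ℂ) : Matrix (Fin n) (Fin n) ℂ :=
  ∑ k ∈ Finset.range n, (binomialPoly (k + 1)).eval t • a ^ (k + 1)

theorem unipotentPow_mem (ha : a ∈ traceRadical A) (t : ℂ) : unipotentPow a t ∈ traceRadical A :=
  Submodule.sum_mem _ fun k _ => Submodule.smul_mem _ _ (pow_succ_mem_traceRadical ha k)

theorem continuous_unipotentPow (a : Matrix (Fin n) (Fin n) ℂ) : Continuous (unipotentPow a) :=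
  continuous_finsetSum _ fun _ _ => (Polynomial.continuous _).smul continuous_const

theorem unipotentPow_nat (h : a ^ n = 0) (j : ℕ) : 1 + unipotentPow a j = (1 + a) ^ j := by
  have hpow : ∀ k, n ≤ k → a ^ k = 0 := fun k hk => by
    rw [← Nat.sub_add_cancel hk, pow_add, h, mul_zero]
  have h1 : (1 + a) ^ j = ∑ k ∈ Finset.range (j + 1), (j.choose k : ℂ) • a ^ k := by
    rw [add_comm, (Commute.one_right a).add_pow]
    refine Finset.sum_congr rfl fun k _ => ?_
    rw [one_pow, mul_one, Nat.cast_smul_eq_nsmul, nsmul_eq_mul, Nat.cast_comm]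
  have h2 : ∀ m₁ m₂ : ℕ, m₁ ≤ m₂ → (∀ k, m₁ ≤ k → (j.choose k : ℂ) • a ^ k = 0) →
      ∑ k ∈ Finset.range m₁, (j.choose k : ℂ) • a ^ k =
        ∑ k ∈ Finset.range m₂, (j.choose k : ℂ) • a ^ k := by
    intro m₁ m₂ hm hz
    refine Finset.sum_subset (Finset.range_mono hm) fun k _ hk => hz k (by simpa using hk)
  -- The binomial sum stops at `k = j` because the coefficients vanish, while the sum defining
  -- `unipotentPow` stops at `k = n` because the powers of `a` vanish. Both are extended to a common
  -- range.
  rw [h1, h2 (j + 1) (j + 1 + (n + 1)) (by omega)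
    (fun k hk => by rw [Nat.choose_eq_zero_of_lt (by omega)]; simp),
    ← h2 (n + 1) (j + 1 + (n + 1)) (by omega) (fun k hk => by rw [hpow k (by omega), smul_zero]),
    Finset.sum_range_succ', unipotentPow, add_comm]
  simp [binomialPoly_eval_nat]

/-- A polynomial in the matrix entries that vanishes on all natural powers of a unipotent matrix
vanishes on all its complex powers. -/
theorem eval_unipotentPow_eq_zero (h : a ^ n = 0) (F : MvPolynomial (Fin n × Fin n) ℂ)
    (hF : ∀ j : ℕ, MvPolynomial.eval (fun ij : Fin n × Fin n => ((1 + a) ^ j) ij.1 ij.2) F = 0)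
    (t : ℂ) :
    MvPolynomial.eval (fun ij : Fin n × Fin n => (1 + unipotentPow a t) ij.1 ij.2) F = 0 := by
  -- The entries of the `t`-th power are polynomials in `t`, so substituting them into `F` gives a
  -- one-variable polynomial that vanishes at all natural numbers and hence is zero.
  let q : Fin n × Fin n → Polynomial ℂ := fun ij =>
    Polynomial.C ((1 : Matrix (Fin n) (Fin n) ℂ) ij.1 ij.2) + ∑ k ∈ Finset.range n,
      binomialPoly (k + 1) * Polynomial.C ((a ^ (k + 1)) ij.1 ij.2)
  have hq : ∀ t ij, (q ij).eval t = (1 + unipotentPow a t) ij.1 ij.2 := by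
    intro t ij
    simp [q, unipotentPow, Polynomial.eval_finsetSum, Matrix.add_apply, Matrix.sum_apply]
  have hQ : ∀ t, (MvPolynomial.aeval q F).eval t =
      MvPolynomial.eval (fun ij : Fin n × Fin n => (1 + unipotentPow a t) ij.1 ij.2) F := by
    intro t
    have h1 := MvPolynomial.comp_aeval_apply (R := ℂ) q (Polynomial.aeval (R := ℂ) t) F
    rw [Polynomial.coe_aeval_eq_eval] at h1
    simp only [hq] at h1
    exact h1
  have h0 : MvPolynomial.aeval q F = 0 := by
    refine Polynomial.eq_zero_of_infinite_isRoot _ (Set.Infinite.mono (s := Set.range ((↑) : ℕ → ℂ))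
      ?_ (Set.infinite_range_of_injective Nat.cast_injective))
    rintro _ ⟨j, rfl⟩
    change Polynomial.eval _ _ = 0
    rw [hQ, unipotentPow_nat h, hF]
  rw [← hQ, h0, Polynomial.eval_zero]

end TraceRadical

/-! ### The unipotent normal subgroup defined by the trace radical -/

section Reductive

variable {EG : Type*} [NormedAddCommGroup EG] [NormedSpace ℂ EG]
  {G : Type*} [TopologicalSpace G] [ChartedSpace EG G] [Group G]

/-- In a reductive group, an element `g` with `ρ g - 1` in the radical of the trace form of an
algebra stable under conjugation by the group is trivial. -/
theorem LinearAlgebraicStructure.eq_one_of_sub_one_mem_traceRadical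
    (alg : LinearAlgebraicStructure EG G) (reductive : alg.IsReductive)
    (A : Subalgebra ℂ (Matrix (Fin alg.n) (Fin alg.n) ℂ))
    (hA : ∀ g, ∀ a ∈ A, (alg.ρ g : Matrix (Fin alg.n) (Fin alg.n) ℂ) * a *
      (alg.ρ g⁻¹ : Matrix (Fin alg.n) (Fin alg.n) ℂ) ∈ A) {g : G}
    (hg : (alg.ρ g : Matrix (Fin alg.n) (Fin alg.n) ℂ) - 1 ∈ traceRadical A) : g = 1 := by
  set r : G → Matrix (Fin alg.n) (Fin alg.n) ℂ := fun g => (alg.ρ g : Matrix _ _ ℂ) with hr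
  have hr1 : r 1 = 1 := by simp [hr]
  have hrm : ∀ g h, r (g * h) = r g * r h := fun g h => by simp [hr]
  have hri : ∀ g, r g * r g⁻¹ = 1 := fun g => by rw [← hrm, mul_inv_cancel, hr1]
  have hri' : ∀ g, r g⁻¹ * r g = 1 := fun g => by rw [← hrm, inv_mul_cancel, hr1]
  let U : Subgroup G :=
    { carrier := {g | r g - 1 ∈ traceRadical A}
      one_mem' := by simp [hr1]
      mul_mem' := by
        intro g h hg hh
        change r (g * h) - 1 ∈ traceRadical A
        have : r (g * h) - 1 = (r g - 1) * (r h - 1) + (r g - 1) + (r h - 1) := by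
          rw [hrm]; noncomm_ring
        rw [this]
        exact Submodule.add_mem _ (Submodule.add_mem _ (mul_mem_traceRadical hg hh.1) hg) hh
      inv_mem' := by
        intro g hg
        change r g⁻¹ - 1 ∈ traceRadical A
        have := inv_sub_one_mem_traceRadical (g := alg.ρ g) hg
        rwa [← map_inv] at this }
  have hUmem : ∀ g, g ∈ U ↔ r g - 1 ∈ traceRadical A := fun g => Iff.rfl
  have hnormal : U.Normal := by
    refine ⟨fun u hu g => ?_⟩
    rw [hUmem] at hu ⊢
    have : r (g * u * g⁻¹) - 1 = r g * (r u - 1) * r g⁻¹ := by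
      rw [hrm, hrm, mul_sub, sub_mul, mul_one, hri]
    rw [this]
    -- By cyclicity of the trace, conjugation by `g` can be moved from `r u - 1` to `b`, and `A` is
    -- stable under it.
    refine ⟨hA g _ hu.1, fun b hb => ?_⟩
    have h1 : r g * (r u - 1) * r g⁻¹ * b = r g * ((r u - 1) * (r g⁻¹ * b)) := by
      simp only [mul_assoc]
    rw [h1, Matrix.trace_mul_comm, mul_assoc]
    refine hu.2 _ ?_
    have := hA g⁻¹ b hb
    rwa [inv_inv] at this
  -- The polynomials defining the group vanish on the natural powers of `u`, hence on all its
  -- complex powers, which therefore lie in the group.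
  have hpow : ∀ u ∈ U, ∀ t : ℂ, ∃ v ∈ U, r v = 1 + unipotentPow (r u - 1) t := by
    intro u hu t
    rw [hUmem] at hu
    have ha := unipotentPow_mem hu t
    obtain ⟨I, hI⟩ := alg.isZariskiClosed
    have hmem : oneAddUnit _ _ (pow_eq_zero_of_mem_traceRadical ha) ∈
        (alg.ρ.range : Set (GL (Fin alg.n) ℂ)) := by
      refine (hI _).2 fun F hF => ?_
      refine eval_unipotentPow_eq_zero (pow_eq_zero_of_mem_traceRadical hu) F (fun j => ?_) t
      have := (hI (alg.ρ (u ^ j))).1 ⟨_, rfl⟩ F hF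
      rw [map_pow, Units.val_pow_eq_pow_val] at this
      rwa [add_sub_cancel]
    obtain ⟨v, hv⟩ := hmem
    have hrv : r v = 1 + unipotentPow (r u - 1) t := by
      simp only [hr]; rw [hv]; rfl
    refine ⟨v, ?_, hrv⟩
    rw [hUmem, hrv, add_sub_cancel_left]
    exact ha
  -- The curve of complex powers joins `1` at `t = 0` to `u` at `t = 1`. Since `ρ` is an embedding,
  -- it suffices to argue inside `GL`.
  have hconn : IsConnected (U : Set G) := by
    refine ⟨⟨1, U.one_mem⟩, ?_⟩
    rw [← alg.isEmbedding.isInducing.isPreconnected_image]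
    refine isPreconnected_of_forall 1 ?_
    rintro _ ⟨u, hu, rfl⟩
    have hu' := (hUmem u).1 hu
    let c : ℂ → GL (Fin alg.n) ℂ := fun t =>
      oneAddUnit _ _ (pow_eq_zero_of_mem_traceRadical (unipotentPow_mem hu' t))
    -- The topology of the unit group also involves the inverse, which is a finite geometric sum of
    -- fixed length.
    have hc : Continuous c := by
      rw [Units.continuous_iff]
      constructor
      · exact continuous_const.add (continuous_unipotentPow _)
      · change Continuous fun t => ∑ i ∈ Finset.range _, (-unipotentPow _ t) ^ i
        exact continuous_finsetSum _ fun i _ => (continuous_unipotentPow _).neg.pow i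
    refine ⟨Set.range c, ?_, ⟨0, ?_⟩, ⟨1, ?_⟩, isPreconnected_range hc⟩
    · rintro _ ⟨t, rfl⟩
      obtain ⟨v, hv, hrv⟩ := hpow u hu t
      exact ⟨v, hv, Units.ext hrv⟩
    · refine Units.ext ?_
      have := unipotentPow_nat (pow_eq_zero_of_mem_traceRadical hu') 0
      rw [pow_zero, Nat.cast_zero] at this
      exact this
    · refine Units.ext ?_
      have := unipotentPow_nat (pow_eq_zero_of_mem_traceRadical hu') 1
      rw [pow_one, Nat.cast_one, add_sub_cancel] at this
      exact this
  -- To the equations of `G` are added the affine linear equations `ℓ (g - 1) = 0`, for `ℓ` in the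
  -- annihilator of the trace radical.
  have hclosed : IsZariskiClosed (alg.ρ '' (U : Set G)) := by
    obtain ⟨I, hI⟩ := alg.isZariskiClosed
    let P : Module.Dual ℂ (Matrix (Fin alg.n) (Fin alg.n) ℂ) →
        MvPolynomial (Fin alg.n × Fin alg.n) ℂ := fun ℓ =>
      ∑ ij : Fin alg.n × Fin alg.n,
        MvPolynomial.C (ℓ (Matrix.single ij.1 ij.2 1)) * MvPolynomial.X ij - MvPolynomial.C (ℓ 1)
    have hP : ∀ ℓ (m : Matrix (Fin alg.n) (Fin alg.n) ℂ),
        MvPolynomial.eval (fun ij : Fin alg.n × Fin alg.n => m ij.1 ij.2) (P ℓ) = ℓ (m - 1) := by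
      intro ℓ m
      rw [map_sub ℓ]
      conv_rhs => rw [Matrix.matrix_eq_sum_single m]
      simp only [P, map_sub, map_sum, map_mul, MvPolynomial.eval_C, MvPolynomial.eval_X,
        Fintype.sum_prod_type]
      congr 1
      refine Finset.sum_congr rfl fun i _ => Finset.sum_congr rfl fun j _ => ?_
      rw [mul_comm, ← smul_eq_mul, ← map_smul, Matrix.smul_single, smul_eq_mul, mul_one]
    refine ⟨I ∪ P '' {ℓ | ℓ ∈ (traceRadical A).dualAnnihilator}, fun g => ?_⟩
    have hJ : ∀ m, m ∈ traceRadical A ↔ ∀ ℓ ∈ (traceRadical A).dualAnnihilator, ℓ m = 0 :=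
      fun m => (Subspace.forall_mem_dualAnnihilator_apply_eq_zero_iff (traceRadical A) m).symm
    constructor
    · rintro ⟨u, hu, rfl⟩ F (hF | ⟨ℓ, hℓ, rfl⟩)
      · exact (hI _).1 ⟨u, rfl⟩ F hF
      · rw [hP]
        exact (hJ _).1 hu ℓ hℓ
    · intro h
      obtain ⟨u, rfl⟩ := (hI g).2 fun F hF => h F (Or.inl hF)
      refine ⟨u, (hJ _).2 fun ℓ hℓ => ?_, rfl⟩
      rw [← hP]
      exact h _ (Or.inr ⟨ℓ, hℓ, rfl⟩)
  have hbot := reductive U hnormal hconn hclosed fun u hu => isNilpotent_of_mem_traceRadical hu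
  have : g ∈ U := hg
  rwa [hbot, Subgroup.mem_bot] at this

end Reductive

/-! ### One-parameter subgroups and the exponential -/

section OneParameterSubgroup

variable {EG : Type*} [NormedAddCommGroup EG] [NormedSpace ℂ EG]
  {G : Type*} [TopologicalSpace G] [ChartedSpace EG G] [Group G] [LieGroup 𝓘(ℂ, EG) ω G]

theorem LieGroup.restrictScalars : LieGroup 𝓘(ℝ, EG) ω G where
  toIsManifold := isManifold_real_of_complex
  contMDiff_mul := fun x => ContMDiffWithinAt.restrictScalars_of_eq
    (I := 𝓘(ℂ, EG).prod 𝓘(ℂ, EG)) (I' := 𝓘(ℂ, EG)) rfl rfl (contMDiff_mul 𝓘(ℂ, EG) ω x)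
  contMDiff_inv := ContMDiff.restrictScalars (_root_.contMDiff_inv 𝓘(ℂ, EG) ω)

variable [FiniteDimensional ℂ EG] {𝒜 : Type*} [NormedRing 𝒜] [NormedAlgebra ℂ 𝒜]

/-- The image of a local one-parameter subgroup under a representation. -/
theorem exists_curve_hasDerivAt_rep {R : G →* 𝒜}
    (hR : ContMDiff 𝓘(ℂ, EG) 𝓘(ℂ, 𝒜) ω (fun g => R g)) (v : GroupLieAlgebra 𝓘(ℂ, EG) G) :
    ∃ γ : ℝ → G, γ 0 = 1 ∧
      ∀ᶠ t in nhds 0, HasDerivAt (fun t => R (γ t)) (R (γ t) * repDeriv R v) t := by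
  have : CompleteSpace EG := FiniteDimensional.complete ℂ EG
  -- Integral curves have a real time variable, so `G` is regarded as a real Lie group. Its
  -- left-invariant fields agree with the complex ones.
  have : LieGroup 𝓘(ℝ, EG) ω G := LieGroup.restrictScalars
  have : LieGroup 𝓘(ℝ, EG) (minSmoothness ℝ 3) G := LieGroup.of_le (n := ω) le_top
  have : IsManifold 𝓘(ℝ, EG) 1 G := IsManifold.of_le (n := ω) le_top
  obtain ⟨γ, hγ0, hγ⟩ := exists_isMIntegralCurveAt_of_contMDiffAt_boundaryless (I := 𝓘(ℝ, EG))
    (t₀ := 0) (x₀ := (1 : G)) (v := mulInvariantVectorField (I := 𝓘(ℝ, EG)) (v : EG))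
    ((contMDiff_mulInvariantVectorField (I := 𝓘(ℝ, EG)) (G := G) (v : EG) 1).of_le (by simp))
  refine ⟨γ, hγ0, ?_⟩
  filter_upwards [hγ] with t ht
  have hd : ∀ g : G, MDifferentiableAt 𝓘(ℂ, EG) 𝓘(ℂ, 𝒜) (fun g => R g) g := mdifferentiable_rep hR
  have h0 := (hd (γ t)).restrictScalars.hasMFDerivAt.comp t ht
  have key : ∀ (f : ℝ → 𝒜) (L : ℝ →L[ℝ] 𝒜) (d : 𝒜), HasFDerivAt f L t → L 1 = d →
      HasDerivAt f d t := fun f L d h hd => hd ▸ h.hasDerivAt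
  refine key _ ((mfderiv 𝓘(ℝ, EG) 𝓘(ℝ, 𝒜) (fun g => R g) (γ t) : EG →L[ℝ] 𝒜) ∘L ((1 : ℝ →L[ℝ] ℝ).smulRight
      (mulInvariantVectorField (I := 𝓘(ℝ, EG)) (G := G) (v : EG) (γ t) : EG))) _
    (hasMFDerivAt_iff_hasFDerivAt.1 h0) ?_
  refine Eq.trans ?_ (mvfderiv_rep_mulInvariantVectorField hR v (γ t))
  have e1 : ∀ u : EG, (mfderiv 𝓘(ℝ, EG) 𝓘(ℝ, 𝒜) (fun g => R g) (γ t) : EG →L[ℝ] 𝒜) u =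
      (mfderiv 𝓘(ℂ, EG) 𝓘(ℂ, 𝒜) (fun g => R g) (γ t) : EG →L[ℂ] 𝒜) u := fun u => by
    rw [(hd (γ t)).mfderiv_real]; rfl
  have e2 : ∀ u : EG, (mfderiv 𝓘(ℝ, EG) 𝓘(ℝ, EG) (fun h => γ t * h) 1 : EG →L[ℝ] EG) u =
      (mfderiv 𝓘(ℂ, EG) 𝓘(ℂ, EG) (fun h => γ t * h) 1 : EG →L[ℂ] EG) u := fun u => by
    rw [(mdifferentiable_lie_mul_left (EG := EG) (γ t) 1).mfderiv_real]; rfl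
  have e3 : ((1 : ℝ →L[ℝ] ℝ).smulRight
      (mulInvariantVectorField (I := 𝓘(ℝ, EG)) (G := G) (v : EG) (γ t) : EG)) (1 : ℝ) =
      (mulInvariantVectorField (I := 𝓘(ℝ, EG)) (G := G) (v : EG) (γ t) : EG) := by simp
  refine (e1 _).trans ?_
  refine congrArg (mfderiv 𝓘(ℂ, EG) 𝓘(ℂ, 𝒜) (fun g => R g) (γ t) : EG →L[ℂ] 𝒜) ?_
  exact e3.trans (e2 v)

/-- Along the integral curve `γ` with `(R ∘ γ)' = (R ∘ γ) N`, the product `R (γ t) * exp (-t N)` has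
derivative zero and equals `1` at `t = 0`. Small `t` is enough, since only a derivative at zero will
be taken. -/
theorem eventually_rep_eq_exp [CompleteSpace 𝒜] {R : G →* 𝒜}
    (hR : ContMDiff 𝓘(ℂ, EG) 𝓘(ℂ, 𝒜) ω (fun g => R g)) (v : GroupLieAlgebra 𝓘(ℂ, EG) G) :
    ∀ᶠ t : ℝ in nhds 0, ∃ g : G, R g = NormedSpace.exp (t • repDeriv R v) := by
  let +nondep : NormedAlgebra ℚ 𝒜 := .restrictScalars ℚ ℂ 𝒜
  obtain ⟨γ, h0, hγ⟩ := exists_curve_hasDerivAt_rep hR v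
  obtain ⟨ε, hε, hball⟩ := Metric.eventually_nhds_iff_ball.1 hγ
  refine Metric.eventually_nhds_iff_ball.2 ⟨ε, hε, fun t ht => ⟨γ t, ?_⟩⟩
  set N := repDeriv R v
  have hd : ∀ s ∈ Metric.ball (0 : ℝ) ε,
      HasDerivAt (fun s => R (γ s) * NormedSpace.exp (s • (-N))) 0 s := by
    intro s hs
    have := (hball s hs).mul (hasDerivAt_exp_smul_const' (𝕂 := ℝ) (-N) s)
    refine this.congr_deriv ?_
    noncomm_ring
  have hc := (convex_ball (0 : ℝ) ε).is_const_of_fderivWithin_eq_zero (𝕜 := ℝ)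
    (f := fun s => R (γ s) * NormedSpace.exp (s • (-N)))
    (fun u hu => (hd u hu).differentiableAt.differentiableWithinAt) (fun u hu => by
      rw [fderivWithin_of_isOpen Metric.isOpen_ball hu, (hd u hu).hasFDerivAt.fderiv]
      ext; simp) ht (Metric.mem_ball_self hε)
  simp only [h0, map_one, zero_smul, neg_zero, NormedSpace.exp_zero, mul_one, smul_neg] at hc
  have hinv : NormedSpace.exp (-(t • N)) * NormedSpace.exp (t • N) = 1 := by
    rw [← NormedSpace.exp_add_of_commute (Commute.neg_left (Commute.refl _)), neg_add_cancel,
      NormedSpace.exp_zero]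
  have := congrArg (· * NormedSpace.exp (t • N)) hc
  simpa [mul_assoc, hinv] using this

/-- All terms of the exponential series after the first lie in the closed subspace `J`, so their sum
does. -/
theorem exp_sub_one_mem_of_pow_mem [CompleteSpace 𝒜] (J : Submodule ℂ 𝒜)
    (hJ : IsClosed (J : Set 𝒜)) {x : 𝒜} (h : ∀ k, x ^ (k + 1) ∈ J) : NormedSpace.exp x - 1 ∈ J := by
  have h1 := (hasSum_nat_add_iff' 1).2 (NormedSpace.exp_series_hasSum_exp' (𝕂 := ℂ) x)
  simp only [Finset.range_one, Finset.sum_singleton, Nat.factorial_zero, Nat.cast_one, inv_one,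
    pow_zero, one_smul] at h1
  exact hJ.mem_of_tendsto h1 (Filter.Eventually.of_forall fun s =>
    J.sum_mem fun k _ => J.smul_mem _ (h k))

end OneParameterSubgroup

/-! ### The Lie algebra of a reductive group has central radical -/

section Reductive

variable {EG : Type*} [NormedAddCommGroup EG] [NormedSpace ℂ EG] [FiniteDimensional ℂ EG]
  {G : Type*} [TopologicalSpace G] [ChartedSpace EG G] [Group G] [LieGroup 𝓘(ℂ, EG) ω G]
  (alg : LinearAlgebraicStructure EG G)

/-- Matrices as continuous linear maps. -/
def matrixEquivCLM (n : ℕ) :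
    Matrix (Fin n) (Fin n) ℂ ≃ₐ[ℂ] ((Fin n → ℂ) →L[ℂ] (Fin n → ℂ)) :=
  Matrix.toLinAlgEquiv'.trans (Module.End.toContinuousLinearMap _)

/-- The representation on `ℂⁿ` of a linear algebraic group. -/
def LinearAlgebraicStructure.rep : G →* ((Fin alg.n → ℂ) →L[ℂ] (Fin alg.n → ℂ)) :=
  (matrixEquivCLM alg.n : _ →* _).comp ((Units.coeHom _).comp alg.ρ)

theorem LinearAlgebraicStructure.rep_apply (g : G) :
    alg.rep g = matrixEquivCLM alg.n (alg.ρ g : Matrix (Fin alg.n) (Fin alg.n) ℂ) := rfl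

theorem LinearAlgebraicStructure.contMDiff_rep :
    ContMDiff 𝓘(ℂ, EG) 𝓘(ℂ, (Fin alg.n → ℂ) →L[ℂ] (Fin alg.n → ℂ)) ω (fun g => alg.rep g) := by
  let T : (Fin alg.n → Fin alg.n → ℂ) →L[ℂ] ((Fin alg.n → ℂ) →L[ℂ] (Fin alg.n → ℂ)) :=
    LinearMap.toContinuousLinearMap
      ((matrixEquivCLM alg.n).toLinearMap ∘ₗ (Matrix.ofLinearEquiv ℂ).toLinearMap)
  have h : ContMDiff 𝓘(ℂ, EG) 𝓘(ℂ, Fin alg.n → Fin alg.n → ℂ) ω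
      (fun g i j => (alg.ρ g : Matrix (Fin alg.n) (Fin alg.n) ℂ) i j) :=
    contMDiff_pi_space.2 fun i => contMDiff_pi_space.2 fun j => alg.holomorphic i j
  exact T.contMDiff.comp h

theorem LinearAlgebraicStructure.repDeriv_injective :
    Function.Injective (repDeriv (EG := EG) alg.rep) := by
  refine (injective_iff_map_eq_zero _).2 fun v hv => alg.immersion v fun i j => ?_
  let T : ((Fin alg.n → ℂ) →L[ℂ] (Fin alg.n → ℂ)) →L[ℂ] ℂ :=
    LinearMap.toContinuousLinearMap
      (Matrix.entryLinearMap ℂ ℂ i j ∘ₗ (matrixEquivCLM alg.n).symm.toLinearMap)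
  have h := mvfderiv_clm_comp T (mdifferentiable_rep alg.contMDiff_rep (1 : G)) v
  have h' : T (repDeriv alg.rep v) = 0 := by rw [hv, map_zero]
  have e : (fun g => T (alg.rep g)) =
      fun g => (alg.ρ g : Matrix (Fin alg.n) (Fin alg.n) ℂ) i j := by
    ext g
    simp [T, alg.rep_apply]
  rw [e] at h
  exact h.trans h'

/-- The differential at the identity of the embedding of a linear algebraic group. -/
def LinearAlgebraicStructure.matDeriv :
    GroupLieAlgebra 𝓘(ℂ, EG) G →ₗ[ℂ] Matrix (Fin alg.n) (Fin alg.n) ℂ :=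
  (matrixEquivCLM alg.n).symm.toLinearMap ∘ₗ repDeriv alg.rep

theorem LinearAlgebraicStructure.matDeriv_lie (x y : GroupLieAlgebra 𝓘(ℂ, EG) G) :
    alg.matDeriv ⁅x, y⁆ = alg.matDeriv x * alg.matDeriv y - alg.matDeriv y * alg.matDeriv x := by
  simp [LinearAlgebraicStructure.matDeriv, repDeriv_lie alg.contMDiff_rep]

theorem LinearAlgebraicStructure.matDeriv_Ad (g : G) (x : GroupLieAlgebra 𝓘(ℂ, EG) G) :
    alg.matDeriv (Ad g x) = (alg.ρ g : Matrix (Fin alg.n) (Fin alg.n) ℂ) * alg.matDeriv x *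
      (alg.ρ g⁻¹ : Matrix (Fin alg.n) (Fin alg.n) ℂ) := by
  simp [LinearAlgebraicStructure.matDeriv, repDeriv_Ad alg.contMDiff_rep, alg.rep_apply]

/-- For small real `t`, `exp (t N)` lies in the image of the group and differs from `1` by an
element of the trace radical. Reductivity of `G` forces it to be `1`; differentiating at zero gives
`N = 0`, and the representation is an immersion. -/
theorem LinearAlgebraicStructure.eq_zero_of_matDeriv_mem_traceRadical
    (reductive : alg.IsReductive) {x : GroupLieAlgebra 𝓘(ℂ, EG) G}
    (hx : alg.matDeriv x ∈
      traceRadical (Algebra.adjoin ℂ (Set.range (alg.matDeriv (EG := EG))))) : x = 0 := by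
  set A := Algebra.adjoin ℂ (Set.range (alg.matDeriv (EG := EG))) with hAdef
  set r : G → Matrix (Fin alg.n) (Fin alg.n) ℂ := fun g => (alg.ρ g : Matrix _ _ ℂ) with hr
  have hr1 : r 1 = 1 := by simp [hr]
  have hrm : ∀ g h, r (g * h) = r g * r h := fun g h => by simp [hr]
  have hri : ∀ g, r g * r g⁻¹ = 1 := fun g => by rw [← hrm, mul_inv_cancel, hr1]
  have hri' : ∀ g, r g⁻¹ * r g = 1 := fun g => by rw [← hrm, inv_mul_cancel, hr1]
  -- Conjugation by the group acts on the generators as `Ad`, so it preserves the algebra they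
  -- generate.
  have hA : ∀ g, ∀ a ∈ A, r g * a * r g⁻¹ ∈ A := by
    intro g a ha
    induction ha using Algebra.adjoin_induction with
    | mem y hy =>
      obtain ⟨v, rfl⟩ := hy
      rw [← alg.matDeriv_Ad]
      exact Algebra.subset_adjoin ⟨_, rfl⟩
    | algebraMap c =>
      rw [← Algebra.commutes, mul_assoc, hri, mul_one]
      exact A.algebraMap_mem c
    | add a b _ _ ha hb => rw [mul_add, add_mul]; exact A.add_mem ha hb
    | mul a b _ _ ha hb =>
      have : r g * (a * b) * r g⁻¹ = (r g * a * r g⁻¹) * (r g * b * r g⁻¹) := by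
        calc _ = r g * a * 1 * b * r g⁻¹ := by noncomm_ring
          _ = _ := by rw [← hri' g]; noncomm_ring
      rw [this]
      exact A.mul_mem ha hb
  set e := matrixEquivCLM alg.n
  set N := repDeriv alg.rep x with hN
  have heN : N = e (alg.matDeriv x) := (e.apply_symm_apply _).symm
  have hexp : ∀ᶠ t : ℝ in nhds 0, NormedSpace.exp (t • N) = 1 := by
    filter_upwards [eventually_rep_eq_exp alg.contMDiff_rep x] with t ⟨g, hg⟩
    have htN : (t : ℂ) • alg.matDeriv x ∈ traceRadical A := (traceRadical A).smul_mem (t : ℂ) hx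
    have hmem := exp_sub_one_mem_of_pow_mem (x := t • N) ((traceRadical A).map e.toLinearMap)
      (Submodule.closed_of_finiteDimensional _)
      (fun k => ⟨_, pow_succ_mem_traceRadical htN k, by
        rw [AlgEquiv.toLinearMap_apply, map_pow, map_smul, ← heN]; rfl⟩)
    rw [← hg] at hmem
    obtain ⟨u, hu, hu'⟩ := hmem
    have hu2 : u = r g - 1 := by
      apply e.injective
      rw [map_sub, map_one]
      exact hu'
    rw [hu2] at hu
    have := alg.eq_one_of_sub_one_mem_traceRadical reductive A hA hu
    rw [← hg, this, map_one]
  have h1 : HasDerivAt (fun t : ℝ => NormedSpace.exp (t • N)) N 0 := by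
    simpa using hasDerivAt_exp_smul_const (𝕂 := ℝ) N (0 : ℝ)
  have h2 : HasDerivAt (fun t : ℝ => NormedSpace.exp (t • N)) 0 0 :=
    (hasDerivAt_const (0 : ℝ) (1 : (Fin alg.n → ℂ) →L[ℂ] (Fin alg.n → ℂ))).congr_of_eventuallyEq
      hexp
  refine alg.repDeriv_injective ?_
  rw [map_zero]
  exact h1.unique h2

/-- The trace criterion is applied to the representation of the Lie algebra on `ℂⁿ`, with matrices
and endomorphisms identified. -/
theorem LinearAlgebraicStructure.hasCentralRadical (reductive : alg.IsReductive) :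
    LieAlgebra.HasCentralRadical ℂ (GroupLieAlgebra 𝓘(ℂ, EG) G) := by
  let φ : GroupLieAlgebra 𝓘(ℂ, EG) G →ₗ[ℂ] Module.End ℂ (Fin alg.n → ℂ) :=
    (Matrix.toLinAlgEquiv' : Matrix (Fin alg.n) (Fin alg.n) ℂ ≃ₐ[ℂ] _).toLinearMap ∘ₗ alg.matDeriv
  have hφ : ∀ x y : GroupLieAlgebra 𝓘(ℂ, EG) G, φ ⁅x, y⁆ = φ x * φ y - φ y * φ x := fun x y => by
    change Matrix.toLinAlgEquiv' (alg.matDeriv ⁅x, y⁆) = _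
    rw [alg.matDeriv_lie, map_sub, map_mul, map_mul]
    rfl
  let : LieRingModule (GroupLieAlgebra 𝓘(ℂ, EG) G) (Fin alg.n → ℂ) :=
    { bracket := fun x m => φ x m
      add_lie := fun x y m => by rw [map_add, LinearMap.add_apply]
      lie_add := fun x => map_add (φ x)
      leibniz_lie := fun x y m => by
        rw [hφ, LinearMap.sub_apply, Module.End.mul_apply, Module.End.mul_apply, sub_add_cancel] }
  have : LieModule ℂ (GroupLieAlgebra 𝓘(ℂ, EG) G) (Fin alg.n → ℂ) :=
    { smul_lie := fun c x m => congrArg (fun f : Module.End ℂ (Fin alg.n → ℂ) => f m) (map_smul φ c x)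
      lie_smul := fun c x => map_smul (φ x) c }
  have : FiniteDimensional ℂ (GroupLieAlgebra 𝓘(ℂ, EG) G) := inferInstanceAs (FiniteDimensional ℂ EG)
  refine LieAlgebra.hasCentralRadical_of_trace (V := Fin alg.n → ℂ) fun x hx =>
    alg.eq_zero_of_matDeriv_mem_traceRadical reductive
      ⟨Algebra.subset_adjoin ⟨x, rfl⟩, fun b hb => ?_⟩
  have hb' : Matrix.toLinAlgEquiv' b ∈ Algebra.adjoin ℂ
      (Set.range (LieModule.toEnd ℂ (GroupLieAlgebra 𝓘(ℂ, EG) G) (Fin alg.n → ℂ))) := by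
    have h1 : Matrix.toLinAlgEquiv' b ∈ (Algebra.adjoin ℂ
        (Set.range (alg.matDeriv (EG := EG)))).map
          (Matrix.toLinAlgEquiv' : Matrix (Fin alg.n) (Fin alg.n) ℂ ≃ₐ[ℂ] _).toAlgHom :=
      ⟨b, hb, rfl⟩
    rw [AlgHom.map_adjoin, ← Set.range_comp] at h1
    exact h1
  have h := hx _ hb'
  rw [← Matrix.trace_toLin'_eq]
  refine Eq.trans ?_ h
  congr 1
  exact map_mul Matrix.toLinAlgEquiv' _ _

end Reductive

/-! ### Local trivializations, and sections of the adjoint bundle as equivariant functions -/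

namespace HolomorphicPrincipalBundle

variable {EX : Type*} [NormedAddCommGroup EX] [NormedSpace ℂ EX]
  {X : Type*} [TopologicalSpace X] [ChartedSpace EX X]
  {EG : Type*} [NormedAddCommGroup EG] [NormedSpace ℂ EG]
  {G : Type*} [TopologicalSpace G] [ChartedSpace EG G] [Group G]
  {EP : Type*} [NormedAddCommGroup EP] [NormedSpace ℂ EP]
  {P : Type*} [TopologicalSpace P] [ChartedSpace EP P]
  (B : HolomorphicPrincipalBundle EX X EG G EP P)

/-- A holomorphic trivialization of a principal bundle over an open set: the `G`-component of the
trivialization, and a section over the open set. -/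
structure LocalTriv where
  U : Set X
  isOpen : IsOpen U
  γ : P → G
  σ : X → P
  contMDiffOn_γ : ContMDiffOn 𝓘(ℂ, EP) 𝓘(ℂ, EG) ω γ (B.proj ⁻¹' U)
  contMDiffOn_σ : ContMDiffOn 𝓘(ℂ, EX) 𝓘(ℂ, EP) ω σ U
  γ_act : ∀ p, B.proj p ∈ U → ∀ g, γ (B.act p g) = γ p * g
  proj_σ : ∀ x ∈ U, B.proj (σ x) = x

theorem exists_localTriv (x : X) : ∃ T : B.LocalTriv, x ∈ T.U := by
  obtain ⟨Φ, U, hx, hU, hs, ht, hΦ, hΦ', hp, he⟩ := B.locally_trivial x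
  refine ⟨⟨U, hU, fun p => (Φ.symm p).2, fun x => Φ (x, 1), ?_, ?_, ?_, fun y hy => hp y hy 1⟩, hx⟩
  · rw [← ht]
    exact contMDiff_snd.comp_contMDiffOn hΦ'
  · exact hΦ.comp (contMDiffOn_id.prodMk contMDiffOn_const)
      (fun y hy => by rw [hs]; exact ⟨hy, Set.mem_univ _⟩)
  · intro p hpU g
    have hpt : p ∈ Φ.target := by rw [ht]; exact hpU
    have h1 := Φ.map_target hpt
    rw [hs] at h1
    have h2 := he _ h1.1 (Φ.symm p).2 g
    rw [Prod.mk.eta, Φ.right_inv hpt] at h2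
    rw [← h2, Φ.left_inv (by rw [hs]; exact ⟨h1.1, Set.mem_univ _⟩)]

theorem continuous_proj : Continuous B.proj := B.holomorphic_proj.continuous

variable {B} in
/-- A function constant on the fibres over `T.U` factors through the section. -/
theorem LocalTriv.apply_σ (T : B.LocalTriv) {α : Type*} {f : P → α}
    (hf : ∀ p, B.proj p ∈ T.U → ∀ g, f (B.act p g) = f p) {p : P} (hp : B.proj p ∈ T.U) :
    f (T.σ (B.proj p)) = f p := by
  obtain ⟨g, hg⟩ := B.exists_eq_act (p := p) (q := T.σ (B.proj p)) (T.proj_σ _ hp).symm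
  rw [hg, hf p hp]

section Adjoint

variable [LieGroup 𝓘(ℂ, EG) ω G]

theorem Ad_inv_Ad (g : G) (v : GroupLieAlgebra 𝓘(ℂ, EG) G) : Ad g⁻¹ (Ad g v) = v := by
  rw [← LinearMap.comp_apply, ← Ad_mul, inv_mul_cancel, Ad_one]; rfl

variable [FiniteDimensional ℂ EG]

theorem frame_symm_act {x : X} (p q : B.Fiber x) (g : G) (h : q.1 = B.act p.1 g)
    (e : B.AdFiber x) : (B.frame q).symm e = Ad g⁻¹ ((B.frame p).symm e) := by
  have h1 : B.frame p ((B.frame p).symm e) = B.frame q (Ad g⁻¹ ((B.frame p).symm e)) :=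
    B.adMk_eq p q g h _
  have h0 : e = B.frame p ((B.frame p).symm e) := ((B.frame p).apply_symm_apply e).symm
  exact (congrArg (B.frame q).symm (h0.trans h1)).trans ((B.frame q).symm_apply_apply _)

theorem sectionFun_eq (s : ∀ x, B.AdFiber x) {x : X} (p : B.Fiber x) :
    B.sectionFun s p.1 = (B.frame p).symm (s x) := by
  obtain ⟨p, rfl⟩ := p
  rfl

theorem sectionFun_act (s : ∀ x, B.AdFiber x) (p : P) (g : G) :
    B.sectionFun s (B.act p g) = Ad g⁻¹ (B.sectionFun s p) := by
  rw [B.sectionFun_eq s ⟨B.act p g, B.proj_act p g⟩]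
  exact B.frame_symm_act ⟨p, rfl⟩ _ g rfl _

theorem eq_of_sectionFun_eq {s t : ∀ x, B.AdFiber x}
    (h : ∀ p, B.sectionFun s p = B.sectionFun t p) : s = t := by
  ext x
  obtain ⟨p⟩ := B.fiber_nonempty x
  have := h p.1
  rw [B.sectionFun_eq, B.sectionFun_eq] at this
  exact (B.frame p).symm.injective this

theorem sectionFun_add (s t : ∀ x, B.AdFiber x) (p : P) :
    B.sectionFun (fun x => s x + t x) p = B.sectionFun s p + B.sectionFun t p :=
  map_add (B.frame ⟨p, rfl⟩).symm _ _

theorem sectionFun_smul (f : X → ℂ) (s : ∀ x, B.AdFiber x) (p : P) :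
    B.sectionFun (fun x => f x • s x) p = f (B.proj p) • B.sectionFun s p :=
  map_smul (B.frame ⟨p, rfl⟩).symm _ _

theorem sectionFun_lie (s t : ∀ x, B.AdFiber x) (p : P) :
    B.sectionFun (fun x => ⁅s x, t x⁆) p = ⁅B.sectionFun s p, B.sectionFun t p⁆ :=
  LieEquiv.map_lie (B.frame ⟨p, rfl⟩).symm _ _

theorem pullbackForm_eq (η : ∀ x, TangentSpace 𝓘(ℝ, EX) x →ₗ[ℝ] B.AdFiber x) {x : X}
    (p : B.Fiber x) (w : TangentSpace 𝓘(ℝ, EP) p.1) :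
    B.pullbackForm η p.1 w = (B.frame p).symm (η x (B.dproj p.1 w : EX)) := by
  obtain ⟨p, rfl⟩ := p
  rfl

/-- The section of the adjoint bundle with a given equivariant function. -/
def ofFun (f : P → GroupLieAlgebra 𝓘(ℂ, EG) G) (x : X) : B.AdFiber x :=
  B.frame (Classical.choice (B.fiber_nonempty x)) (f (Classical.choice (B.fiber_nonempty x)).1)

/-- `ofFun` uses an arbitrary point of each fibre; equivariance makes the result independent of that
point. -/
theorem sectionFun_ofFun {f : P → GroupLieAlgebra 𝓘(ℂ, EG) G}
    (hf : ∀ p g, f (B.act p g) = Ad g⁻¹ (f p)) (p : P) : B.sectionFun (B.ofFun f) p = f p := by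
  set q := Classical.choice (B.fiber_nonempty (B.proj p)) with hq
  obtain ⟨g, hg⟩ := B.exists_eq_act (p := q.1) (q := p) q.2
  have h1 := B.frame_symm_act q ⟨p, rfl⟩ g hg (B.ofFun f (B.proj p))
  refine h1.trans ?_
  have h2 : (B.frame q).symm (B.ofFun f (B.proj p)) = f q.1 := LieEquiv.symm_apply_apply _ _
  rw [h2, ← hf, ← hg]

end Adjoint

end HolomorphicPrincipalBundle

/-! ### Reading `𝔤` inside a normed algebra, where `Ad` is conjugation and the bracket a commutator
-/

/-- A holomorphic representation of a complex Lie group in a normed algebra whose differential is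
injective. -/
structure InfFaithfulRep (EG : Type*) [NormedAddCommGroup EG] [NormedSpace ℂ EG]
    (G : Type*) [TopologicalSpace G] [ChartedSpace EG G] [Group G]
    (𝒜 : Type*) [NormedRing 𝒜] [NormedAlgebra ℂ 𝒜] where
  R : G →* 𝒜
  contMDiff : ContMDiff 𝓘(ℂ, EG) 𝓘(ℂ, 𝒜) ω (fun g => R g)
  injective : Function.Injective (repDeriv (EG := EG) R)

namespace InfFaithfulRep

variable {EG : Type*} [NormedAddCommGroup EG] [NormedSpace ℂ EG]
  {G : Type*} [TopologicalSpace G] [ChartedSpace EG G] [Group G]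
  {𝒜 : Type*} [NormedRing 𝒜] [NormedAlgebra ℂ 𝒜] (ρ : InfFaithfulRep EG G 𝒜)

/-- The differential of the representation. -/
def φ : EG →L[ℂ] 𝒜 := mvfderiv 𝓘(ℂ, EG) (fun g => ρ.R g) 1

theorem φ_injective : Function.Injective ρ.φ := ρ.injective

theorem R_mul_inv (g : G) : ρ.R g * ρ.R g⁻¹ = 1 := by rw [← map_mul, mul_inv_cancel, map_one]

theorem R_inv_mul (g : G) : ρ.R g⁻¹ * ρ.R g = 1 := by rw [← map_mul, inv_mul_cancel, map_one]

theorem exists_leftInverse [FiniteDimensional ℂ 𝒜] : ∃ l : 𝒜 →L[ℂ] EG, ∀ v, l (ρ.φ v) = v := by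
  obtain ⟨l, hl⟩ := LinearMap.exists_leftInverse_of_injective ρ.φ.toLinearMap
    (LinearMap.ker_eq_bot.2 ρ.φ_injective)
  exact ⟨LinearMap.toContinuousLinearMap l, fun v => LinearMap.congr_fun hl v⟩

/-- A left inverse of the differential of the representation. -/
def l [FiniteDimensional ℂ 𝒜] : 𝒜 →L[ℂ] EG := ρ.exists_leftInverse.choose

theorem l_φ [FiniteDimensional ℂ 𝒜] (v : EG) : ρ.l (ρ.φ v) = v := ρ.exists_leftInverse.choose_spec v

variable [LieGroup 𝓘(ℂ, EG) ω G]

variable [FiniteDimensional ℂ EG]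

theorem φ_Ad (g : G) (v : GroupLieAlgebra 𝓘(ℂ, EG) G) :
    ρ.φ (Ad g v) = ρ.R g * ρ.φ v * ρ.R g⁻¹ := repDeriv_Ad ρ.contMDiff g v

theorem φ_lie (v w : GroupLieAlgebra 𝓘(ℂ, EG) G) :
    ρ.φ (⁅v, w⁆ : GroupLieAlgebra 𝓘(ℂ, EG) G) = ρ.φ v * ρ.φ w - ρ.φ w * ρ.φ v := repDeriv_lie ρ.contMDiff v w

variable {EP : Type*} [NormedAddCommGroup EP] [NormedSpace ℂ EP]
  {P : Type*} [TopologicalSpace P] [ChartedSpace EP P]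

theorem contMDiff_φ {f : P → EG} (hf : ContMDiff 𝓘(ℝ, EP) 𝓘(ℝ, EG) ∞ f) :
    ContMDiff 𝓘(ℝ, EP) 𝓘(ℝ, 𝒜) ∞ (fun p => ρ.φ (f p)) :=
  (ρ.φ.restrictScalars ℝ).contMDiff.comp hf

/-- The injective map `φ` has a continuous linear left inverse, so smoothness may be tested in `𝒜`.
There the adjoint action is multiplication by `R g` and `R g⁻¹`, which are visibly smooth in `g`. -/
theorem contMDiff_of_φ [FiniteDimensional ℂ 𝒜] {f : P → EG}
    (hf : ContMDiff 𝓘(ℝ, EP) 𝓘(ℝ, 𝒜) ∞ (fun p => ρ.φ (f p))) :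
    ContMDiff 𝓘(ℝ, EP) 𝓘(ℝ, EG) ∞ f := by
  have h := (ρ.l.restrictScalars ℝ).contMDiff (n := ∞).comp hf
  have e : (⇑(ρ.l.restrictScalars ℝ) ∘ fun p => ρ.φ (f p)) = f := funext fun p => ρ.l_φ _
  rwa [e] at h

end InfFaithfulRep

namespace HolomorphicPrincipalBundle

variable {EX : Type*} [NormedAddCommGroup EX] [NormedSpace ℂ EX]
  {X : Type*} [TopologicalSpace X] [ChartedSpace EX X]
  {EG : Type*} [NormedAddCommGroup EG] [NormedSpace ℂ EG] [FiniteDimensional ℂ EG]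
  {G : Type*} [TopologicalSpace G] [ChartedSpace EG G] [Group G] [LieGroup 𝓘(ℂ, EG) ω G]
  {EP : Type*} [NormedAddCommGroup EP] [NormedSpace ℂ EP]
  {P : Type*} [TopologicalSpace P] [ChartedSpace EP P]
  {B : HolomorphicPrincipalBundle EX X EG G EP P}
  {𝒜 : Type*} [NormedRing 𝒜] [NormedAlgebra ℂ 𝒜] (ρ : InfFaithfulRep EG G 𝒜)

section RepFun

/-- The function of a section of the adjoint bundle, with values in the algebra of a
representation. -/
def repFun (s : ∀ x, B.AdFiber x) (p : P) : 𝒜 := ρ.φ (B.sectionFun s p)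

variable {s : ∀ x, B.AdFiber x}

theorem contMDiff_repFun (hs : B.IsSmoothSection s) :
    ContMDiff 𝓘(ℝ, EP) 𝓘(ℝ, 𝒜) ∞ (repFun ρ s) := ρ.contMDiff_φ hs

theorem isSmoothSection_of_repFun [FiniteDimensional ℂ 𝒜]
    (hs : ContMDiff 𝓘(ℝ, EP) 𝓘(ℝ, 𝒜) ∞ (repFun ρ s)) : B.IsSmoothSection s := ρ.contMDiff_of_φ hs

theorem φ_dSectionFun (hs : B.IsSmoothSection s) (p : P) (w : TangentSpace 𝓘(ℝ, EP) p) :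
    ρ.φ (B.dSectionFun s p w) = mvfderiv 𝓘(ℝ, EP) (repFun ρ s) p w :=
  (mvfderiv_clm_comp (ρ.φ.restrictScalars ℝ)
    (hs.mdifferentiable (by simp) p) w).symm

theorem repFun_act (s : ∀ x, B.AdFiber x) (p : P) (g : G) :
    repFun ρ s (B.act p g) = ρ.R g⁻¹ * repFun ρ s p * ρ.R g := by
  have h := ρ.φ_Ad g⁻¹ (B.sectionFun s p)
  rw [inv_inv] at h
  refine Eq.trans ?_ h
  exact congrArg (fun v : EG => ρ.φ v) (B.sectionFun_act s p g)

end RepFun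

namespace LocalTriv

variable (T : B.LocalTriv)

/-- The representation of the group component of a trivialization. -/
def r (p : P) : 𝒜 := ρ.R (T.γ p)

/-- The inverse of `LocalTriv.r`. -/
def r' (p : P) : 𝒜 := ρ.R (T.γ p)⁻¹

theorem r'_mul_r (p : P) : T.r' ρ p * T.r ρ p = 1 := ρ.R_inv_mul _

variable {T} {p : P}

theorem isOpen_preimage : IsOpen (B.proj ⁻¹' T.U) := T.isOpen.preimage B.continuous_proj

theorem r_act (hp : B.proj p ∈ T.U) (g : G) : T.r ρ (B.act p g) = T.r ρ p * ρ.R g := by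
  rw [r, r, T.γ_act p hp, map_mul]

theorem r'_act (hp : B.proj p ∈ T.U) (g : G) : T.r' ρ (B.act p g) = ρ.R g⁻¹ * T.r' ρ p := by
  rw [r', r', T.γ_act p hp, mul_inv_rev, map_mul]

theorem contMDiffAt_γ (hp : B.proj p ∈ T.U) : ContMDiffAt 𝓘(ℂ, EP) 𝓘(ℂ, EG) ω T.γ p :=
  T.contMDiffOn_γ.contMDiffAt (isOpen_preimage.mem_nhds hp)

theorem contMDiffAt_r (hp : B.proj p ∈ T.U) : ContMDiffAt 𝓘(ℂ, EP) 𝓘(ℂ, 𝒜) ω (T.r ρ) p :=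
  ContMDiffAt.comp p (ρ.contMDiff _) (contMDiffAt_γ hp)

theorem contMDiffAt_r' (hp : B.proj p ∈ T.U) : ContMDiffAt 𝓘(ℂ, EP) 𝓘(ℂ, 𝒜) ω (T.r' ρ) p :=
  ContMDiffAt.comp (g := fun g => ρ.R g⁻¹) p ((ρ.contMDiff.comp (contMDiff_inv 𝓘(ℂ, EG) ω)) _)
    (contMDiffAt_γ hp)

theorem contMDiffAt_r_real (hp : B.proj p ∈ T.U) :
    ContMDiffAt 𝓘(ℝ, EP) 𝓘(ℝ, 𝒜) ∞ (T.r ρ) p := (contMDiffAt_r ρ hp).restrictScalars.of_le (by simp)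

theorem contMDiffAt_r'_real (hp : B.proj p ∈ T.U) :
    ContMDiffAt 𝓘(ℝ, EP) 𝓘(ℝ, 𝒜) ∞ (T.r' ρ) p := (contMDiffAt_r' ρ hp).restrictScalars.of_le (by simp)

/-- The coordinate in the trivialization of a section, with values in the algebra. -/
def coordFun (T : B.LocalTriv) (s : ∀ x, B.AdFiber x) (p : P) : 𝒜 :=
  T.r ρ p * repFun ρ s p * T.r' ρ p

theorem coordFun_eq (T : B.LocalTriv) (s : ∀ x, B.AdFiber x) (p : P) :
    T.coordFun ρ s p = ρ.φ (Ad (T.γ p) (B.sectionFun s p)) := (ρ.φ_Ad _ _).symm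

/-- Conjugation by `r` cancels the equivariance of the section, so the coordinate is constant on
fibres and descends to the base. -/
theorem coordFun_act (s : ∀ x, B.AdFiber x) (hp : B.proj p ∈ T.U) (g : G) :
    T.coordFun ρ s (B.act p g) = T.coordFun ρ s p := by
  rw [coordFun, r_act ρ hp, r'_act ρ hp, repFun_act]
  calc _ = T.r ρ p * (ρ.R g * ρ.R g⁻¹) * repFun ρ s p * (ρ.R g * ρ.R g⁻¹) * T.r' ρ p := by
        noncomm_ring
    _ = _ := by rw [ρ.R_mul_inv, mul_one, mul_one, coordFun]

/-- The logarithmic derivative `r⁻¹ dr` takes values in the Lie algebra. -/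
theorem exists_r'_mul_mvfderiv_r (hp : B.proj p ∈ T.U) (w : TangentSpace 𝓘(ℝ, EP) p) :
    ∃ m : GroupLieAlgebra 𝓘(ℂ, EG) G, T.r' ρ p * mvfderiv 𝓘(ℝ, EP) (T.r ρ) p w = ρ.φ m := by
  have hd := (contMDiffAt_r ρ hp).mdifferentiableAt (by simp)
  have h1 := mvfderiv_comp_mfderiv (ρ.contMDiff.mdifferentiable (by simp) (T.γ p))
    ((contMDiffAt_γ hp).mdifferentiableAt (by simp)) rfl w
  obtain ⟨m, hm⟩ := mvfderiv_rep_eq ρ.contMDiff (T.γ p)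
    (mfderiv 𝓘(ℂ, EP) 𝓘(ℂ, EG) T.γ p w : EG)
  refine ⟨m, ?_⟩
  have h2 : (mvfderiv 𝓘(ℝ, EP) (T.r ρ) p : EP →L[ℝ] 𝒜) w =
      (mvfderiv 𝓘(ℂ, EP) (T.r ρ) p : EP →L[ℂ] 𝒜) w :=
    congrArg (fun L : EP →L[ℝ] 𝒜 => L w) hd.mfderiv_real
  refine (congrArg (T.r' ρ p * ·) (h2.trans (h1.trans hm))).trans ?_
  change T.r' ρ p * (T.r ρ p * _) = _
  rw [← mul_assoc, r'_mul_r, one_mul]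
  rfl

/-- Comparison of the differential of a section and of its coordinate. -/
theorem mvfderiv_coordFun {s : ∀ x, B.AdFiber x} (hs : B.IsSmoothSection s)
    (hp : B.proj p ∈ T.U) (w : TangentSpace 𝓘(ℝ, EP) p) :
    T.r' ρ p * mvfderiv 𝓘(ℝ, EP) (T.coordFun ρ s) p w * T.r ρ p =
      mvfderiv 𝓘(ℝ, EP) (repFun ρ s) p w +
        (T.r' ρ p * mvfderiv 𝓘(ℝ, EP) (T.r ρ) p w * repFun ρ s p -
          repFun ρ s p * (T.r' ρ p * mvfderiv 𝓘(ℝ, EP) (T.r ρ) p w)) := by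
  have dr := (contMDiffAt_r_real ρ hp).mdifferentiableAt (by simp)
  have dr' := (contMDiffAt_r'_real ρ hp).mdifferentiableAt (by simp)
  have df : MDifferentiableAt 𝓘(ℝ, EP) 𝓘(ℝ, 𝒜) (repFun ρ s) p :=
    (contMDiff_repFun ρ hs).mdifferentiable (by simp) p
  have dh : MDifferentiableAt 𝓘(ℝ, EP) 𝓘(ℝ, 𝒜) (T.coordFun ρ s) p := (dr.mul df).mul dr'
  -- Differentiating the identity `h r = r f` avoids the derivative of `r⁻¹`.
  have e : (fun q => T.coordFun ρ s q * T.r ρ q) = fun q => T.r ρ q * repFun ρ s q := by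
    ext q
    rw [coordFun, mul_assoc, r'_mul_r, mul_one]
  have h1 := mvfderiv_mul_algebra dh dr w
  have h2 := mvfderiv_mul_algebra dr df w
  rw [e, h2] at h1
  have h3 := congrArg (T.r' ρ p * ·) h1
  simp only [mul_add, ← mul_assoc, r'_mul_r, one_mul] at h3
  rw [← eq_sub_iff_add_eq'] at h3
  rw [h3, coordFun]
  simp only [← mul_assoc, r'_mul_r, one_mul]
  abel

end LocalTriv

end HolomorphicPrincipalBundle

theorem ContMDiffAt.complex_smul {E : Type*} [NormedAddCommGroup E] [NormedSpace ℝ E] {H : Type*}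
    [TopologicalSpace H] {I : ModelWithCorners ℝ E H} {M : Type*} [TopologicalSpace M]
    [ChartedSpace H M] {F : Type*} [NormedAddCommGroup F] [NormedSpace ℂ F] {n : ℕ∞ω} {f : M → ℂ}
    {g : M → F} {x : M} (hf : ContMDiffAt I 𝓘(ℝ, ℂ) n f x) (hg : ContMDiffAt I 𝓘(ℝ, F) n g x) :
    ContMDiffAt I 𝓘(ℝ, F) n (fun x => f x • g x) x :=
  ((isBoundedBilinearMap_smul (𝕜 := ℝ) (A := ℂ) (E := F)).contDiff.contDiffAt.contMDiffAt).comp x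
    (hf.prodMk_space hg)

theorem ContMDiff.complex_smul {E : Type*} [NormedAddCommGroup E] [NormedSpace ℝ E] {H : Type*}
    [TopologicalSpace H] {I : ModelWithCorners ℝ E H} {M : Type*} [TopologicalSpace M]
    [ChartedSpace H M] {F : Type*} [NormedAddCommGroup F] [NormedSpace ℂ F] {n : ℕ∞ω} {f : M → ℂ}
    {g : M → F} (hf : ContMDiff I 𝓘(ℝ, ℂ) n f) (hg : ContMDiff I 𝓘(ℝ, F) n g) :
    ContMDiff I 𝓘(ℝ, F) n (fun x => f x • g x) :=
  fun x => (hf x).complex_smul (hg x)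

theorem ContMDiffAt.algebra_mul {E : Type*} [NormedAddCommGroup E] [NormedSpace ℝ E] {H : Type*}
    [TopologicalSpace H] {I : ModelWithCorners ℝ E H} {M : Type*} [TopologicalSpace M]
    [ChartedSpace H M] {𝒜 : Type*} [NormedRing 𝒜] [NormedAlgebra ℂ 𝒜] {n : ℕ∞ω} {f g : M → 𝒜}
    {x : M} (hf : ContMDiffAt I 𝓘(ℝ, 𝒜) n f x) (hg : ContMDiffAt I 𝓘(ℝ, 𝒜) n g x) :
    ContMDiffAt I 𝓘(ℝ, 𝒜) n (fun x => f x * g x) x :=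
  (((contDiff_mul (𝕜 := ℂ) (𝔸 := 𝒜)).restrict_scalars ℝ).contDiffAt.contMDiffAt).comp x
    (hf.prodMk_space hg)

/-! ### Smooth sections, and the connection pulled back to `E_G` -/

namespace HolomorphicPrincipalBundle

variable {EX : Type*} [NormedAddCommGroup EX] [NormedSpace ℂ EX]
  {X : Type*} [TopologicalSpace X] [ChartedSpace EX X]
  {EG : Type*} [NormedAddCommGroup EG] [NormedSpace ℂ EG] [FiniteDimensional ℂ EG]
  {G : Type*} [TopologicalSpace G] [ChartedSpace EG G] [Group G] [LieGroup 𝓘(ℂ, EG) ω G]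
  {EP : Type*} [NormedAddCommGroup EP] [NormedSpace ℂ EP]
  {P : Type*} [TopologicalSpace P] [ChartedSpace EP P]
  {B : HolomorphicPrincipalBundle EX X EG G EP P}

section SmoothSections

variable {s t : ∀ x, B.AdFiber x}

theorem isSmoothSection_of_eq {f : P → EG} (hf : ContMDiff 𝓘(ℝ, EP) 𝓘(ℝ, EG) ∞ f)
    (h : ∀ p, B.sectionFun s p = f p) : B.IsSmoothSection s := by
  have e : (fun p => (B.sectionFun s p : EG)) = f := funext h
  rw [IsSmoothSection, e]
  exact hf

theorem contMDiff_proj_real : ContMDiff 𝓘(ℝ, EP) 𝓘(ℝ, EX) ∞ B.proj :=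
  B.holomorphic_proj.restrictScalars.of_le (by simp)

theorem IsSmoothSection.add (hs : B.IsSmoothSection s) (ht : B.IsSmoothSection t) :
    B.IsSmoothSection (fun x => s x + t x) :=
  isSmoothSection_of_eq (ContMDiff.add hs ht) (B.sectionFun_add s t)

theorem IsSmoothSection.smul {f : X → ℂ} (hf : ContMDiff 𝓘(ℝ, EX) 𝓘(ℝ, ℂ) ∞ f)
    (hs : B.IsSmoothSection s) : B.IsSmoothSection (fun x => f x • s x) :=
  isSmoothSection_of_eq (ContMDiff.complex_smul (hf.comp contMDiff_proj_real) hs) (B.sectionFun_smul f s)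

theorem isSmoothSection_zero : B.IsSmoothSection (fun _ => 0) :=
  isSmoothSection_of_eq (f := fun _ => 0) contMDiff_const fun _ => map_zero (B.frame _).symm

theorem isSmoothSection_sum {ι : Type*} (S : Finset ι) {t : ι → ∀ x, B.AdFiber x}
    (ht : ∀ i, B.IsSmoothSection (t i)) : B.IsSmoothSection (fun x => ∑ i ∈ S, t i x) := by
  classical
  induction S using Finset.induction_on with
  | empty => simpa using isSmoothSection_zero
  | insert a S ha ih =>
    simp only [Finset.sum_insert ha]
    exact (ht a).add ih

theorem sectionFun_sum {ι : Type*} (S : Finset ι) (t : ι → ∀ x, B.AdFiber x) (p : P) :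
    B.sectionFun (fun x => ∑ i ∈ S, t i x) p = ∑ i ∈ S, B.sectionFun (t i) p :=
  map_sum (B.frame ⟨p, rfl⟩).symm _ _

end SmoothSections

namespace AdConnection

variable [IsManifold 𝓘(ℂ, EP) ω P] (D : B.AdConnection) {s t : ∀ x, B.AdFiber x}

theorem pullback_add (hs : B.IsSmoothSection s) (ht : B.IsSmoothSection t) (p : P)
    (w : TangentSpace 𝓘(ℝ, EP) p) :
    B.pullbackForm (D.toFun fun x => s x + t x) p w =
      B.pullbackForm (D.toFun s) p w + B.pullbackForm (D.toFun t) p w :=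
  (congrArg (B.frame ⟨p, rfl⟩).symm (D.add s t hs ht _ _)).trans (map_add _ _ _)

theorem pullback_smul {f : X → ℂ} (hf : ContMDiff 𝓘(ℝ, EX) 𝓘(ℝ, ℂ) ∞ f)
    (hs : B.IsSmoothSection s) (p : P) (w : TangentSpace 𝓘(ℝ, EP) p) :
    B.pullbackForm (D.toFun fun x => f x • s x) p w =
      (mvfderiv 𝓘(ℝ, EP) (fun q => f (B.proj q)) p w : ℂ) • B.sectionFun s p +
        f (B.proj p) • B.pullbackForm (D.toFun s) p w := by
  have h1 : mvfderiv 𝓘(ℝ, EP) (fun q => f (B.proj q)) p w =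
      mvfderiv 𝓘(ℝ, EX) f (B.proj p) (B.dproj p w) :=
    mvfderiv_comp_mfderiv (hf.mdifferentiable (by simp) _)
      (contMDiff_proj_real.mdifferentiable (by simp) p) rfl w
  rw [h1]
  refine (congrArg (B.frame ⟨p, rfl⟩).symm (D.leibniz f s hf hs _ _)).trans ?_
  refine (map_add _ _ _).trans ?_
  exact congrArg₂ (· + ·) (map_smul _ _ _) (map_smul _ _ _)

theorem pullback_zero (p : P) (w : TangentSpace 𝓘(ℝ, EP) p) :
    B.pullbackForm (D.toFun fun _ => 0) p w = 0 := by
  have h := D.pullback_add isSmoothSection_zero isSmoothSection_zero p w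
  have e : (fun x => (0 : B.AdFiber x) + 0) = fun _ => 0 := by ext; simp
  rw [e] at h
  exact left_eq_add.1 h

theorem pullback_sum {ι : Type*} (S : Finset ι) {t : ι → ∀ x, B.AdFiber x}
    (ht : ∀ i, B.IsSmoothSection (t i)) (p : P) (w : TangentSpace 𝓘(ℝ, EP) p) :
    B.pullbackForm (D.toFun fun x => ∑ i ∈ S, t i x) p w =
      ∑ i ∈ S, B.pullbackForm (D.toFun (t i)) p w := by
  classical
  induction S using Finset.induction_on with
  | empty => simpa using D.pullback_zero p w
  | insert a S ha ih =>
    simp only [Finset.sum_insert ha]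
    rw [D.pullback_add (ht a) (isSmoothSection_sum S ht), ih]

theorem pullback_lie (h : D.SatisfiesLieLeibniz) (hs : B.IsSmoothSection s)
    (ht : B.IsSmoothSection t) (p : P) (w : TangentSpace 𝓘(ℝ, EP) p) :
    B.pullbackForm (D.toFun fun x => ⁅s x, t x⁆) p w =
      ⁅B.pullbackForm (D.toFun s) p w, B.sectionFun t p⁆ +
        ⁅B.sectionFun s p, B.pullbackForm (D.toFun t) p w⁆ := by
  refine (congrArg (B.frame ⟨p, rfl⟩).symm (h s t hs ht _ _)).trans ?_
  refine (map_add _ _ _).trans ?_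
  exact congrArg₂ (· + ·) (LieEquiv.map_lie _ _ _) (LieEquiv.map_lie _ _ _)

/-- The projection is invariant under right translation, so the tangent vector on `X` is unchanged
and only the frame moves. -/
theorem pullback_act (η : ∀ x, TangentSpace 𝓘(ℝ, EX) x →ₗ[ℝ] B.AdFiber x) (p : P) (g : G)
    (w : TangentSpace 𝓘(ℝ, EP) p) :
    B.pullbackForm η (B.act p g) (mfderiv 𝓘(ℝ, EP) 𝓘(ℝ, EP) (fun q => B.act q g) p w) =
      Ad g⁻¹ (B.pullbackForm η p w) := by
  have ha : ContMDiff 𝓘(ℂ, EP) 𝓘(ℂ, EP) ω (fun q => B.act q g) :=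
    B.holomorphic_act.comp (contMDiff_id.prodMk contMDiff_const)
  have had : MDifferentiableAt 𝓘(ℝ, EP) 𝓘(ℝ, EP) (fun q => B.act q g) p :=
    ha.restrictScalars.mdifferentiable (by simp) p
  have h1 : (B.dproj (B.act p g) (mfderiv 𝓘(ℝ, EP) 𝓘(ℝ, EP) (fun q => B.act q g) p w) : EX) =
      (B.dproj p w : EX) := by
    have hpd : MDifferentiableAt 𝓘(ℝ, EP) 𝓘(ℝ, EX) B.proj (B.act p g) :=
      contMDiff_proj_real.mdifferentiable (by simp) _
    have h2 := mfderiv_comp_apply (I' := 𝓘(ℝ, EP)) p hpd had w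
    have e : B.proj ∘ (fun q => B.act q g) = B.proj := funext fun q => B.proj_act q g
    have h3 : (mfderiv 𝓘(ℝ, EP) 𝓘(ℝ, EX) (B.proj ∘ (fun q => B.act q g)) p : EP →L[ℝ] EX) w =
        (mfderiv 𝓘(ℝ, EP) 𝓘(ℝ, EX) B.proj p : EP →L[ℝ] EX) w := by rw [e]
    exact h2.symm.trans h3
  have h4 := B.pullbackForm_eq η ⟨B.act p g, B.proj_act p g⟩
    (mfderiv 𝓘(ℝ, EP) 𝓘(ℝ, EP) (fun q => B.act q g) p w)
  refine h4.trans ?_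
  refine (B.frame_symm_act ⟨p, rfl⟩ _ g rfl _).trans ?_
  exact congrArg (fun v : EX => Ad g⁻¹ ((B.frame ⟨p, rfl⟩).symm (η (B.proj p) v))) h1

end AdConnection

end HolomorphicPrincipalBundle

/-! ### Cutoffs, and the connection in a trivialization -/

namespace HolomorphicPrincipalBundle

variable {EX : Type*} [NormedAddCommGroup EX] [NormedSpace ℂ EX]
  {X : Type*} [TopologicalSpace X] [ChartedSpace EX X]
  {EG : Type*} [NormedAddCommGroup EG] [NormedSpace ℂ EG] [FiniteDimensional ℂ EG]
  {G : Type*} [TopologicalSpace G] [ChartedSpace EG G] [Group G] [LieGroup 𝓘(ℂ, EG) ω G]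
  {EP : Type*} [NormedAddCommGroup EP] [NormedSpace ℂ EP]
  {P : Type*} [TopologicalSpace P] [ChartedSpace EP P]

/-- A trivialization over an open set together with a cutoff function supported in this set and
equal to one on a smaller open set. -/
structure CutTriv (B : HolomorphicPrincipalBundle EX X EG G EP P) extends B.LocalTriv where
  χ : X → ℂ
  contMDiff_χ : ContMDiff 𝓘(ℝ, EX) 𝓘(ℝ, ℂ) ∞ χ
  tsupport_χ : tsupport χ ⊆ U
  V : Set X
  isOpen_V : IsOpen V
  χ_eq_one : ∀ x ∈ V, χ x = 1

variable {B : HolomorphicPrincipalBundle EX X EG G EP P}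

theorem exists_cutTriv [FiniteDimensional ℂ EX] [T2Space X] [IsManifold 𝓘(ℂ, EX) ω X] (x : X) :
    ∃ T : B.CutTriv, x ∈ T.V := by
  have : FiniteDimensional ℝ EX := FiniteDimensional.complexToReal EX
  have : IsManifold 𝓘(ℝ, EX) ∞ X := IsManifold.of_le (n := ω) (by simp)
  obtain ⟨T, hx⟩ := B.exists_localTriv x
  obtain ⟨f, -, hf⟩ := (SmoothBumpFunction.nhds_basis_tsupport (I := 𝓘(ℝ, EX)) x).mem_iff.1
    (T.isOpen.mem_nhds hx)
  obtain ⟨V, hV, hVo, hxV⟩ := eventually_nhds_iff.1 f.eventuallyEq_one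
  refine ⟨⟨T, fun y => (f y : ℂ), ?_, ?_, V, hVo, fun y hy => ?_⟩, hxV⟩
  · exact Complex.ofRealCLM.contMDiff.comp f.contMDiff
  · refine (closure_mono ?_).trans hf
    intro y hy hfy
    exact hy (by simp [hfy])
  · rw [hV y hy]; simp

namespace CutTriv

variable (T : B.CutTriv)

theorem mem_U {x : X} (hx : x ∈ T.V) : x ∈ T.U :=
  T.tsupport_χ (subset_tsupport _ (by rw [Function.mem_support, T.χ_eq_one x hx]; exact one_ne_zero))

/-- The function of the cutoff of a constant section in the trivialization. -/
def bumpFun (ξ : GroupLieAlgebra 𝓘(ℂ, EG) G) (p : P) : GroupLieAlgebra 𝓘(ℂ, EG) G :=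
  T.χ (B.proj p) • Ad (T.γ p)⁻¹ ξ

/-- The cutoff of a constant section in the trivialization. -/
def bump (ξ : GroupLieAlgebra 𝓘(ℂ, EG) G) : ∀ x, B.AdFiber x := B.ofFun (T.bumpFun ξ)

theorem χ_eq_zero {x : X} (hx : x ∉ T.U) : T.χ x = 0 :=
  image_eq_zero_of_notMem_tsupport fun h => hx (T.tsupport_χ h)

/-- Outside `U` the map `γ` need not be equivariant, but there `χ` vanishes. -/
theorem sectionFun_bump (ξ : GroupLieAlgebra 𝓘(ℂ, EG) G) (p : P) :
    B.sectionFun (T.bump ξ) p = T.χ (B.proj p) • Ad (T.γ p)⁻¹ ξ := by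
  refine B.sectionFun_ofFun (f := T.bumpFun ξ) (fun p g => ?_) p
  rw [bumpFun, bumpFun, B.proj_act, map_smul]
  by_cases hp : B.proj p ∈ T.U
  · rw [T.γ_act p hp, mul_inv_rev, Ad_mul, LinearMap.comp_apply]
  · rw [T.χ_eq_zero hp, zero_smul, zero_smul]

variable {𝒜 : Type*} [NormedRing 𝒜] [NormedAlgebra ℂ 𝒜] (ρ : InfFaithfulRep EG G 𝒜)

theorem repFun_bump (ξ : GroupLieAlgebra 𝓘(ℂ, EG) G) (p : P) :
    repFun ρ (T.bump ξ) p = T.χ (B.proj p) • (T.r' ρ p * ρ.φ ξ * T.r ρ p) := by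
  have h := ρ.φ_Ad (T.γ p)⁻¹ ξ
  rw [inv_inv] at h
  refine (congrArg (fun v : EG => ρ.φ v) (T.sectionFun_bump ξ p)).trans ?_
  exact (map_smul ρ.φ _ _).trans (congrArg (T.χ (B.proj p) • ·) h)

theorem contMDiff_χ_proj : ContMDiff 𝓘(ℝ, EP) 𝓘(ℝ, ℂ) ∞ (fun p => T.χ (B.proj p)) :=
  T.contMDiff_χ.comp contMDiff_proj_real

include ρ in
theorem isSmoothSection_bump [FiniteDimensional ℂ 𝒜] (ξ : GroupLieAlgebra 𝓘(ℂ, EG) G) :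
    B.IsSmoothSection (T.bump ξ) := by
  refine isSmoothSection_of_repFun ρ fun p => ?_
  have e : repFun ρ (T.bump ξ) = fun p => T.χ (B.proj p) • (T.r' ρ p * ρ.φ ξ * T.r ρ p) :=
    funext (T.repFun_bump ρ ξ)
  rw [e]
  by_cases hp : B.proj p ∈ T.U
  · refine (T.contMDiff_χ_proj p).complex_smul ?_
    exact ((LocalTriv.contMDiffAt_r'_real ρ hp).algebra_mul contMDiffAt_const).algebra_mul
      (LocalTriv.contMDiffAt_r_real ρ hp)
  · have hz : (fun p => T.χ (B.proj p) • (T.r' ρ p * ρ.φ ξ * T.r ρ p)) =ᶠ[nhds p] fun _ => 0 := by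
      have ho : IsOpen (B.proj ⁻¹' (tsupport T.χ)ᶜ) :=
        (isClosed_tsupport _).isOpen_compl.preimage B.continuous_proj
      filter_upwards [ho.mem_nhds fun h => hp (T.tsupport_χ h)] with q hq
      rw [image_eq_zero_of_notMem_tsupport hq, zero_smul]
    exact contMDiffAt_const.congr_of_eventuallyEq hz

theorem isOpen_preimage_V : IsOpen (B.proj ⁻¹' T.V) := T.isOpen_V.preimage B.continuous_proj

theorem sectionFun_bump_of_mem (ξ : GroupLieAlgebra 𝓘(ℂ, EG) G) {p : P} (hp : B.proj p ∈ T.V) :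
    B.sectionFun (T.bump ξ) p = Ad (T.γ p)⁻¹ ξ := by
  rw [sectionFun_bump, T.χ_eq_one _ hp, one_smul]

theorem Ad_sectionFun_bump (ξ : GroupLieAlgebra 𝓘(ℂ, EG) G) {p : P} (hp : B.proj p ∈ T.V) :
    Ad (T.γ p) (B.sectionFun (T.bump ξ) p) = ξ := by
  have h := Ad_inv_Ad (T.γ p)⁻¹ ξ
  rwa [inv_inv, ← T.sectionFun_bump_of_mem ξ hp] at h

end CutTriv

/-- A basis of the Lie algebra of the group. -/
def lieBasis (EG : Type*) [NormedAddCommGroup EG] [NormedSpace ℂ EG] [FiniteDimensional ℂ EG]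
    (G : Type*) [TopologicalSpace G] [ChartedSpace EG G] [Group G] :
    Module.Basis (Fin (Module.finrank ℂ EG)) ℂ (GroupLieAlgebra 𝓘(ℂ, EG) G) :=
  Module.finBasis ℂ EG

/-- The coordinates in `lieBasis` as continuous linear functionals. -/
def lieCoord (EG : Type*) [NormedAddCommGroup EG] [NormedSpace ℂ EG] [FiniteDimensional ℂ EG]
    (G : Type*) [TopologicalSpace G] [ChartedSpace EG G] [Group G]
    (i : Fin (Module.finrank ℂ EG)) : EG →L[ℂ] ℂ :=
  LinearMap.toContinuousLinearMap ((Module.finBasis ℂ EG).coord i)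

theorem sum_lieCoord (v : GroupLieAlgebra 𝓘(ℂ, EG) G) :
    ∑ i, lieCoord EG G i v • lieBasis EG G i = v :=
  (Module.finBasis ℂ EG).sum_repr v

namespace CutTriv

variable (T : B.CutTriv) {𝒜 : Type*} [NormedRing 𝒜] [NormedAlgebra ℂ 𝒜] [FiniteDimensional ℂ 𝒜]
  (ρ : InfFaithfulRep EG G 𝒜) {s : ∀ x, B.AdFiber x}

/-- The coefficients of a section, cut off, in the trivialization. -/
def coeff (s : ∀ x, B.AdFiber x) (i : Fin (Module.finrank ℂ EG)) (x : X) : ℂ :=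
  T.χ x • lieCoord EG G i (ρ.l (T.coordFun ρ s (T.σ x)))

theorem coeff_proj (s : ∀ x, B.AdFiber x) (i : Fin (Module.finrank ℂ EG)) (p : P) :
    T.coeff ρ s i (B.proj p) =
      T.χ (B.proj p) • lieCoord EG G i (ρ.l (T.coordFun ρ s p)) := by
  by_cases hp : B.proj p ∈ T.U
  · rw [coeff, T.apply_σ (fun q hq g => LocalTriv.coordFun_act ρ s hq g) hp]
  · rw [coeff, T.χ_eq_zero hp, zero_smul, zero_smul]

theorem contMDiffAt_coordFun (hs : B.IsSmoothSection s) {p : P} (hp : B.proj p ∈ T.U) :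
    ContMDiffAt 𝓘(ℝ, EP) 𝓘(ℝ, 𝒜) ∞ (T.coordFun ρ s) p :=
  ((LocalTriv.contMDiffAt_r_real ρ hp).algebra_mul (contMDiff_repFun ρ hs p)).algebra_mul
    (LocalTriv.contMDiffAt_r'_real ρ hp)

theorem contMDiff_coeff (hs : B.IsSmoothSection s) (i : Fin (Module.finrank ℂ EG)) :
    ContMDiff 𝓘(ℝ, EX) 𝓘(ℝ, ℂ) ∞ (T.coeff ρ s i) := by
  intro x
  by_cases hx : x ∈ T.U
  · refine (T.contMDiff_χ x).complex_smul ?_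
    have h1 : ContMDiffAt 𝓘(ℝ, EX) 𝓘(ℝ, EP) ∞ T.σ x :=
      (T.contMDiffOn_σ.contMDiffAt (T.isOpen.mem_nhds hx)).restrictScalars.of_le (by simp)
    have h2 : ContMDiffAt 𝓘(ℝ, EP) 𝓘(ℝ, 𝒜) ∞ (T.coordFun ρ s) (T.σ x) :=
      T.contMDiffAt_coordFun ρ hs (by rw [T.proj_σ x hx]; exact hx)
    exact ((lieCoord EG G i ∘L ρ.l).restrictScalars ℝ).contMDiff.contMDiffAt.comp x (h2.comp x h1)
  · have hz : T.coeff ρ s i =ᶠ[nhds x] fun _ => 0 := by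
      filter_upwards [(isClosed_tsupport T.χ).isOpen_compl.mem_nhds fun h => hx (T.tsupport_χ h)]
        with y hy
      rw [coeff, image_eq_zero_of_notMem_tsupport hy, zero_smul]
    exact contMDiffAt_const.congr_of_eventuallyEq hz

/-- The cutoff is squared because the coefficients and the bump sections each carry one factor `χ`;
both are thus defined and smooth on all of `X`. -/
theorem cutoff_eq_sum (s : ∀ x, B.AdFiber x) :
    (fun x => (T.χ x * T.χ x) • s x) =
      fun x => ∑ i, T.coeff ρ s i x • T.bump (lieBasis EG G i) x := by
  refine B.eq_of_sectionFun_eq fun p => ?_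
  rw [B.sectionFun_smul (fun x => T.χ x * T.χ x), sectionFun_sum]
  have h1 : ∀ i, B.sectionFun (fun x => T.coeff ρ s i x • T.bump (lieBasis EG G i) x) p =
      (T.χ (B.proj p) * T.χ (B.proj p)) • Ad (T.γ p)⁻¹
        (lieCoord EG G i (ρ.l (T.coordFun ρ s p)) • lieBasis EG G i) := by
    intro i
    rw [B.sectionFun_smul, T.sectionFun_bump, T.coeff_proj, map_smul, smul_smul, smul_smul]
    congr 1
    rw [smul_eq_mul]
    ring
  simp only [h1]
  rw [← Finset.smul_sum, ← map_sum]
  congr 1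
  have h2 : ρ.l (T.coordFun ρ s p) = Ad (T.γ p) (B.sectionFun s p) := by
    rw [T.coordFun_eq]
    exact ρ.l_φ _
  have h3 := sum_lieCoord (Ad (T.γ p) (B.sectionFun s p))
  rw [h2]
  exact ((congrArg (Ad (T.γ p)⁻¹) h3).trans (Ad_inv_Ad _ _)).symm

variable [IsManifold 𝓘(ℂ, EP) ω P] (D : B.AdConnection)

/-- The connection applied to the cutoffs of the constant sections. -/
def connMap (p : P) (w : TangentSpace 𝓘(ℝ, EP) p) :
    GroupLieAlgebra 𝓘(ℂ, EG) G →ₗ[ℂ] GroupLieAlgebra 𝓘(ℂ, EG) G :=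
  (lieBasis EG G).constr ℂ fun i => B.pullbackForm (D.toFun (T.bump (lieBasis EG G i))) p w

theorem connMap_apply (p : P) (w : TangentSpace 𝓘(ℝ, EP) p) (v : GroupLieAlgebra 𝓘(ℂ, EG) G) :
    T.connMap D p w v = ∑ i, lieCoord EG G i v •
      B.pullbackForm (D.toFun (T.bump (lieBasis EG G i))) p w :=
  (lieBasis EG G).constr_apply_fintype ℂ _ v

include ρ in
/-- The connection in a trivialization. -/
theorem φ_pullbackForm (hs : B.IsSmoothSection s) {p : P} (hp : B.proj p ∈ T.V)
    (w : TangentSpace 𝓘(ℝ, EP) p) :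
    ρ.φ (B.pullbackForm (D.toFun s) p w) =
      T.r' ρ p * ρ.φ (ρ.l (mvfderiv 𝓘(ℝ, EP) (T.coordFun ρ s) p w)) * T.r ρ p +
        ρ.φ (T.connMap D p w (Ad (T.γ p) (B.sectionFun s p))) := by
  have hpU := T.mem_U hp
  have hnear : ∀ᶠ q in nhds p, B.proj q ∈ T.V := T.isOpen_preimage_V.mem_nhds hp
  -- `D` acts only on global sections. As `χ²` is `1` near the base point, the Leibniz rule gives `D
  -- (χ² s) = D s` there, and `χ² s` is a combination of bump sections with smooth coefficients.
  have h1 := D.pullback_smul (T.contMDiff_χ.complex_smul T.contMDiff_χ) hs p w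
  have hc : mvfderiv 𝓘(ℝ, EP) (fun q => T.χ (B.proj q) • T.χ (B.proj q)) p w = 0 := by
    have e : (fun q => T.χ (B.proj q) • T.χ (B.proj q)) =ᶠ[nhds p] fun _ => (1 : ℂ) := by
      filter_upwards [hnear] with q hq
      rw [T.χ_eq_one _ hq, one_smul]
    rw [e.mvfderiv_eq, mvfderiv_const]
    rfl
  have h2 : B.pullbackForm (D.toFun fun x => (T.χ x * T.χ x) • s x) p w =
      B.pullbackForm (D.toFun s) p w := by
    refine h1.trans ?_
    rw [hc, zero_smul, zero_add, T.χ_eq_one _ hp, one_smul, one_smul]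
  rw [T.cutoff_eq_sum ρ s, D.pullback_sum _ fun i =>
    (T.isSmoothSection_bump ρ _).smul (T.contMDiff_coeff ρ hs i)] at h2
  have hcoord : T.coordFun ρ s p = ρ.φ (Ad (T.γ p) (B.sectionFun s p)) := T.coordFun_eq ρ s p
  have h3 : ∀ i, B.pullbackForm
      (D.toFun fun x => T.coeff ρ s i x • T.bump (lieBasis EG G i) x) p w =
      Ad (T.γ p)⁻¹ (lieCoord EG G i (ρ.l (mvfderiv 𝓘(ℝ, EP) (T.coordFun ρ s) p w)) •
        lieBasis EG G i) +
      lieCoord EG G i (Ad (T.γ p) (B.sectionFun s p)) •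
        B.pullbackForm (D.toFun (T.bump (lieBasis EG G i))) p w := by
    intro i
    rw [D.pullback_smul (T.contMDiff_coeff ρ hs i) (T.isSmoothSection_bump ρ _)]
    have e : (fun q => T.coeff ρ s i (B.proj q)) =ᶠ[nhds p]
        fun q => ((lieCoord EG G i ∘L ρ.l).restrictScalars ℝ) (T.coordFun ρ s q) := by
      filter_upwards [hnear] with q hq
      rw [T.coeff_proj, T.χ_eq_one _ hq, one_smul]
      rfl
    have e1 := mvfderiv_clm_comp ((lieCoord EG G i ∘L ρ.l).restrictScalars ℝ)
      ((T.contMDiffAt_coordFun ρ hs hpU).mdifferentiableAt (by simp)) w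
    have e2 : T.coeff ρ s i (B.proj p) = lieCoord EG G i (Ad (T.γ p) (B.sectionFun s p)) := by
      rw [T.coeff_proj, T.χ_eq_one _ hp, one_smul, hcoord]
      exact congrArg (lieCoord EG G i) (ρ.l_φ _)
    rw [e.mvfderiv_eq, e1, e2, T.sectionFun_bump_of_mem _ hp, map_smul]
    rfl
  simp only [h3] at h2
  rw [Finset.sum_add_distrib, ← map_sum, ← T.connMap_apply D p w] at h2
  have h4 := sum_lieCoord (G := G) (ρ.l (mvfderiv 𝓘(ℝ, EP) (T.coordFun ρ s) p w))
  have h5 := ρ.φ_Ad (T.γ p)⁻¹ (ρ.l (mvfderiv 𝓘(ℝ, EP) (T.coordFun ρ s) p w))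
  rw [inv_inv] at h5
  rw [← h2]
  refine (map_add ρ.φ _ _).trans ?_
  congr 1
  refine Eq.trans ?_ h5
  exact congrArg (fun v : GroupLieAlgebra 𝓘(ℂ, EG) G => ρ.φ (Ad (T.γ p)⁻¹ v)) h4

end CutTriv

end HolomorphicPrincipalBundle

/-! ### The connection endomorphism as a derivation, and a linear choice of the element inducing it
-/

/-- Split `f` over its range and extend the splitting to `W`. Applied to `ad`, this chooses an
element inducing an inner derivation linearly, hence smoothly in parameters. -/
theorem LinearMap.exists_comp_comp_eq {k V W : Type*} [Field k] [AddCommGroup V] [Module k V]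
    [AddCommGroup W] [Module k W] (f : V →ₗ[k] W) : ∃ g : W →ₗ[k] V, ∀ v, f (g (f v)) = f v := by
  obtain ⟨s, hs⟩ := f.rangeRestrict.exists_rightInverse_of_surjective f.range_rangeRestrict
  obtain ⟨g, hg⟩ := s.exists_extend
  refine ⟨g, fun v => ?_⟩
  have h1 : g (f v) = s (f.rangeRestrict v) := LinearMap.congr_fun hg (f.rangeRestrict v)
  rw [h1]
  exact congrArg Subtype.val (LinearMap.congr_fun hs (f.rangeRestrict v))

/-- In a reductive Lie algebra, the element inducing a derivation that vanishes on the centre can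
be chosen linearly. -/
theorem LieAlgebra.exists_linearMap_derivation {k L : Type*} [Field k] [CharZero k] [LieRing L]
    [LieAlgebra k L] [FiniteDimensional k L] [HasCentralRadical k L] :
    ∃ κ : (L →ₗ[k] L) →ₗ[k] L, ∀ δ : L →ₗ[k] L, (∀ x y : L, δ ⁅x, y⁆ = ⁅δ x, y⁆ + ⁅x, δ y⁆) →
      (∀ z ∈ center k L, δ z = 0) → ∀ x, δ x = ⁅κ δ, x⁆ := by
  obtain ⟨κ, hκ⟩ := (LieModule.toEnd k L L : L →ₗ[k] Module.End k L).exists_comp_comp_eq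
  refine ⟨κ, fun δ hδ hz x => ?_⟩
  obtain ⟨a, ha⟩ := exists_eq_lie_of_derivation δ hδ hz
  have e : δ = (LieModule.toEnd k L L : L →ₗ[k] Module.End k L) a := LinearMap.ext ha
  have h := LinearMap.congr_fun (hκ a) x
  rw [← e] at h
  exact h.symm

theorem MDifferentiableAt.mvfderiv_tangentJ {E F : Type*} [NormedAddCommGroup E] [NormedSpace ℂ E]
    [NormedAddCommGroup F] [NormedSpace ℂ F] {M : Type*} [TopologicalSpace M] [ChartedSpace E M]
    {f : M → F} {x : M} (hf : MDifferentiableAt 𝓘(ℂ, E) 𝓘(ℂ, F) f x)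
    (w : TangentSpace 𝓘(ℝ, E) x) :
    mvfderiv 𝓘(ℝ, E) f x (tangentJ x w) = Complex.I • mvfderiv 𝓘(ℝ, E) f x w :=
  hf.mfderiv_tangentJ w

namespace HolomorphicPrincipalBundle

variable {EX : Type*} [NormedAddCommGroup EX] [NormedSpace ℂ EX]
  {X : Type*} [TopologicalSpace X] [ChartedSpace EX X]
  {EG : Type*} [NormedAddCommGroup EG] [NormedSpace ℂ EG] [FiniteDimensional ℂ EG]
  {G : Type*} [TopologicalSpace G] [ChartedSpace EG G] [Group G] [LieGroup 𝓘(ℂ, EG) ω G]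
  {EP : Type*} [NormedAddCommGroup EP] [NormedSpace ℂ EP]
  {P : Type*} [TopologicalSpace P] [ChartedSpace EP P]
  {B : HolomorphicPrincipalBundle EX X EG G EP P}
  {𝒜 : Type*} [NormedRing 𝒜] [NormedAlgebra ℂ 𝒜] (ρ : InfFaithfulRep EG G 𝒜)

theorem repFun_lie (s t : ∀ x, B.AdFiber x) (p : P) :
    repFun ρ (fun x => ⁅s x, t x⁆) p =
      repFun ρ s p * repFun ρ t p - repFun ρ t p * repFun ρ s p :=
  (congrArg (fun v : EG => ρ.φ v) (B.sectionFun_lie s t p)).trans (ρ.φ_lie _ _)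

include ρ in
theorem IsSmoothSection.lie [FiniteDimensional ℂ 𝒜] {s t : ∀ x, B.AdFiber x}
    (hs : B.IsSmoothSection s) (ht : B.IsSmoothSection t) :
    B.IsSmoothSection (fun x => ⁅s x, t x⁆) := by
  refine isSmoothSection_of_repFun ρ ?_
  have e : repFun ρ (fun x => ⁅s x, t x⁆) =
      fun p => repFun ρ s p * repFun ρ t p - repFun ρ t p * repFun ρ s p :=
    funext (repFun_lie ρ s t)
  rw [e]
  have h1 := contMDiff_repFun ρ hs
  have h2 := contMDiff_repFun ρ ht
  exact fun p => ((h1 p).algebra_mul (h2 p)).sub ((h2 p).algebra_mul (h1 p))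

variable [FiniteDimensional ℂ 𝒜] [IsManifold 𝓘(ℂ, EP) ω P]

namespace CutTriv

variable (T : B.CutTriv) (D : B.AdConnection) {s : ∀ x, B.AdFiber x} {p : P}

/-- The coordinate takes values in the image of `φ`, which the linear map `φ ∘ l` fixes; so does its
derivative. -/
theorem φ_l_mvfderiv_coordFun (hs : B.IsSmoothSection s) (hp : B.proj p ∈ T.V)
    (w : TangentSpace 𝓘(ℝ, EP) p) :
    ρ.φ (ρ.l (mvfderiv 𝓘(ℝ, EP) (T.coordFun ρ s) p w)) = mvfderiv 𝓘(ℝ, EP) (T.coordFun ρ s) p w := by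
  have h := mvfderiv_clm_comp ((ρ.φ ∘L ρ.l).restrictScalars ℝ)
    ((T.contMDiffAt_coordFun ρ hs (T.mem_U hp)).mdifferentiableAt (by simp)) w
  have e : (fun q => ((ρ.φ ∘L ρ.l).restrictScalars ℝ) (T.coordFun ρ s q)) = T.coordFun ρ s := by
    ext q
    have h1 : T.coordFun ρ s q = ρ.φ (Ad (T.γ q) (B.sectionFun s q)) := T.coordFun_eq ρ s q
    rw [h1]
    exact congrArg ρ.φ (ρ.l_φ _)
  rw [e] at h
  exact h.symm

include ρ in
/-- The connection on sections that are constant in the trivialization. -/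
theorem pullbackForm_eq_connMap (hs : B.IsSmoothSection s) {ξ : GroupLieAlgebra 𝓘(ℂ, EG) G}
    (hξ : ∀ q, B.proj q ∈ T.V → Ad (T.γ q) (B.sectionFun s q) = ξ) (hp : B.proj p ∈ T.V)
    (w : TangentSpace 𝓘(ℝ, EP) p) :
    B.pullbackForm (D.toFun s) p w = T.connMap D p w ξ := by
  have h := T.φ_pullbackForm ρ D hs hp w
  have e : T.coordFun ρ s =ᶠ[nhds p] fun _ => ρ.φ ξ := by
    filter_upwards [T.isOpen_preimage_V.mem_nhds hp] with q hq
    exact (T.coordFun_eq ρ s q).trans (congrArg (fun v : EG => ρ.φ v) (hξ q hq))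
  have h0 : mvfderiv 𝓘(ℝ, EP) (T.coordFun ρ s) p w = 0 := by
    rw [e.mvfderiv_eq, mvfderiv_const]
    rfl
  rw [h0, map_zero, map_zero, mul_zero, zero_mul, zero_add, hξ p hp] at h
  exact ρ.φ_injective h

theorem connMap_ext {p q : P} {w : TangentSpace 𝓘(ℝ, EP) p} {w' : TangentSpace 𝓘(ℝ, EP) q}
    {f : GroupLieAlgebra 𝓘(ℂ, EG) G →ₗ[ℂ] GroupLieAlgebra 𝓘(ℂ, EG) G}
    (h : ∀ s, B.IsSmoothSection s →
      B.pullbackForm (D.toFun s) q w' = f (B.pullbackForm (D.toFun s) p w))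
    (hb : ∀ ξ, B.IsSmoothSection (T.bump ξ)) :
    T.connMap D q w' = f ∘ₗ T.connMap D p w := by
  refine (lieBasis EG G).ext fun i => ?_
  rw [LinearMap.comp_apply, connMap, connMap, Module.Basis.constr_basis, Module.Basis.constr_basis]
  exact h _ (hb _)

/-- The endomorphism `connMap` in the trivialization. -/
def connEnd (p : P) (w : TangentSpace 𝓘(ℝ, EP) p) :
    GroupLieAlgebra 𝓘(ℂ, EG) G →ₗ[ℂ] GroupLieAlgebra 𝓘(ℂ, EG) G :=
  Ad (T.γ p) ∘ₗ T.connMap D p w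

-- Over `V` the bracket of the bump sections of `x` and `y` is constant equal to `⁅x, y⁆` in the
-- trivialization. Applying `D` to it by the Lie Leibniz rule gives the derivation identity.
include ρ in
theorem connEnd_lie (h : D.SatisfiesLieLeibniz) (hp : B.proj p ∈ T.V)
    (w : TangentSpace 𝓘(ℝ, EP) p) (x y : GroupLieAlgebra 𝓘(ℂ, EG) G) :
    T.connEnd D p w ⁅x, y⁆ = ⁅T.connEnd D p w x, y⁆ + ⁅x, T.connEnd D p w y⁆ := by
  have hx := T.isSmoothSection_bump ρ x
  have hy := T.isSmoothSection_bump ρ y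
  have h1 := T.pullbackForm_eq_connMap ρ D (ξ := ⁅x, y⁆) (hx.lie ρ hy) (fun q hq => by
    rw [B.sectionFun_lie, Ad_lie, T.Ad_sectionFun_bump x hq, T.Ad_sectionFun_bump y hq]) hp w
  rw [D.pullback_lie h hx hy,
    T.pullbackForm_eq_connMap ρ D hx (fun q hq => T.Ad_sectionFun_bump x hq) hp,
    T.pullbackForm_eq_connMap ρ D hy (fun q hq => T.Ad_sectionFun_bump y hq) hp] at h1
  simp only [connEnd, LinearMap.comp_apply]
  rw [← h1, map_add, Ad_lie, Ad_lie, T.Ad_sectionFun_bump x hp, T.Ad_sectionFun_bump y hp]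

-- Since `Ad` fixes `z`, the bump section of `z` is the section of `ℨ` given by `χ z`. Hence `D`
-- sends it to `d (χ z)`, which vanishes over `V`, where `χ = 1`.
include ρ in
theorem connEnd_center [ConnectedSpace G] (h : D.RestrictsToDOnCenter) (hp : B.proj p ∈ T.V)
    (w : TangentSpace 𝓘(ℝ, EP) p) {z : GroupLieAlgebra 𝓘(ℂ, EG) G}
    (hz : z ∈ LieAlgebra.center ℂ (GroupLieAlgebra 𝓘(ℂ, EG) G)) : T.connEnd D p w z = 0 := by
  have h1 := T.pullbackForm_eq_connMap ρ D (T.isSmoothSection_bump ρ z)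
    (fun q hq => T.Ad_sectionFun_bump z hq) hp w
  have hs : ∀ x (q : B.Fiber x), T.bump z x = B.adMk q (T.χ x • z) := by
    rintro x ⟨q, rfl⟩
    have h2 := T.sectionFun_bump z q
    rw [Ad_eq_of_mem_center ρ.contMDiff ρ.injective hz] at h2
    have h3 := congrArg (B.frame ⟨q, rfl⟩) h2
    exact ((B.frame ⟨q, rfl⟩).apply_symm_apply _).symm.trans h3
  have hsm : ∀ u : EG, ContMDiff 𝓘(ℝ, EX) 𝓘(ℝ, EG) ∞ (fun x => T.χ x • u) := fun u =>
    T.contMDiff_χ.complex_smul contMDiff_const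
  have h4 := h (T.bump z) (fun x => T.χ x • z) (hsm z)
    (fun x => (LieAlgebra.center ℂ (GroupLieAlgebra 𝓘(ℂ, EG) G)).smul_mem _ hz) hs (B.proj p)
    (B.dproj p w) ⟨p, rfl⟩
  have h5 : ∀ u : EG,
      mvfderiv 𝓘(ℝ, EX) (fun x => T.χ x • u) (B.proj p) (B.dproj p w) = 0 := by
    intro u
    have e : (fun x => T.χ x • u) =ᶠ[nhds (B.proj p)] fun _ => u := by
      filter_upwards [T.isOpen_V.mem_nhds hp] with y hy
      rw [T.χ_eq_one y hy, one_smul]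
    rw [e.mvfderiv_eq, mvfderiv_const]
    rfl
  have h6 : B.pullbackForm (D.toFun (T.bump z)) p w = 0 := by
    refine (congrArg (B.frame ⟨p, rfl⟩).symm h4).trans ?_
    refine ((B.frame ⟨p, rfl⟩).symm_apply_apply _).trans ?_
    exact h5 z
  rw [connEnd, LinearMap.comp_apply, ← h1, h6, map_zero]

end CutTriv

end HolomorphicPrincipalBundle

/-! ### Local connection forms -/

namespace HolomorphicPrincipalBundle

variable {EX : Type*} [NormedAddCommGroup EX] [NormedSpace ℂ EX]
  {X : Type*} [TopologicalSpace X] [ChartedSpace EX X]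
  {EG : Type*} [NormedAddCommGroup EG] [NormedSpace ℂ EG] [FiniteDimensional ℂ EG]
  {G : Type*} [TopologicalSpace G] [ChartedSpace EG G] [Group G] [LieGroup 𝓘(ℂ, EG) ω G]
  {EP : Type*} [NormedAddCommGroup EP] [NormedSpace ℂ EP]
  {P : Type*} [TopologicalSpace P] [ChartedSpace EP P] [IsManifold 𝓘(ℂ, EP) ω P]
  {B : HolomorphicPrincipalBundle EX X EG G EP P}

/-- A connection form over an open set of the base that induces a given connection on the adjoint
bundle. -/
structure LocalConnection (D : B.AdConnection) (V : Set X) where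
  form : ∀ p : P, TangentSpace 𝓘(ℝ, EP) p →ₗ[ℝ] GroupLieAlgebra 𝓘(ℂ, EG) G
  smooth : ∀ w₀ : TangentBundle 𝓘(ℝ, EP) P, B.proj w₀.proj ∈ V →
    ContMDiffAt (M' := EG) (𝓘(ℝ, EP).tangent) 𝓘(ℝ, EG) ∞
      (fun w : TangentBundle 𝓘(ℝ, EP) P => (form w.proj w.snd : EG)) w₀
  fundamental : ∀ p, B.proj p ∈ V → ∀ ξ : GroupLieAlgebra 𝓘(ℂ, EG) G,
    form p (mfderiv 𝓘(ℝ, EG) 𝓘(ℝ, EP) (fun g : G => B.act p g) 1 ξ : EP) = ξ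
  equivariant : ∀ p, B.proj p ∈ V → ∀ (g : G) (w : TangentSpace 𝓘(ℝ, EP) p),
    form (B.act p g) (mfderiv 𝓘(ℝ, EP) 𝓘(ℝ, EP) (fun q => B.act q g) p w) = Ad g⁻¹ (form p w)
  induces : ∀ s, B.IsSmoothSection s → ∀ p, B.proj p ∈ V → ∀ w : TangentSpace 𝓘(ℝ, EP) p,
    B.pullbackForm (D.toFun s) p w = B.dSectionFun s p w + ⁅form p w, B.sectionFun s p⁆
  compatible : D.IsCompatible → ∀ p, B.proj p ∈ V → ∀ w : TangentSpace 𝓘(ℝ, EP) p,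
    form p (tangentJ p w) = Complex.I • form p w

namespace CutTriv

variable {𝒜 : Type*} [NormedRing 𝒜] [NormedAlgebra ℂ 𝒜] [FiniteDimensional ℂ 𝒜]
  (ρ : InfFaithfulRep EG G 𝒜) (T : B.CutTriv) (D : B.AdConnection)
  (κ : (GroupLieAlgebra 𝓘(ℂ, EG) G →ₗ[ℂ] GroupLieAlgebra 𝓘(ℂ, EG) G) →ₗ[ℂ]
    GroupLieAlgebra 𝓘(ℂ, EG) G) {p : P}

theorem pullbackForm_add_right (η : ∀ x, TangentSpace 𝓘(ℝ, EX) x →ₗ[ℝ] B.AdFiber x)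
    (w w' : TangentSpace 𝓘(ℝ, EP) p) :
    B.pullbackForm η p (w + w') = B.pullbackForm η p w + B.pullbackForm η p w' := by
  simp only [pullbackForm, map_add]

theorem pullbackForm_smul_right (η : ∀ x, TangentSpace 𝓘(ℝ, EX) x →ₗ[ℝ] B.AdFiber x)
    (c : ℝ) (w : TangentSpace 𝓘(ℝ, EP) p) :
    B.pullbackForm η p (c • w) = c • B.pullbackForm η p w := by
  simp only [pullbackForm, map_smul]
  exact map_smul (B.frame ⟨p, rfl⟩).symm (c : ℂ) _

theorem connMap_add (w w' : TangentSpace 𝓘(ℝ, EP) p) :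
    T.connMap D p (w + w') = T.connMap D p w + T.connMap D p w' := by
  refine (lieBasis EG G).ext fun i => ?_
  simp only [connMap, LinearMap.add_apply, Module.Basis.constr_basis, pullbackForm_add_right]

theorem connMap_smul (c : ℝ) (w : TangentSpace 𝓘(ℝ, EP) p) :
    T.connMap D p (c • w) = (c : ℂ) • T.connMap D p w := by
  refine (lieBasis EG G).ext fun i => ?_
  simp only [connMap, LinearMap.smul_apply, Module.Basis.constr_basis, pullbackForm_smul_right]
  rfl

/-- The part of the connection form coming from the trivialization. -/
def flatForm (p : P) (w : TangentSpace 𝓘(ℝ, EP) p) : GroupLieAlgebra 𝓘(ℂ, EG) G :=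
  ρ.l (T.r' ρ p * mvfderiv 𝓘(ℝ, EP) (T.r ρ) p w)

/-- The part of the connection form coming from the connection on the adjoint bundle. -/
def adForm (p : P) (w : TangentSpace 𝓘(ℝ, EP) p) : GroupLieAlgebra 𝓘(ℂ, EG) G :=
  Ad (T.γ p)⁻¹ (κ (T.connEnd D p w))

/-- The connection form in a trivialization. -/
def localForm (p : P) : TangentSpace 𝓘(ℝ, EP) p →ₗ[ℝ] GroupLieAlgebra 𝓘(ℂ, EG) G where
  toFun w := T.flatForm ρ p w + T.adForm D κ p w
  map_add' w w' := by
    simp only [adForm, connEnd, connMap_add, LinearMap.comp_add, map_add]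
    have h : T.flatForm ρ p (w + w') = T.flatForm ρ p w + T.flatForm ρ p w' := by
      simp only [flatForm, map_add, mul_add]
      rfl
    rw [h]
    abel
  map_smul' c w := by
    have h : T.flatForm ρ p (c • w) = (c : ℂ) • T.flatForm ρ p w := by
      simp only [flatForm, map_smul, mul_smul_comm]
      exact map_smul ρ.l (c : ℂ) _
    simp only [adForm, connEnd, connMap_smul, LinearMap.comp_smul, map_smul]
    rw [h, ← smul_add]
    rfl

theorem localForm_apply (w : TangentSpace 𝓘(ℝ, EP) p) :
    T.localForm ρ D κ p w = T.flatForm ρ p w + T.adForm D κ p w := rfl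

/-- As `l` is only a left inverse of `φ`, this uses that `r⁻¹ dr` takes values in the image of `φ`.
-/
theorem φ_flatForm (hp : B.proj p ∈ T.V) (w : TangentSpace 𝓘(ℝ, EP) p) :
    ρ.φ (T.flatForm ρ p w) = T.r' ρ p * mvfderiv 𝓘(ℝ, EP) (T.r ρ) p w := by
  obtain ⟨m, hm⟩ := LocalTriv.exists_r'_mul_mvfderiv_r ρ (T.mem_U hp) w
  have h1 : T.flatForm ρ p w = ρ.l (T.r' ρ p * mvfderiv 𝓘(ℝ, EP) (T.r ρ) p w) := rfl
  rw [h1, hm]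
  exact congrArg ρ.φ (ρ.l_φ _)

/-- In the local formula for `D s`, the derivative of the coordinate contributes `d f + [r⁻¹ dr,
f]`, and `connMap` contributes the bracket with `adForm` because the derivation is inner. -/
theorem localForm_induces {s : ∀ x, B.AdFiber x} (hs : B.IsSmoothSection s) (hp : B.proj p ∈ T.V)
    (w : TangentSpace 𝓘(ℝ, EP) p)
    (hκ : ∀ x, T.connEnd D p w x = ⁅κ (T.connEnd D p w), x⁆) :
    B.pullbackForm (D.toFun s) p w =
      B.dSectionFun s p w + ⁅T.localForm ρ D κ p w, B.sectionFun s p⁆ := by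
  apply ρ.φ_injective
  have h1 := T.φ_pullbackForm ρ D hs hp w
  rw [T.φ_l_mvfderiv_coordFun ρ hs hp, LocalTriv.mvfderiv_coordFun ρ hs (T.mem_U hp),
    ← T.φ_flatForm ρ hp, ← φ_dSectionFun ρ hs] at h1
  have h2 : T.connMap D p w (Ad (T.γ p) (B.sectionFun s p)) =
      ⁅T.adForm D κ p w, B.sectionFun s p⁆ := by
    have h3 := congrArg (Ad (T.γ p)⁻¹) (hκ (Ad (T.γ p) (B.sectionFun s p)))
    rw [Ad_lie, Ad_inv_Ad, connEnd, LinearMap.comp_apply, Ad_inv_Ad] at h3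
    exact h3
  have h4 : ρ.φ (⁅T.flatForm ρ p w, B.sectionFun s p⁆ : GroupLieAlgebra 𝓘(ℂ, EG) G) =
      ρ.φ (T.flatForm ρ p w) * repFun ρ s p - repFun ρ s p * ρ.φ (T.flatForm ρ p w) :=
    ρ.φ_lie _ _
  rw [← h4, h2] at h1
  rw [localForm_apply, add_lie]
  refine h1.trans ?_
  rw [add_assoc]
  exact ((map_add ρ.φ _ _).trans (congrArg (_ + ·) (map_add ρ.φ _ _))).symm

/-- The flat part transforms correctly because `r (p g) = r p * R g`. In the other part `connEnd` is
invariant: the factor `Ad g⁻¹` of the pulled-back forms cancels against `γ (p g) = γ p * g`, which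
leaves the outer `Ad (γ p g)⁻¹`. -/
theorem localForm_equivariant (hp : B.proj p ∈ T.V) (g : G) (w : TangentSpace 𝓘(ℝ, EP) p) :
    T.localForm ρ D κ (B.act p g) (mfderiv 𝓘(ℝ, EP) 𝓘(ℝ, EP) (fun q => B.act q g) p w) =
      Ad g⁻¹ (T.localForm ρ D κ p w) := by
  have hpU := T.mem_U hp
  have hpg : B.proj (B.act p g) ∈ T.V := by rwa [B.proj_act]
  have had : MDifferentiableAt 𝓘(ℝ, EP) 𝓘(ℝ, EP) (fun q => B.act q g) p :=
    (B.holomorphic_act.comp (contMDiff_id.prodMk contMDiff_const)).restrictScalars.mdifferentiable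
      (by simp) p
  rw [localForm_apply, localForm_apply, map_add]
  congr 1
  · apply ρ.φ_injective
    have h1 := ρ.φ_Ad g⁻¹ (T.flatForm ρ p w)
    rw [inv_inv, T.φ_flatForm ρ hp] at h1
    refine (T.φ_flatForm ρ hpg _).trans (Eq.trans ?_ h1.symm)
    have h2 := mvfderiv_comp_mfderiv
      ((LocalTriv.contMDiffAt_r_real ρ (T.mem_U hpg)).mdifferentiableAt (by simp)) had rfl w
    have e : (fun q => T.r ρ (B.act q g)) =ᶠ[nhds p]
        fun q => (((ContinuousLinearMap.mul ℂ 𝒜).flip (ρ.R g)).restrictScalars ℝ) (T.r ρ q) := by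
      filter_upwards [T.isOpen_preimage_V.mem_nhds hp] with q hq
      exact LocalTriv.r_act ρ (T.mem_U hq) g
    have h3 := mvfderiv_clm_comp (((ContinuousLinearMap.mul ℂ 𝒜).flip (ρ.R g)).restrictScalars ℝ)
      ((LocalTriv.contMDiffAt_r_real ρ hpU).mdifferentiableAt (by simp)) w
    rw [e.mvfderiv_eq, h3] at h2
    rw [← h2, LocalTriv.r'_act ρ hpU]
    simp [mul_assoc]
  · have h1 : T.connMap D (B.act p g) (mfderiv 𝓘(ℝ, EP) 𝓘(ℝ, EP) (fun q => B.act q g) p w) =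
        Ad g⁻¹ ∘ₗ T.connMap D p w :=
      T.connMap_ext D (fun s _ => AdConnection.pullback_act (D.toFun s) p g w)
        (T.isSmoothSection_bump ρ)
    have h2 : T.connEnd D (B.act p g) (mfderiv 𝓘(ℝ, EP) 𝓘(ℝ, EP) (fun q => B.act q g) p w) =
        T.connEnd D p w := by
      rw [connEnd, h1, T.γ_act p hpU, ← LinearMap.comp_assoc, ← Ad_mul, mul_inv_cancel_right,
        connEnd]
    rw [adForm, h2, T.γ_act p hpU, mul_inv_rev, Ad_mul, LinearMap.comp_apply, adForm]

/-- The vector is vertical, so `connMap`, built from forms pulled back from `X`, vanishes on it.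
Differentiating `r (p g) = r p * R g` at `g = 1` shows that the flat part returns `ξ`. -/
theorem localForm_fundamental (hp : B.proj p ∈ T.V) (ξ : GroupLieAlgebra 𝓘(ℂ, EG) G) :
    T.localForm ρ D κ p (mfderiv 𝓘(ℝ, EG) 𝓘(ℝ, EP) (fun g : G => B.act p g) 1 ξ : EP) = ξ := by
  have hpU := T.mem_U hp
  have ha : MDifferentiableAt 𝓘(ℝ, EG) 𝓘(ℝ, EP) (fun g : G => B.act p g) 1 :=
    (B.holomorphic_act.comp (contMDiff_const.prodMk contMDiff_id)).restrictScalars.mdifferentiable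
      (by simp) 1
  have hp1 : B.proj p = B.proj (B.act p 1) := (B.proj_act p 1).symm
  set w : EP := (mfderiv 𝓘(ℝ, EG) 𝓘(ℝ, EP) (fun g : G => B.act p g) 1 : EG →L[ℝ] EP) ξ with hw
  have hproj : (B.dproj p w : EX) = 0 := by
    have aux : ∀ q (_ : q = p), (mfderiv 𝓘(ℝ, EP) 𝓘(ℝ, EX) B.proj q : EP →L[ℝ] EX) w =
        (mfderiv 𝓘(ℝ, EP) 𝓘(ℝ, EX) B.proj p : EP →L[ℝ] EX) w := by rintro _ rfl; rfl
    have hpd : MDifferentiableAt 𝓘(ℝ, EP) 𝓘(ℝ, EX) B.proj (B.act p 1) :=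
      contMDiff_proj_real.mdifferentiable (by simp) _
    have h2 := mfderiv_comp_apply (I' := 𝓘(ℝ, EP)) (1 : G) hpd ha ξ
    have e : B.proj ∘ (fun g => B.act p g) = fun _ => B.proj p := funext fun g => B.proj_act p g
    have h3 : (mfderiv 𝓘(ℝ, EG) 𝓘(ℝ, EX) (B.proj ∘ (fun g => B.act p g)) 1 : EG →L[ℝ] EX) ξ = 0 := by
      rw [e, mfderiv_const]; rfl
    exact ((aux _ (B.act_one p)).symm.trans h2.symm).trans h3
  have hconn : T.connMap D p w = 0 := by
    refine (lieBasis EG G).ext fun i => ?_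
    refine Eq.trans ((lieBasis EG G).constr_basis ℂ _ i) ?_
    refine (congrArg (fun v : EX => (B.frame ⟨p, rfl⟩).symm
      (D.toFun (T.bump (lieBasis EG G i)) (B.proj p) v)) hproj).trans ?_
    exact (congrArg (B.frame ⟨p, rfl⟩).symm (map_zero (D.toFun _ (B.proj p)))).trans (map_zero _)
  have hflat : T.flatForm ρ p w = ξ := by
    apply ρ.φ_injective
    refine (T.φ_flatForm ρ hp w).trans ?_
    have h1 := mvfderiv_comp_mfderiv
      ((LocalTriv.contMDiffAt_r_real ρ hpU).mdifferentiableAt (by simp)) ha (B.act_one p) ξ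
    have e : (fun g => T.r ρ (B.act p g)) =
        fun g => ((ContinuousLinearMap.mul ℂ 𝒜 (T.r ρ p)).restrictScalars ℝ) (ρ.R g) :=
      funext fun g => LocalTriv.r_act ρ hpU g
    have hRd : MDifferentiableAt 𝓘(ℂ, EG) 𝓘(ℂ, 𝒜) (fun g => ρ.R g) 1 :=
      ρ.contMDiff.mdifferentiable (by simp) 1
    have h2 := mvfderiv_clm_comp ((ContinuousLinearMap.mul ℂ 𝒜 (T.r ρ p)).restrictScalars ℝ)
      hRd.restrictScalars ξ
    have h3 : (mvfderiv 𝓘(ℝ, EG) (fun g => ρ.R g) (1 : G) : EG →L[ℝ] 𝒜) ξ = ρ.φ ξ :=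
      congrArg (fun L : EG →L[ℝ] 𝒜 => L ξ) hRd.mfderiv_real
    rw [e, h2] at h1
    refine (congrArg (T.r' ρ p * ·) h1.symm).trans ?_
    refine (congrArg (fun a => T.r' ρ p * (T.r ρ p * a)) h3).trans ?_
    rw [← mul_assoc, LocalTriv.r'_mul_r, one_mul]
  refine (localForm_apply ρ T D κ w).trans ?_
  have h0 : ∀ f : GroupLieAlgebra 𝓘(ℂ, EG) G →ₗ[ℂ] GroupLieAlgebra 𝓘(ℂ, EG) G, f = 0 →
      Ad (T.γ p)⁻¹ (κ (Ad (T.γ p) ∘ₗ f)) = 0 := by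
    rintro _ rfl
    rw [LinearMap.comp_zero, map_zero, map_zero]
  exact (congrArg₂ (· + ·) hflat (h0 _ hconn)).trans (add_zero ξ)

/-- The flat part has type (1,0) because `r` is holomorphic. Bump sections are holomorphic over `V`,
so compatibility makes `D` of them of type (1,0), and this passes through the complex linear `κ`. -/
theorem localForm_tangentJ (hD : D.IsCompatible) (hp : B.proj p ∈ T.V)
    (w : TangentSpace 𝓘(ℝ, EP) p) :
    T.localForm ρ D κ p (tangentJ p w) = Complex.I • T.localForm ρ D κ p w := by
  have hpU := T.mem_U hp
  rw [localForm_apply, localForm_apply, smul_add]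
  congr 1
  · apply ρ.φ_injective
    have h1 := ((LocalTriv.contMDiffAt_r ρ hpU).mdifferentiableAt (by simp)).mvfderiv_tangentJ w
    refine (T.φ_flatForm ρ hp _).trans ?_
    rw [h1, mul_smul_comm, ← T.φ_flatForm ρ hp]
    exact (map_smul ρ.φ _ _).symm
  · have h1 : T.connMap D p (tangentJ p w) = Complex.I • T.connMap D p w := by
      refine (lieBasis EG G).ext fun i => ?_
      rw [LinearMap.smul_apply, connMap, connMap, Module.Basis.constr_basis,
        Module.Basis.constr_basis]
      set s := T.bump (lieBasis EG G i) with hs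
      have h2 := congrArg (B.frame ⟨p, rfl⟩).symm (hD s (T.isSmoothSection_bump ρ _) p w)
      have h3 : B.dSectionFun s p (tangentJ p w) = Complex.I • B.dSectionFun s p w := by
        apply ρ.φ_injective
        -- Near `p` the cutoff is `1`, so the bump section becomes the holomorphic function `r⁻¹
        -- φ(eᵢ) r`.
        have e : repFun ρ s =ᶠ[nhds p] fun q => T.r' ρ q * ρ.φ (lieBasis EG G i) * T.r ρ q := by
          filter_upwards [T.isOpen_preimage_V.mem_nhds hp] with q hq
          rw [hs, T.repFun_bump, T.χ_eq_one _ hq, one_smul]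
        have hd : MDifferentiableAt 𝓘(ℂ, EP) 𝓘(ℂ, 𝒜) (repFun ρ s) p := by
          refine MDifferentiableAt.congr_of_eventuallyEq ?_ e
          exact (((LocalTriv.contMDiffAt_r' ρ hpU).mdifferentiableAt (by simp)).mul
            mdifferentiableAt_const).mul
            ((LocalTriv.contMDiffAt_r ρ hpU).mdifferentiableAt (by simp))
        refine (φ_dSectionFun ρ (T.isSmoothSection_bump ρ _) p _).trans ?_
        rw [hd.mvfderiv_tangentJ, ← φ_dSectionFun ρ (T.isSmoothSection_bump ρ _)]
        exact (map_smul ρ.φ _ _).symm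
      have h4 : (B.dproj p (tangentJ p w) : EX) = tangentJ (B.proj p) (B.dproj p w) :=
        (B.holomorphic_proj.mdifferentiable (by simp) p).mfderiv_tangentJ w
      have h5 : B.dSectionFun s p w + Complex.I • B.dSectionFun s p (tangentJ p w) = 0 := by
        rw [h3, smul_smul, Complex.I_mul_I, neg_one_smul, add_neg_cancel]
      rw [h5, smul_zero] at h2
      have h6 : B.pullbackForm (D.toFun s) p w +
          Complex.I • B.pullbackForm (D.toFun s) p (tangentJ p w) = 0 := by
        have h7 : (2⁻¹ : ℂ) • (B.pullbackForm (D.toFun s) p w +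
            Complex.I • B.pullbackForm (D.toFun s) p (tangentJ p w)) = 0 := by
          refine Eq.trans ?_ (h2.trans ((B.frame ⟨p, rfl⟩).symm_apply_apply 0))
          refine Eq.trans ?_ (map_smul (B.frame ⟨p, rfl⟩).symm _ _).symm
          refine congrArg ((2⁻¹ : ℂ) • ·) ?_
          refine Eq.trans ?_ (map_add (B.frame ⟨p, rfl⟩).symm _ _).symm
          refine congrArg (B.pullbackForm (D.toFun s) p w + ·) ?_
          refine Eq.trans ?_ (map_smul (B.frame ⟨p, rfl⟩).symm _ _).symm
          exact congrArg (fun v : EX => Complex.I • (B.frame ⟨p, rfl⟩).symm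
            (D.toFun s (B.proj p) v)) h4
        exact (smul_eq_zero.1 h7).resolve_left (by norm_num)
      have h8 := congrArg (Complex.I • ·) h6
      simp only [smul_add, smul_smul, Complex.I_mul_I, neg_one_smul, smul_zero] at h8
      exact (add_neg_eq_zero.1 h8).symm
    rw [adForm, adForm, connEnd, connEnd, h1, LinearMap.comp_smul, map_smul, map_smul]

end CutTriv

end HolomorphicPrincipalBundle

/-! ### Smoothness of the local forms on the tangent bundle -/

theorem ContMDiffOn.contMDiffAt_mvfderiv {E F : Type*} [NormedAddCommGroup E] [NormedSpace ℝ E]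
    [NormedAddCommGroup F] [NormedSpace ℝ F] {M : Type*} [TopologicalSpace M] [ChartedSpace E M]
    [IsManifold 𝓘(ℝ, E) ∞ M] {f : M → F} {U : Set M} (hf : ContMDiffOn 𝓘(ℝ, E) 𝓘(ℝ, F) ∞ f U)
    (hU : IsOpen U) {w₀ : TangentBundle 𝓘(ℝ, E) M} (hw : w₀.proj ∈ U) :
    ContMDiffAt 𝓘(ℝ, E).tangent 𝓘(ℝ, F) ∞
      (fun w : TangentBundle 𝓘(ℝ, E) M => mvfderiv 𝓘(ℝ, E) f w.proj w.snd) w₀ := by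
  have ho : IsOpen (Bundle.TotalSpace.proj ⁻¹' U : Set (TangentBundle 𝓘(ℝ, E) M)) :=
    hU.preimage (FiberBundle.continuous_proj E _)
  have h1 := (hf.contMDiffOn_tangentMapWithin (m := ∞) (by simp) hU.uniqueMDiffOn).contMDiffAt
    (ho.mem_nhds hw)
  have h2 := (contMDiff_snd_tangentBundle_modelSpace F 𝓘(ℝ, F) (n := ∞)).contMDiffAt.comp w₀ h1
  refine h2.congr_of_eventuallyEq ?_
  filter_upwards [ho.mem_nhds hw] with w hw
  have h3 := mfderivWithin_of_isOpen (I := 𝓘(ℝ, E)) (I' := 𝓘(ℝ, F)) (f := f) hU hw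
  exact (congrArg (fun L : E →L[ℝ] F => L w.snd) h3).symm

theorem ContMDiffAt.complex_clm {E : Type*} [NormedAddCommGroup E] [NormedSpace ℝ E] {H : Type*}
    [TopologicalSpace H] {I : ModelWithCorners ℝ E H} {M : Type*} [TopologicalSpace M]
    [ChartedSpace H M] {F F' : Type*} [NormedAddCommGroup F] [NormedSpace ℂ F]
    [NormedAddCommGroup F'] [NormedSpace ℂ F'] {n : ℕ∞ω} (L : F →L[ℂ] F') {f : M → F} {x : M}
    (hf : ContMDiffAt I 𝓘(ℝ, F) n f x) : ContMDiffAt I 𝓘(ℝ, F') n (fun y => L (f y)) x :=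
  (L.restrictScalars ℝ).contMDiff.contMDiffAt.comp x hf

namespace HolomorphicPrincipalBundle

variable {EX : Type*} [NormedAddCommGroup EX] [NormedSpace ℂ EX]
  {X : Type*} [TopologicalSpace X] [ChartedSpace EX X]
  {EG : Type*} [NormedAddCommGroup EG] [NormedSpace ℂ EG] [FiniteDimensional ℂ EG]
  {G : Type*} [TopologicalSpace G] [ChartedSpace EG G] [Group G] [LieGroup 𝓘(ℂ, EG) ω G]
  {EP : Type*} [NormedAddCommGroup EP] [NormedSpace ℂ EP]
  {P : Type*} [TopologicalSpace P] [ChartedSpace EP P] [IsManifold 𝓘(ℂ, EP) ω P]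
  {B : HolomorphicPrincipalBundle EX X EG G EP P}

namespace CutTriv

variable {𝒜 : Type*} [NormedRing 𝒜] [NormedAlgebra ℂ 𝒜] [FiniteDimensional ℂ 𝒜]
  (ρ : InfFaithfulRep EG G 𝒜) (T : B.CutTriv) (D : B.AdConnection)
  (κ : (GroupLieAlgebra 𝓘(ℂ, EG) G →ₗ[ℂ] GroupLieAlgebra 𝓘(ℂ, EG) G) →ₗ[ℂ]
    GroupLieAlgebra 𝓘(ℂ, EG) G)

theorem Ad_eq_l (g : G) (v : GroupLieAlgebra 𝓘(ℂ, EG) G) :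
    Ad g v = ρ.l (ρ.R g * ρ.φ v * ρ.R g⁻¹) :=
  (ρ.l_φ (Ad g v)).symm.trans (congrArg ρ.l (ρ.φ_Ad g v))

/-- The value of `κ` on the map sending one basis vector to a given vector and the others to
zero. -/
def kappaCoord (i : Fin (Module.finrank ℂ EG)) : EG →L[ℂ] EG :=
  LinearMap.toContinuousLinearMap (κ ∘ₗ ((lieBasis EG G).constr ℂ :
    (_ → GroupLieAlgebra 𝓘(ℂ, EG) G) ≃ₗ[ℂ] _).toLinearMap ∘ₗ
      LinearMap.single ℂ (fun _ => GroupLieAlgebra 𝓘(ℂ, EG) G) i : EG →ₗ[ℂ] EG)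

/-- This writes the form as fixed linear maps applied to finitely many forms `D (bump)`, whose
smoothness is part of the definition of a connection on `𝔈`. -/
theorem kappa_connEnd (p : P) (w : TangentSpace 𝓘(ℝ, EP) p) :
    κ (T.connEnd D p w) = ∑ i, kappaCoord κ i (Ad (EG := EG) (T.γ p)
      (B.pullbackForm (D.toFun (T.bump (lieBasis EG G i))) p w)) := by
  have h : T.connEnd D p w = (lieBasis EG G).constr ℂ fun i =>
      Ad (T.γ p) (B.pullbackForm (D.toFun (T.bump (lieBasis EG G i))) p w) := by
    refine (lieBasis EG G).ext fun i => ?_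
    rw [connEnd, LinearMap.comp_apply, connMap, Module.Basis.constr_basis,
      Module.Basis.constr_basis]
  rw [h, ← Finset.univ_sum_single fun i =>
    Ad (T.γ p) (B.pullbackForm (D.toFun (T.bump (lieBasis EG G i))) p w), map_sum, map_sum]
  rfl

theorem contMDiffAt_localForm {w₀ : TangentBundle 𝓘(ℝ, EP) P} (hw : B.proj w₀.proj ∈ T.U) :
    ContMDiffAt (M' := EG) (𝓘(ℝ, EP).tangent) 𝓘(ℝ, EG) ∞
      (fun w : TangentBundle 𝓘(ℝ, EP) P => (T.localForm ρ D κ w.proj w.snd : EG)) w₀ := by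
  have : IsManifold 𝓘(ℝ, EP) ∞ P := IsManifold.of_le (n := ω) (by simp)
  have hproj : ContMDiffAt 𝓘(ℝ, EP).tangent 𝓘(ℝ, EP) ∞
      (fun w : TangentBundle 𝓘(ℝ, EP) P => w.proj) w₀ :=
    Bundle.contMDiff_proj _ w₀
  have hr : ContMDiffAt 𝓘(ℝ, EP).tangent 𝓘(ℝ, 𝒜) ∞
      (fun w : TangentBundle 𝓘(ℝ, EP) P => T.r ρ w.proj) w₀ :=
    (LocalTriv.contMDiffAt_r_real ρ hw).comp w₀ hproj
  have hr' : ContMDiffAt 𝓘(ℝ, EP).tangent 𝓘(ℝ, 𝒜) ∞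
      (fun w : TangentBundle 𝓘(ℝ, EP) P => T.r' ρ w.proj) w₀ :=
    (LocalTriv.contMDiffAt_r'_real ρ hw).comp w₀ hproj
  have hdr : ContMDiffAt 𝓘(ℝ, EP).tangent 𝓘(ℝ, 𝒜) ∞
      (fun w : TangentBundle 𝓘(ℝ, EP) P => mvfderiv 𝓘(ℝ, EP) (T.r ρ) w.proj w.snd) w₀ :=
    ContMDiffOn.contMDiffAt_mvfderiv (U := B.proj ⁻¹' T.U)
      (fun q hq => (LocalTriv.contMDiffAt_r_real ρ hq).contMDiffWithinAt)
      LocalTriv.isOpen_preimage hw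
  have hpull : ∀ i, ContMDiffAt (M' := EG) 𝓘(ℝ, EP).tangent 𝓘(ℝ, EG) ∞
      (fun w : TangentBundle 𝓘(ℝ, EP) P =>
        (B.pullbackForm (D.toFun (T.bump (lieBasis EG G i))) w.proj w.snd : EG)) w₀ := fun i =>
    D.smooth _ (T.isSmoothSection_bump ρ _) w₀
  have hκ : ContMDiffAt (M' := EG) 𝓘(ℝ, EP).tangent 𝓘(ℝ, EG) ∞
      (fun w : TangentBundle 𝓘(ℝ, EP) P => (κ (T.connEnd D w.proj w.snd) : EG)) w₀ := by
    have h := contMDiffAt_finsetSum (I' := 𝓘(ℝ, EP).tangent) (I := 𝓘(ℝ, EG)) (n := ∞) (x := w₀)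
      (t := Finset.univ) (f := fun i (w : TangentBundle 𝓘(ℝ, EP) P) => kappaCoord (G := G) κ i (ρ.l
        (T.r ρ w.proj * ρ.φ (B.pullbackForm (D.toFun (T.bump (lieBasis EG G i))) w.proj w.snd) *
          T.r' ρ w.proj))) fun i _ =>
      ((hr.algebra_mul ((hpull i).complex_clm ρ.φ)).algebra_mul hr').complex_clm (ρ.l) |>.complex_clm _
    refine h.congr_of_eventuallyEq (Filter.Eventually.of_forall fun w => ?_)
    refine (T.kappa_connEnd D κ w.proj w.snd).trans ?_
    exact Finset.sum_congr rfl fun i _ => congrArg (kappaCoord κ i) (Ad_eq_l ρ _ _)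
  have had : ContMDiffAt (M' := EG) 𝓘(ℝ, EP).tangent 𝓘(ℝ, EG) ∞
      (fun w : TangentBundle 𝓘(ℝ, EP) P => (T.adForm D κ w.proj w.snd : EG)) w₀ := by
    refine (((hr'.algebra_mul (hκ.complex_clm ρ.φ)).algebra_mul hr).complex_clm
      ρ.l).congr_of_eventuallyEq (Filter.Eventually.of_forall fun w => ?_)
    have h := Ad_eq_l ρ (T.γ w.proj)⁻¹ (κ (T.connEnd D w.proj w.snd))
    rw [inv_inv] at h
    exact h
  exact ((hr'.algebra_mul hdr).complex_clm ρ.l).add had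

end CutTriv

theorem exists_localConnection [FiniteDimensional ℂ EX] [T2Space X] [IsManifold 𝓘(ℂ, EX) ω X]
    [ConnectedSpace G] {𝒜 : Type*} [NormedRing 𝒜] [NormedAlgebra ℂ 𝒜] [FiniteDimensional ℂ 𝒜]
    (ρ : InfFaithfulRep EG G 𝒜)
    [LieAlgebra.HasCentralRadical ℂ (GroupLieAlgebra 𝓘(ℂ, EG) G)] (D : B.AdConnection)
    (lieLeibniz : D.SatisfiesLieLeibniz) (center : D.RestrictsToDOnCenter) (x : X) :
    ∃ V : Set X, IsOpen V ∧ x ∈ V ∧ Nonempty (LocalConnection D V) := by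
  have : FiniteDimensional ℂ (GroupLieAlgebra 𝓘(ℂ, EG) G) :=
    inferInstanceAs (FiniteDimensional ℂ EG)
  obtain ⟨T, hx⟩ := exists_cutTriv (B := B) x
  obtain ⟨κ, hκ⟩ := LieAlgebra.exists_linearMap_derivation (k := ℂ)
    (L := GroupLieAlgebra 𝓘(ℂ, EG) G)
  exact ⟨T.V, T.isOpen_V, hx, ⟨{
    form := T.localForm ρ D κ
    smooth := fun w₀ hw => T.contMDiffAt_localForm ρ D κ (T.mem_U hw)
    fundamental := fun p hp => T.localForm_fundamental ρ D κ hp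
    equivariant := fun p hp => T.localForm_equivariant ρ D κ hp
    induces := fun s hs p hp w => T.localForm_induces ρ D κ hs hp w
      (hκ _ (T.connEnd_lie ρ D lieLeibniz hp w) fun z hz => T.connEnd_center ρ D center hp w hz)
    compatible := fun hD p hp => T.localForm_tangentJ ρ D κ hD hp }⟩⟩

/-! ### Gluing by a partition of unity -/

section Gluing

variable [FiniteDimensional ℂ EX] [T2Space X] [SigmaCompactSpace X] [IsManifold 𝓘(ℂ, EX) ω X]
  {D : B.AdConnection} {V : X → Set X}

/-- The combination of local connection forms with a partition of unity. -/
def glueForm (A : ∀ i, LocalConnection D (V i))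
    (μ : SmoothPartitionOfUnity X 𝓘(ℝ, EX) X Set.univ) (p : P) :
    TangentSpace 𝓘(ℝ, EP) p →ₗ[ℝ] GroupLieAlgebra 𝓘(ℂ, EG) G :=
  ∑ i ∈ μ.finsupport (B.proj p), μ i (B.proj p) • (A i).form p

variable (A : ∀ i, LocalConnection D (V i)) (μ : SmoothPartitionOfUnity X 𝓘(ℝ, EX) X Set.univ)

theorem glueForm_apply (p : P) (w : TangentSpace 𝓘(ℝ, EP) p) :
    glueForm A μ p w =
      ∑ i ∈ μ.finsupport (B.proj p), (μ i (B.proj p) : ℂ) • (A i).form p w := by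
  rw [glueForm, LinearMap.sum_apply]
  rfl

theorem sum_complex_smul (x : X) (v : GroupLieAlgebra 𝓘(ℂ, EG) G) :
    ∑ i ∈ μ.finsupport x, (μ i x : ℂ) • v = v := by
  rw [← Finset.sum_smul, ← Complex.ofReal_sum, μ.sum_finsupport x (Set.mem_univ x),
    Complex.ofReal_one, one_smul]

variable {μ} (hμ : μ.IsSubordinate V)

include hμ in
theorem mem_of_mem_finsupport {x : X} {i : X} (hi : i ∈ μ.finsupport x) : x ∈ V i :=
  hμ i (subset_tsupport _ ((μ.mem_finsupport x).1 hi))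

include hμ in
theorem contMDiff_glueForm : IsSmoothForm (fun p => glueForm A μ p) := by
  intro w₀
  have : IsManifold 𝓘(ℝ, EP) ∞ P := IsManifold.of_le (n := ω) (by simp)
  have hproj : ContMDiff 𝓘(ℝ, EP).tangent 𝓘(ℝ, EX) ∞
      (fun w : TangentBundle 𝓘(ℝ, EP) P => B.proj w.proj) :=
    contMDiff_proj_real.comp (Bundle.contMDiff_proj _)
  have hterm : ∀ i, B.proj w₀.proj ∈ V i → ContMDiffAt (M' := EG) 𝓘(ℝ, EP).tangent 𝓘(ℝ, EG) ∞
      (fun w : TangentBundle 𝓘(ℝ, EP) P =>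
        ((μ i (B.proj w.proj) : ℂ) • (A i).form w.proj w.snd : EG)) w₀ := fun i hi =>
    ContMDiffAt.complex_smul
      ((Complex.ofRealCLM.contMDiff.comp ((μ i).contMDiff.comp hproj)) w₀) ((A i).smooth w₀ hi)
  -- The index set in `glueForm` varies with the point; near `w₀` it lies in the fixed finite set of
  -- indices whose closed support contains the base point, and the extra terms vanish.
  have h0 := contMDiffAt_finsetSum (t := μ.fintsupport (B.proj w₀.proj)) fun i hi =>
    hterm i (hμ i ((μ.mem_fintsupport_iff _ i).1 hi))
  refine h0.congr_of_eventuallyEq ?_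
  filter_upwards [hproj.continuous.continuousAt.eventually (μ.eventually_finsupport_subset _)]
    with w hw
  refine (glueForm_apply A μ w.proj w.snd).trans ?_
  refine Finset.sum_subset hw fun i _ hi => ?_
  have : μ i (B.proj w.proj) = 0 := by
    by_contra h
    exact hi ((μ.mem_finsupport _).2 h)
  rw [this, Complex.ofReal_zero, zero_smul]

-- The vertical and inducing conditions are affine in the form and use that the weights sum to one;
-- equivariance and type (1,0) are linear. The weights are constant along fibres, so right
-- translation leaves them unchanged.
include A hμ in
theorem exists_principalConnection_of_local : ∃ C : B.PrincipalConnection,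
    C.Induces D ∧ (D.IsCompatible → C.IsCompatible) := by
  refine ⟨⟨glueForm A μ, contMDiff_glueForm A hμ, fun p ξ => ?_, fun p g w => ?_⟩,
    fun s hs p w => ?_, fun hD p w => ?_⟩
  · refine (glueForm_apply A μ p _).trans (Eq.trans ?_ (sum_complex_smul μ (B.proj p) ξ))
    exact Finset.sum_congr rfl fun i hi =>
      congrArg (_ • ·) ((A i).fundamental p (mem_of_mem_finsupport hμ hi) ξ)
  · refine (glueForm_apply A μ _ _).trans ?_
    rw [glueForm_apply, map_sum, B.proj_act]
    refine Finset.sum_congr rfl fun i hi => ?_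
    rw [map_smul]
    exact congrArg (_ • ·) ((A i).equivariant p (mem_of_mem_finsupport hμ hi) g w)
  · change _ = _ + ⁅glueForm A μ p w, _⁆
    rw [glueForm_apply, sum_lie]
    refine Eq.trans (sum_complex_smul μ (B.proj p) _).symm (Eq.trans ?_
      (congrArg (· + _) (sum_complex_smul μ (B.proj p) (B.dSectionFun s p w))))
    rw [← Finset.sum_add_distrib]
    refine Finset.sum_congr rfl fun i hi => ?_
    rw [(A i).induces s hs p (mem_of_mem_finsupport hμ hi), smul_add, smul_lie]
  · change glueForm A μ p _ = _ • glueForm A μ p w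
    rw [glueForm_apply, glueForm_apply, Finset.smul_sum]
    refine Finset.sum_congr rfl fun i hi => ?_
    rw [(A i).compatible hD p (mem_of_mem_finsupport hμ hi), smul_comm]

end Gluing

end HolomorphicPrincipalBundle

end

theorem mainTheorem8
    {EX : Type*} [NormedAddCommGroup EX] [NormedSpace ℂ EX] [FiniteDimensional ℂ EX]
    {X : Type*} [TopologicalSpace X] [T2Space X] [SigmaCompactSpace X]
    [ChartedSpace EX X] [IsManifold 𝓘(ℂ, EX) ω X]
    {EG : Type*} [NormedAddCommGroup EG] [NormedSpace ℂ EG] [FiniteDimensional ℂ EG]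
    {G : Type*} [TopologicalSpace G] [ConnectedSpace G]
    [ChartedSpace EG G] [Group G] [LieGroup 𝓘(ℂ, EG) ω G]
    (alg : LinearAlgebraicStructure EG G) (reductive : alg.IsReductive)
    {EP : Type*} [NormedAddCommGroup EP] [NormedSpace ℂ EP] [FiniteDimensional ℂ EP]
    {P : Type*} [TopologicalSpace P] [ChartedSpace EP P] [IsManifold 𝓘(ℂ, EP) ω P]
    (B : HolomorphicPrincipalBundle EX X EG G EP P) (D : B.AdConnection)
    (lieLeibniz : D.SatisfiesLieLeibniz) (center : D.RestrictsToDOnCenter) :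
    ∃ A : B.PrincipalConnection, A.Induces D ∧ (D.IsCompatible → A.IsCompatible) := by
  have : LieAlgebra.HasCentralRadical ℂ (GroupLieAlgebra 𝓘(ℂ, EG) G) :=
    alg.hasCentralRadical reductive
  let ρ : InfFaithfulRep EG G ((Fin alg.n → ℂ) →L[ℂ] (Fin alg.n → ℂ)) :=
    ⟨alg.rep, alg.contMDiff_rep, alg.repDeriv_injective⟩
  have : IsManifold 𝓘(ℝ, EX) ∞ X := IsManifold.of_le (n := ω) (by simp)
  have : FiniteDimensional ℝ EX := FiniteDimensional.complexToReal EX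
  choose V hVo hxV hA using
    HolomorphicPrincipalBundle.exists_localConnection ρ D lieLeibniz center
  obtain ⟨μ, hμ⟩ := SmoothPartitionOfUnity.exists_isSubordinate 𝓘(ℝ, EX) isClosed_univ V hVo
    fun x _ => Set.mem_iUnion_of_mem x (hxV x)
  exact HolomorphicPrincipalBundle.exists_principalConnection_of_local (fun i => (hA i).some) hμ
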